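/- All manifolds, distributions and vector fields are of class $C^\infty$. Let $X$ be a (Hausdorff) manifold of dimension $7$ and $D\subset TX$ a hyperbolic $(4,7)$-distribution: a distribution of rank $4$ with $D+[D,D]=TX$ such that near each point of $X$ there is an adapted frame, i.e. a local frame $\xi_1,\xi_2,\xi_3,\xi_4$ of $D$ with $[\xi_1,\xi_2]\equiv 0$, $[\xi_3,\xi_4]\equiv 0$, $[\xi_1,\xi_4]\equiv[\xi_2,\xi_3]$ modulo $D$, for which $\xi_1,\xi_2,\xi_3,\xi_4,[\xi_1,\xi_3],[\xi_1,\xi_4],[\xi_2,\xi_4]$ is a local frame of $TX$. The characteristic cone is $C=\{(x,\sum_i u_i\xi_i(x)) : u_1u_4-u_2u_3=0\}\subset D$ (independent of the adapted frame). Let $Z=PC=\{(x,[u]) : (x,u)\in C,\ u\ne 0\}$, a $9$-dimensional manifold with projection $\pi:Z\to X$, and let $E\subset TZ$ be the rank $3$ distribution $E_{(x,[u])}=\{v\in T_{(x,[u])}Z : \pi_*v\in\mathbf{R}u\}$. With $\mathcal E^{(1)}$ the sheaf of sections of $E$ and $\mathcal E^{(r+1)}=\mathcal E^{(r)}+[\mathcal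 E^{(1)},\mathcal E^{(r)}]$, the small growth of $E$ at $z\in Z$ is the sequence of the dimensions of the spaces of values at $z$ of $\mathcal E^{(1)},\mathcal E^{(2)},\mathcal E^{(3)},\dots$. A direction $[u_0]\in P(C_{x_0})$ is of $C_3$-type if $E$ has small growth $(3,5,7,8,9)$ at all points of a neighbourhood of $(x_0,[u_0])$ in $Z$, and of regular type if $E$ has small growth $(3,5,7,9)$ at $(x_0,[u_0])$. A $D$-integral curve $\gamma$ on $[a,b]$ is $D$-singular if it is a critical point of the endpoint map $c\mapsto c(b)$ on the space of $D$-integral curves $c$ on $[a,b]$ with $c(a)=\gamma(a)$, i.e. if the differential of the endpoint map at $\gamma$ is not surjective onto $T_{\gamma(b)}X$. A germ $\gamma:(\mathbf{R},0)\to X$ of a $C^\infty$ integral curve is a $D$-singular curve if its restrictions to all sufficiently small intervals $[-\varepsilon,\varepsilon]$ are $D$-singular, and a $D$-singular path if moreover it is an immersion. The singular velocity cone $SVC\subset TX$ is the set of all $(x,u)$ such that there is a $C^\infty$ $D$-singular curve $\gamma:(\mathbf{R},0)\to X$ with $\gamma(0)=x$ and $\gamma'(0)=u$. **Theorem.** Let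 $x_0\in X$ and $u_0\in C_{x_0}\setminus\{0\}$. (1) If $[u_0]$ is of $C_3$-type, then there exists a $D$-singular path $\gamma:(\mathbf{R},0)\to X$ with $\gamma(0)=x_0$ and $\gamma'(0)=u_0$; and therefore $(x_0,u_0)\in SVC$. (2) If $[u_0]$ is of regular type, then there exists no $D$-singular path $\gamma:(\mathbf{R},0)\to X$ with $\gamma(0)=x_0$ and $\gamma'(0)=u_0$; and therefore $(x_0,u_0)\notin SVC$. -/

import Mathlib

open Set Filter
open scoped Manifold ContDiff Topology

noncomputable section

namespace FourSeven

section General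

variable {E : Type*} [NormedAddCommGroup E] [NormedSpace ℝ E] {H : Type*} [TopologicalSpace H]
  (I : ModelWithCorners ℝ E H) {M : Type*} [TopologicalSpace M] [ChartedSpace H M]
  [IsManifold I ∞ M]

/-- The (possibly only locally meaningful) vector field `V` is of class `C^∞` on `U`. -/
def SmoothFieldOn (U : Set M) (V : Π x : M, TangentSpace I x) : Prop :=
  ContMDiffOn I I.tangent ∞ (fun x => (⟨x, V x⟩ : TangentBundle I M)) U

/-- `C^∞` sections over `U` of a field `Δ` of tangent subspaces. -/
def sectionsOn (Δ : Π x : M, Submodule ℝ (TangentSpace I x)) (U : Set M) :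
    Set (Π x : M, TangentSpace I x) :=
  {V | SmoothFieldOn I U V ∧ ∀ x ∈ U, V x ∈ Δ x}

/-- The weak derived system over `U`, with index shifted by one: `weakDerived I Δ U r` is
`Δ^{(r+1)}`, where `Δ^{(1)}` consists of the sections of `Δ` and
`Δ^{(r+1)} = Δ^{(r)} + [Δ, Δ^{(r)}]`. -/
def weakDerived (Δ : Π x : M, Submodule ℝ (TangentSpace I x)) (U : Set M) :
    ℕ → Submodule ℝ (Π x : M, TangentSpace I x)
  | 0 => Submodule.span ℝ (sectionsOn I Δ U)
  | r + 1 => weakDerived Δ U r ⊔ Submodule.span ℝ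
      {B | ∃ V ∈ sectionsOn I Δ U, ∃ W ∈ weakDerived Δ U r, B = VectorField.mlieBracket I V W}

/-- The values at `z` of the germs at `z` of sections of `Δ^{(r+1)}`. -/
def derivedFiber (Δ : Π x : M, Submodule ℝ (TangentSpace I x)) (r : ℕ) (z : M) :
    Submodule ℝ (TangentSpace I z) :=
  Submodule.span ℝ {w | ∃ U : Set M, IsOpen U ∧ z ∈ U ∧ ∃ V ∈ weakDerived I Δ U r, V z = w}

/-- The small growth of `Δ` at `z`, that is, the sequence
`(rank_z Δ^{(1)}, rank_z Δ^{(2)}, ...)`, begins with the entries of `g`. -/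
def HasSmallGrowth (Δ : Π x : M, Submodule ℝ (TangentSpace I x)) (z : M) (g : List ℕ) : Prop :=
  ∀ i : Fin g.length, Module.finrank ℝ (derivedFiber I Δ i z) = g.get i

/-- `ξ` is a `C^∞` frame of `Δ` over `U`. -/
def IsFrameOn {k : ℕ} (Δ : Π x : M, Submodule ℝ (TangentSpace I x)) (U : Set M)
    (ξ : Fin k → Π x : M, TangentSpace I x) : Prop :=
  (∀ i, SmoothFieldOn I U (ξ i)) ∧
    ∀ x ∈ U, LinearIndependent ℝ (fun i => ξ i x) ∧
      Submodule.span ℝ (Set.range fun i => ξ i x) = Δ x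

/-- `Δ` is a `C^∞` distribution (subbundle of the tangent bundle) of rank `k`. -/
def IsDistribution (k : ℕ) (Δ : Π x : M, Submodule ℝ (TangentSpace I x)) : Prop :=
  ∀ x : M, ∃ U : Set M, IsOpen U ∧ x ∈ U ∧
    ∃ ξ : Fin k → Π x : M, TangentSpace I x, IsFrameOn I Δ U ξ

/-- The velocity of the curve `c` at time `t`, as a point of the tangent bundle (meaningful if `c`
is differentiable at `t`). -/
def velocity (c : ℝ → M) (t : ℝ) : TangentBundle I M :=
  ⟨c t, mfderiv 𝓘(ℝ, ℝ) I c t (1 : ℝ)⟩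

/-- `Γ` is a variation of the curve `γ : [a, b] → M` through integral curves of `Δ` with the same
initial point: for finitely many `C^∞` sections `ξ j` of `Δ` over an open set, a control `u` of `γ`
and a direction `v` in the space of controls, the curve `Γ s` is the trajectory with
initial point `γ a` and control `u + s v`, i.e. `(Γ s)' = ∑ j, (u j + s v j) ξ j (Γ s)`. -/
def IsControlledVariation (Δ : Π x : M, Submodule ℝ (TangentSpace I x)) (γ : ℝ → M) (a b : ℝ)
    (Γ : ℝ → ℝ → M) : Prop :=
  ∃ (m : ℕ) (ξ : Fin m → Π x : M, TangentSpace I x) (U : Set M) (u v : Fin m → ℝ → ℝ),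
    IsOpen U ∧ (∀ j, ξ j ∈ sectionsOn I Δ U) ∧
    (∀ j, ContinuousOn (u j) (Icc a b) ∧ ContinuousOn (v j) (Icc a b)) ∧
    (∀ t ∈ Icc a b, Γ 0 t = γ t) ∧
    ∀ᶠ s in 𝓝 (0 : ℝ), Γ s a = γ a ∧ ∀ t ∈ Icc a b, Γ s t ∈ U ∧
      HasMFDerivWithinAt 𝓘(ℝ, ℝ) I (Γ s) (Icc a b) t
        (ContinuousLinearMap.smulRight (1 : ℝ →L[ℝ] ℝ)
          (∑ j, (u j t + s * v j t) • ξ j (Γ s t)))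

/-- The image of the differential at `γ` of the endpoint map `c ↦ c b`, defined on the integral
curves `c : [a, b] → M` of `Δ` with initial point `γ a`: the derivatives of the endpoint at `s = 0`
along the variations of `γ` by integral curves with that initial point. -/
def endpointDifferentialImage (Δ : Π x : M, Submodule ℝ (TangentSpace I x)) (γ : ℝ → M)
    (a b : ℝ) : Set (TangentSpace I (γ b)) :=
  {w | ∃ Γ : ℝ → ℝ → M, IsControlledVariation I Δ γ a b Γ ∧
    MDifferentiableAt 𝓘(ℝ, ℝ) I (fun s => Γ s b) 0 ∧
    velocity I (fun s => Γ s b) 0 = ⟨γ b, w⟩}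

/-- `γ : [a, b] → M` is a critical point of the endpoint map: the differential of the endpoint map
at `γ` is not surjective. -/
def IsEndpointCritical (Δ : Π x : M, Submodule ℝ (TangentSpace I x)) (γ : ℝ → M)
    (a b : ℝ) : Prop :=
  endpointDifferentialImage I Δ γ a b ≠ Set.univ

/-- The germ `γ : (ℝ, 0) → M` is a `C^∞` singular curve of `Δ`: near `0` it is a `C^∞` integral
curve of `Δ`, and its restriction to `[-ε, ε]` is a critical point of the endpoint map for all
sufficiently small `ε > 0`. -/
def IsSingularCurve (Δ : Π x : M, Submodule ℝ (TangentSpace I x)) (γ : ℝ → M) : Prop :=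
  (∀ᶠ t in 𝓝 (0 : ℝ), ContMDiffAt 𝓘(ℝ, ℝ) I ∞ γ t ∧ (velocity I γ t).2 ∈ Δ (γ t)) ∧
    ∀ᶠ ε in 𝓝[>] (0 : ℝ), IsEndpointCritical I Δ γ (-ε) ε

/-- A singular path: an immersive `C^∞` singular curve (germ at `0`). -/
def IsSingularPath (Δ : Π x : M, Submodule ℝ (TangentSpace I x)) (γ : ℝ → M) : Prop :=
  IsSingularCurve I Δ γ ∧ ∀ᶠ t in 𝓝 (0 : ℝ), (velocity I γ t).2 ≠ 0

/-- The singular velocity cone. -/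
def singularVelocityCone (Δ : Π x : M, Submodule ℝ (TangentSpace I x)) :
    Set (TangentBundle I M) :=
  {p | ∃ γ : ℝ → M, IsSingularCurve I Δ γ ∧ velocity I γ 0 = p}

end General

section Hyperbolic

open VectorField

variable {X : Type*} [TopologicalSpace X] [ChartedSpace (EuclideanSpace ℝ (Fin 7)) X]
  [IsManifold (𝓡 7) ∞ X]

/-- A `(4, 7)`-distribution: rank `4` on a manifold of dimension `7`, with `D + [D, D] = TX`. -/
def IsFourSevenDistribution (D : Π x : X, Submodule ℝ (TangentSpace (𝓡 7) x)) : Prop :=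
  IsDistribution (𝓡 7) 4 D ∧ ∀ x, derivedFiber (𝓡 7) D 1 x = ⊤

/-- `ξ 0, ξ 1, ξ 2, ξ 3` (the fields `ξ₁, ξ₂, ξ₃, ξ₄` of the usual numbering) is an adapted frame
of `D` over `U`. -/
def IsAdaptedFrameOn (D : Π x : X, Submodule ℝ (TangentSpace (𝓡 7) x)) (U : Set X)
    (ξ : Fin 4 → Π x : X, TangentSpace (𝓡 7) x) : Prop :=
  IsFrameOn (𝓡 7) D U ξ ∧ ∀ x ∈ U,
    mlieBracket (𝓡 7) (ξ 0) (ξ 1) x ∈ D x ∧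
    mlieBracket (𝓡 7) (ξ 2) (ξ 3) x ∈ D x ∧
    mlieBracket (𝓡 7) (ξ 0) (ξ 3) x - mlieBracket (𝓡 7) (ξ 1) (ξ 2) x ∈ D x ∧
    LinearIndependent ℝ ![ξ 0 x, ξ 1 x, ξ 2 x, ξ 3 x, mlieBracket (𝓡 7) (ξ 0) (ξ 2) x,
      mlieBracket (𝓡 7) (ξ 0) (ξ 3) x, mlieBracket (𝓡 7) (ξ 1) (ξ 3) x]

/-- A hyperbolic `(4, 7)`-distribution: adapted frames exist near each point. -/
def IsHyperbolic (D : Π x : X, Submodule ℝ (TangentSpace (𝓡 7) x)) : Prop :=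
  IsFourSevenDistribution D ∧
    ∀ x : X, ∃ U : Set X, IsOpen U ∧ x ∈ U ∧
      ∃ ξ : Fin 4 → Π x : X, TangentSpace (𝓡 7) x, IsAdaptedFrameOn D U ξ

/-- The fibre `C_x` of the characteristic cone (which does not depend on the adapted frame). -/
def charCone (D : Π x : X, Submodule ℝ (TangentSpace (𝓡 7) x)) (x : X) :
    Set (TangentSpace (𝓡 7) x) :=
  {w | ∃ U : Set X, IsOpen U ∧ x ∈ U ∧
    ∃ ξ : Fin 4 → Π x : X, TangentSpace (𝓡 7) x, IsAdaptedFrameOn D U ξ ∧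
      ∃ u : Fin 4 → ℝ, w = ∑ i, u i • ξ i x ∧ u 0 * u 3 - u 1 * u 2 = 0}

/-- The model of `X × ℝ²`, where `(x, θ, φ)` is written `(x, (θ, φ))`. -/
abbrev chartModel := (𝓡 7).prod 𝓘(ℝ, ℝ × ℝ)

/-- The vector `ξ₁ + θ ξ₂ + φ ξ₃ + θ φ ξ₄` at `x`. For an adapted frame `ξ` over `U`, the map
`(x, θ, φ) ↦ (x, [chartVector ξ (x, θ, φ)])` on `U × ℝ²` is a local parametrisation of the
`9`-dimensional manifold `Z = PC` of directions in the characteristic cone, and these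
parametrisations, for all adapted frames, cover `Z` (the reorderings
`(ξ₂, ξ₁, ξ₄, ξ₃)`, `(ξ₃, ξ₄, ξ₁, ξ₂)` and `(ξ₄, ξ₃, ξ₂, ξ₁)` are adapted as well). -/
def chartVector (ξ : Fin 4 → Π x : X, TangentSpace (𝓡 7) x) (z : X × (ℝ × ℝ)) :
    TangentSpace (𝓡 7) z.1 :=
  ξ 0 z.1 + z.2.1 • ξ 1 z.1 + z.2.2 • ξ 2 z.1 + (z.2.1 * z.2.2) • ξ 3 z.1

/-- The rank `3` distribution of the prolongation, `E_{(x, [u])} = {w | π_* w ∈ ℝ u}` with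
`π (x, [u]) = x`, in the local parametrisation of `Z` given by `ξ`. -/
def prolongation (ξ : Fin 4 → Π x : X, TangentSpace (𝓡 7) x) (z : X × (ℝ × ℝ)) :
    Submodule ℝ (TangentSpace chartModel z) :=
  (Submodule.span ℝ {chartVector ξ z}).comap
    (mfderiv chartModel (𝓡 7) (Prod.fst : X × (ℝ × ℝ) → X) z).toLinearMap

/-- `(θ, φ) = q` are the fibre coordinates of the point `(x, [u])` of `Z`, in the local
parametrisation of `Z` given by an adapted frame `ξ` near `x`. -/
def IsChartPoint (D : Π x : X, Submodule ℝ (TangentSpace (𝓡 7) x)) (x : X)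
    (u : TangentSpace (𝓡 7) x) (ξ : Fin 4 → Π x : X, TangentSpace (𝓡 7) x) (q : ℝ × ℝ) : Prop :=
  (∃ U : Set X, IsOpen U ∧ x ∈ U ∧ IsAdaptedFrameOn D U ξ) ∧
    Submodule.span ℝ {u} = Submodule.span ℝ {chartVector ξ (x, q)}

/-- The direction `[u]` is of `C₃`-type: the prolongation has small growth `(3, 5, 7, 8, 9)` on a
neighbourhood of `(x, [u])` in `Z`. -/
def IsC3Type (D : Π x : X, Submodule ℝ (TangentSpace (𝓡 7) x)) (x : X)
    (u : TangentSpace (𝓡 7) x) : Prop :=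
  ∃ (ξ : Fin 4 → Π x : X, TangentSpace (𝓡 7) x) (q : ℝ × ℝ), IsChartPoint D x u ξ q ∧
    ∀ᶠ z in 𝓝 (x, q), HasSmallGrowth chartModel (prolongation ξ) z [3, 5, 7, 8, 9]

/-- The direction `[u]` is of regular type: the prolongation has small growth `(3, 5, 7, 9)` at the
point `(x, [u])` of `Z`. -/
def IsRegularType (D : Π x : X, Submodule ℝ (TangentSpace (𝓡 7) x)) (x : X)
    (u : TangentSpace (𝓡 7) x) : Prop :=
  ∃ (ξ : Fin 4 → Π x : X, TangentSpace (𝓡 7) x) (q : ℝ × ℝ), IsChartPoint D x u ξ q ∧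
    HasSmallGrowth chartModel (prolongation ξ) (x, q) [3, 5, 7, 9]

end Hyperbolic

end FourSeven

end

/-! Work in a chart at `x₀`. Complete an adapted frame e0, ..., e3 of D by e4 = [e0,e2], e5 =
[e0,e3], e6 = [e1,e3], with dual coframe η, and parametrise the cone directions by ζ = e0 + θ e1 + φ
e2 + θφ e3. The prolongation is then spanned by ∂θ, ∂φ and ζ. Its first derived system projects to
the tangent hyperplane of the cone along ζ. The second one contains all of D and, modulo D, only the
direction e4 + 2θ e5 + θ² e6. A further bracket with ∂θ adds the θ-derivative of that direction.
What remains of TX is detected by one covector, the `moment` covector θ² η4 - θ η5 + η6, and its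
value on [ζ,[ζ,[∂φ,ζ]]] is the function `obstruction`, written F below. So the fourth term of the
growth is 9 exactly where F ≠ 0 (`finrank_derivedFiber_eq_nine`, `finrank_derivedFiber_ne_nine`).
Consequently C₃-type forces F = 0 on a neighbourhood of the direction, and regular type forces F ≠ 0
at it.

The same covector governs singular curves. Criticality of the endpoint map is tied to a nonzero
covector p along the curve which annihilates D and solves the adjoint equation. Such a p is
sufficient by `isEndpointCritical_of_adjoint`, and it exists on short critical curves by
`IsEndpointCritical.exists_adjoint`.

Write p_k = p(e_k), and let u be the components of the velocity. Differentiating p(e2) = p(e3) = 0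
along the curve gives u0 p4 + u1 p5 = 0 and u0 p5 + u1 p6 = 0, hence p4 p6 = p5². At time 0 this
makes p a multiple of the moment covector, and differentiating p4 p6 = p5² there gives F = 0
(`IsAdaptedCoframe.obstruction_eq_zero`). A regular direction is therefore not the velocity of any
singular curve.

Conversely, suppose F = 0 near the direction. Put p = l (θ² η4 - θ η5 + η6) along a curve with
velocity κζ and keep φ constant. The adjoint equations for p5 and p6 prescribe θ' and l', and the
one for p4 then holds because F = 0 (`hasDerivWithinAt_coneCovector`). Solving this ordinary
differential equation for (y, θ, l) yields the singular path. -/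

noncomputable section

namespace FourSeven

/-! ### Vector fields and their brackets in a chart. -/

section Charts

variable {E : Type*} [NormedAddCommGroup E] [NormedSpace ℝ E] [CompleteSpace E]
  {H : Type*} [TopologicalSpace H]
  (I : ModelWithCorners ℝ E H) {M : Type*} [TopologicalSpace M] [ChartedSpace H M]
  [IsManifold I ∞ M]

/-- The representative of the vector field `V` in the chart at `p`. -/
def chartField (p : M) (V : Π x : M, TangentSpace I x) (y : E) : E :=
  mfderiv I 𝓘(ℝ, E) (extChartAt I p) ((extChartAt I p).symm y) (V ((extChartAt I p).symm y))

/-- Evaluation of the chart representative at `y`, as a linear map. -/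
def chartFieldLinear (p : M) (y : E) : (Π x : M, TangentSpace I x) →ₗ[ℝ] E :=
  (mfderiv I 𝓘(ℝ, E) (extChartAt I p) ((extChartAt I p).symm y)).toLinearMap ∘ₗ
    LinearMap.proj ((extChartAt I p).symm y)

/-- The vector field on the chart domain at `p` represented by `W`. -/
def pushField (p : M) (W : E → E) : Π x : M, TangentSpace I x :=
  VectorField.mpullback I 𝓘(ℝ, E) (extChartAt I p) W

variable {I}

lemma two_le_infty : (2 : ℕ∞ω) ≤ ∞ :=
  WithTop.coe_le_coe.2 (le_top : (2 : ℕ∞) ≤ ⊤)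

omit [CompleteSpace E] in
lemma isManifold_one : IsManifold I 1 M := IsManifold.of_le (n := ∞) (by simp)

omit [CompleteSpace E] in
lemma isManifold_two : IsManifold I 2 M :=
  IsManifold.of_le (n := ∞) two_le_infty

omit [CompleteSpace E] in
lemma mfderiv_extChartAt_isInvertible {p x : M} (hx : x ∈ (extChartAt I p).source) :
    (mfderiv I 𝓘(ℝ, E) (extChartAt I p) x).IsInvertible :=
  have : IsManifold I 1 M := isManifold_one
  isInvertible_mfderiv_extChartAt hx

-- The derivative of a chart and that of its inverse are mutually inverse, so pushing forward by the
-- chart is pulling back by its inverse. This gives access to the naturality of `mpullback` under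
-- brackets.
omit [CompleteSpace E] in
lemma chartField_eq_mpullback [I.Boundaryless] {p : M} (V : Π x : M, TangentSpace I x) {y : E}
    (hy : y ∈ (extChartAt I p).target) :
    chartField I p V y = VectorField.mpullback 𝓘(ℝ, E) I (extChartAt I p).symm V y := by
  have : IsManifold I 1 M := isManifold_one
  have h1 := mfderiv_extChartAt_comp_mfderivWithin_extChartAt_symm (I := I) hy
  have h2 := mfderivWithin_extChartAt_symm_comp_mfderiv_extChartAt (I := I) hy
  rw [I.range_eq_univ, mfderivWithin_univ] at h1 h2
  rw [VectorField.mpullback_apply, ContinuousLinearMap.inverse_eq h2 h1]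
  rfl

omit [CompleteSpace E] in
lemma isInvertible_mfderiv_symm [I.Boundaryless] {p : M} {y : E}
    (hy : y ∈ (extChartAt I p).target) :
    (mfderiv 𝓘(ℝ, E) I (extChartAt I p).symm y).IsInvertible := by
  have : IsManifold I 1 M := isManifold_one
  have := isInvertible_mfderivWithin_extChartAt_symm (I := I) hy
  rwa [I.range_eq_univ, mfderivWithin_univ] at this

omit [CompleteSpace E] in
lemma contMDiffAt_symm [I.Boundaryless] {p : M} {y : E}
    (hy : y ∈ (extChartAt I p).target) :
    ContMDiffAt 𝓘(ℝ, E) I ∞ (extChartAt I p).symm y :=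
  (contMDiffOn_extChartAt_symm p).contMDiffAt ((isOpen_extChartAt_target p).mem_nhds hy)

omit [CompleteSpace E] in
lemma contMDiffAt_chart {p x : M} (hx : x ∈ (extChartAt I p).source) :
    ContMDiffAt I 𝓘(ℝ, E) ∞ (extChartAt I p) x :=
  contMDiffAt_extChartAt' (by simpa using hx)

/-- The part of the chart target lying over `U`. -/
def chartSet (I : ModelWithCorners ℝ E H) (p : M) (U : Set M) : Set E :=
  (extChartAt I p).target ∩ (extChartAt I p).symm ⁻¹' U

omit [CompleteSpace E] [IsManifold I ∞ M] in
lemma isOpen_chartSet [I.Boundaryless] (p : M) {U : Set M} (hU : IsOpen U) :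
    IsOpen (chartSet I p U) :=
  (continuousOn_extChartAt_symm p).isOpen_inter_preimage (isOpen_extChartAt_target p) hU

lemma contDiffOn_chartField [I.Boundaryless] {p : M} {V : Π x : M, TangentSpace I x} {U : Set M}
    (hU : IsOpen U) (hV : SmoothFieldOn I U V) :
    ContDiffOn ℝ ∞ (chartField I p V) (chartSet I p U) := by
  intro y hy
  have hVa : ContMDiffAt I I.tangent ∞ (fun x => (⟨x, V x⟩ : TangentBundle I M))
      ((extChartAt I p).symm y) := hV.contMDiffAt (hU.mem_nhds hy.2)
  have : IsManifold I 1 M := isManifold_one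
  have : IsManifold I (∞ + 1) M := by simpa using (inferInstance : IsManifold I ∞ M)
  have h := ContMDiffAt.mpullback_vectorField_preimage (m := ∞) (n := ∞) hVa (contMDiffAt_symm hy.1)
    (isInvertible_mfderiv_symm hy.1) (by simp)
  rw [contMDiffAt_vectorSpace_iff_contDiffAt] at h
  refine (h.congr_of_eventuallyEq ?_).contDiffWithinAt
  filter_upwards [(isOpen_extChartAt_target p).mem_nhds hy.1] with z hz
  exact chartField_eq_mpullback V hz

lemma smoothFieldOn_pushField [I.Boundaryless] {p : M} {W : E → E} {U : Set M}
    (hU : IsOpen U) (hUs : U ⊆ (extChartAt I p).source)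
    (hW : ContDiffOn ℝ ∞ W (chartSet I p U)) :
    SmoothFieldOn I U (pushField I p W) := by
  intro x hx
  have hy : extChartAt I p x ∈ chartSet I p U :=
    ⟨(extChartAt I p).map_source (hUs hx), by
      rw [mem_preimage, (extChartAt I p).left_inv (hUs hx)]; exact hx⟩
  have hWa : ContDiffAt ℝ ∞ W (extChartAt I p x) :=
    hW.contDiffAt ((isOpen_chartSet p hU).mem_nhds hy)
  have : IsManifold I 1 M := isManifold_one
  have : IsManifold I (∞ + 1) M := by simpa using (inferInstance : IsManifold I ∞ M)
  have h := ContMDiffAt.mpullback_vectorField_preimage (m := ∞) (n := ∞)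
    (contMDiffAt_vectorSpace_iff_contDiffAt.2 hWa) (contMDiffAt_chart (hUs hx))
    (mfderiv_extChartAt_isInvertible (hUs hx)) (by simp)
  exact h.contMDiffWithinAt

omit [CompleteSpace E] in
lemma chartField_pushField {p : M} {W : E → E} {y : E}
    (hy : y ∈ (extChartAt I p).target) : chartField I p (pushField I p W) y = W y := by
  have h := mfderiv_extChartAt_isInvertible (I := I) ((extChartAt I p).map_target hy)
  refine (h.self_apply_inverse _).trans ?_
  rw [(extChartAt I p).right_inv hy]

omit [CompleteSpace E] in
lemma mlieBracket_vectorSpace (V W : E → E) :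
    VectorField.mlieBracket 𝓘(ℝ, E) V W = VectorField.lieBracket ℝ V W := by
  refine VectorField.mlieBracketWithin_univ.symm.trans ?_
  refine VectorField.mlieBracketWithin_eq_lieBracketWithin.trans ?_
  exact VectorField.lieBracketWithin_univ

/-- Naturality of the bracket under pullback by the inverse chart. It turns every bracket
computation on the manifold into one in a vector space. -/
lemma chartField_mlieBracket [I.Boundaryless] {p : M} {V W : Π x : M, TangentSpace I x} {U : Set M}
    (hU : IsOpen U) (hV : SmoothFieldOn I U V) (hW : SmoothFieldOn I U W) {y : E}
    (hy : y ∈ chartSet I p U) :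
    chartField I p (VectorField.mlieBracket I V W) y =
      VectorField.lieBracket ℝ (chartField I p V) (chartField I p W) y := by
  have : IsManifold I 2 M := isManifold_two
  have : IsManifold I 1 M := isManifold_one
  have : IsManifold I (minSmoothness ℝ 2) M := by simpa using isManifold_two
  have hVa : ContMDiffAt I I.tangent ∞ (fun x => (⟨x, V x⟩ : TangentBundle I M))
      ((extChartAt I p).symm y) := hV.contMDiffAt (hU.mem_nhds hy.2)
  have hWa : ContMDiffAt I I.tangent ∞ (fun x => (⟨x, W x⟩ : TangentBundle I M))
      ((extChartAt I p).symm y) := hW.contMDiffAt (hU.mem_nhds hy.2)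
  rw [chartField_eq_mpullback _ hy.1, VectorField.mpullback_mlieBracket (n := 2)
    (hVa.mdifferentiableAt (by simp)) (hWa.mdifferentiableAt (by simp))
    ((contMDiffAt_symm hy.1).of_le two_le_infty) (by simp)]
  refine (congrFun (mlieBracket_vectorSpace _ _) y).trans ?_
  have key : ∀ V : Π x : M, TangentSpace I x,
      (VectorField.mpullback 𝓘(ℝ, E) I (extChartAt I p).symm V : E → E) =ᶠ[𝓝 y]
        chartField I p V := fun V => by
    filter_upwards [(isOpen_extChartAt_target p).mem_nhds hy.1] with z hz
    exact (chartField_eq_mpullback V hz).symm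
  exact Filter.EventuallyEq.lieBracket_vectorField_eq (E := E) (key V) (key W)

omit [CompleteSpace E] in
lemma pushField_chartField {p : M} (V : Π x : M, TangentSpace I x) {x : M}
    (hx : x ∈ (extChartAt I p).source) : pushField I p (chartField I p V) x = V x := by
  have h := mfderiv_extChartAt_isInvertible (I := I) hx
  refine (VectorField.mpullback_apply (V := chartField I p V)).trans ?_
  unfold chartField
  rw [(extChartAt I p).left_inv hx]
  exact h.inverse_apply_self _

omit [CompleteSpace E] [IsManifold I ∞ M] in
lemma chartSet_preimage {p : M} {S : Set E} (hS : S ⊆ (extChartAt I p).target) :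
    chartSet I p ((extChartAt I p).source ∩ extChartAt I p ⁻¹' S) = S := by
  ext y
  refine ⟨fun ⟨h1, h2⟩ => by
    have h3 := h2.2
    rwa [mem_preimage, (extChartAt I p).right_inv h1] at h3, fun hy => ?_⟩
  refine ⟨hS hy, (extChartAt I p).map_target (hS hy), ?_⟩
  rw [mem_preimage, (extChartAt I p).right_inv (hS hy)]
  exact hy

omit [CompleteSpace E] [IsManifold I ∞ M] in
lemma isOpen_source_inter_preimage {p : M} {S : Set E} (hS : IsOpen S) :
    IsOpen ((extChartAt I p).source ∩ extChartAt I p ⁻¹' S) :=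
  (continuousOn_extChartAt p).isOpen_inter_preimage (isOpen_extChartAt_source p) hS

lemma smoothFieldOn_of_chartField [I.Boundaryless] {p : M} {V : Π x : M, TangentSpace I x}
    {S : Set E} (hS : IsOpen S) (hSt : S ⊆ (extChartAt I p).target)
    (hV : ContDiffOn ℝ ∞ (chartField I p V) S) :
    SmoothFieldOn I ((extChartAt I p).source ∩ extChartAt I p ⁻¹' S) V := by
  have h := smoothFieldOn_pushField (I := I) (p := p) (W := chartField I p V)
    (isOpen_source_inter_preimage hS) inter_subset_left (by rwa [chartSet_preimage hSt])
  refine h.congr fun x hx => ?_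
  rw [pushField_chartField V hx.1]

/-- The chart representative of a bracket, for fields with smooth representatives. -/
lemma chartField_mlieBracket_of_contDiffOn [I.Boundaryless] {p : M}
    {V W : Π x : M, TangentSpace I x} {S : Set E} (hS : IsOpen S)
    (hSt : S ⊆ (extChartAt I p).target) (hV : ContDiffOn ℝ ∞ (chartField I p V) S)
    (hW : ContDiffOn ℝ ∞ (chartField I p W) S) {y : E} (hy : y ∈ S) :
    chartField I p (VectorField.mlieBracket I V W) y =
      VectorField.lieBracket ℝ (chartField I p V) (chartField I p W) y :=
  chartField_mlieBracket (isOpen_source_inter_preimage hS)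
    (smoothFieldOn_of_chartField hS hSt hV) (smoothFieldOn_of_chartField hS hSt hW)
    (by rwa [chartSet_preimage hSt])

end Charts

/-! ### Frames, dual coframes and structure functions in a vector space. -/

section Coframe

open VectorField

variable {E : Type*} [NormedAddCommGroup E] [NormedSpace ℝ E] {n : ℕ}

/-- `e` is a smooth frame over the open set `O`, with dual coframe `η`. -/
structure IsCoframe (e : Fin n → E → E) (η : Fin n → E → E →L[ℝ] ℝ) (O : Set E) : Prop where
  isOpen : IsOpen O
  smooth_frame : ∀ i, ContDiffOn ℝ ∞ (e i) O
  smooth_coframe : ∀ i, ContDiffOn ℝ ∞ (η i) O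
  dual : ∀ y ∈ O, ∀ i j, η i y (e j y) = if i = j then 1 else 0
  expand : ∀ y ∈ O, ∀ v, ∑ i, η i y v • e i y = v

/-- The structure functions of a frame: `[e j, e i] = ∑ k, structureFun e η j i k • e k`. -/
def structureFun (e : Fin n → E → E) (η : Fin n → E → E →L[ℝ] ℝ) (j i k : Fin n) (y : E) : ℝ :=
  η k y (lieBracket ℝ (e j) (e i) y)

/-- At each point the frame is a linear isomorphism from ℝⁿ. Its inverse depends smoothly on the
point because operator inversion is smooth at invertible maps, and the coframe consists of the
coordinates of that inverse. -/
lemma exists_coframe [FiniteDimensional ℝ E] {e : Fin n → E → E} {O : Set E} (hO : IsOpen O)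
    (hn : Module.finrank ℝ E = n) (he : ∀ i, ContDiffOn ℝ ∞ (e i) O)
    (hli : ∀ y ∈ O, LinearIndependent ℝ (fun i => e i y)) :
    ∃ η : Fin n → E → E →L[ℝ] ℝ, IsCoframe e η O := by
  have : CompleteSpace E := FiniteDimensional.complete ℝ E
  let B : E → (Fin n → ℝ) →L[ℝ] E := fun y =>
    ∑ i, (ContinuousLinearMap.proj (R := ℝ) (φ := fun _ : Fin n => ℝ) i).smulRight (e i y)
  have hB : ∀ y v, B y v = ∑ i, v i • e i y := fun y v => by
    simp [B]
  have hinv : ∀ y ∈ O, ∃ L : (Fin n → ℝ) ≃L[ℝ] E, (L : (Fin n → ℝ) →L[ℝ] E) = B y := by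
    intro y hy
    let b := Module.Basis.mk (hli y hy)
      ((hli y hy).span_eq_top_of_card_eq_finrank' (by simp [hn])).ge
    refine ⟨b.equivFun.symm.toContinuousLinearEquiv, ?_⟩
    ext v
    simp [hB, b, Module.Basis.equivFun_symm_apply]
  have hBs : ContDiffOn ℝ ∞ B O := by
    refine ContDiffOn.sum fun i _ => ?_
    exact (ContinuousLinearMap.smulRightL ℝ (Fin n → ℝ) E
      (ContinuousLinearMap.proj i)).contDiff.comp_contDiffOn (he i)
  refine ⟨fun k y => (ContinuousLinearMap.proj k).comp (ContinuousLinearMap.inverse (B y)),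
    hO, he, fun k => ?_, fun y hy i j => ?_, fun y hy v => ?_⟩
  · intro y hy
    obtain ⟨L, hL⟩ := hinv y hy
    have h1 : ContDiffAt ℝ ∞ (fun y => ContinuousLinearMap.inverse (B y)) y := by
      have := contDiffAt_map_inverse (𝕜 := ℝ) (n := ∞) L
      rw [hL] at this
      exact this.comp y (hBs.contDiffAt (hO.mem_nhds hy))
    exact (((ContinuousLinearMap.compL ℝ E (Fin n → ℝ) ℝ
      (ContinuousLinearMap.proj k)).contDiff.contDiffAt).comp y h1).contDiffWithinAt
  · obtain ⟨L, hL⟩ := hinv y hy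
    have h2 : e j y = L (Pi.single j 1) := by
      have : L (Pi.single j 1) = B y (Pi.single j 1) := by rw [← hL]; rfl
      rw [this, hB]; simp [Pi.single_apply]
    simp only [← hL, ContinuousLinearMap.inverse_equiv, ContinuousLinearMap.comp_apply]
    rw [h2]
    simp [Pi.single_apply]
  · obtain ⟨L, hL⟩ := hinv y hy
    have h2 := hB y (L.symm v)
    rw [← hL] at h2
    simp only [← hL, ContinuousLinearMap.inverse_equiv, ContinuousLinearMap.comp_apply]
    simpa using h2.symm

namespace IsCoframe

variable {e : Fin n → E → E} {η : Fin n → E → E →L[ℝ] ℝ} {O : Set E}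

lemma mono (h : IsCoframe e η O) {O' : Set E} (hO' : IsOpen O') (hs : O' ⊆ O) :
    IsCoframe e η O' :=
  ⟨hO', fun i => (h.smooth_frame i).mono hs, fun i => (h.smooth_coframe i).mono hs,
    fun y hy => h.dual y (hs hy), fun y hy => h.expand y (hs hy)⟩

variable (h : IsCoframe e η O)
include h

lemma differentiableAt_frame {y : E} (hy : y ∈ O) (i : Fin n) : DifferentiableAt ℝ (e i) y :=
  ((h.smooth_frame i).contDiffAt (h.isOpen.mem_nhds hy)).differentiableAt (by simp)

lemma differentiableAt_coframe {y : E} (hy : y ∈ O) (i : Fin n) : DifferentiableAt ℝ (η i) y :=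
  ((h.smooth_coframe i).contDiffAt (h.isOpen.mem_nhds hy)).differentiableAt (by simp)

/-- If `η k` is constant on the field `f` near `y`, then the derivative of `η k` on `f` is minus
`η k` on the derivative of `f`. -/
lemma fderiv_coframe_apply {y : E} (hy : y ∈ O) {f : E → E} (hf : DifferentiableAt ℝ f y)
    {k : Fin n} {c : ℝ} (hc : ∀ᶠ z in 𝓝 y, η k z (f z) = c) (v : E) :
    fderiv ℝ (η k) y v (f y) = - η k y (fderiv ℝ f y v) := by
  have h1 := ((h.differentiableAt_coframe hy k).hasFDerivAt.clm_apply hf.hasFDerivAt)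
  have h2 : HasFDerivAt (fun z => η k z (f z)) (0 : E →L[ℝ] ℝ) y :=
    (hasFDerivAt_const c y).congr_of_eventuallyEq hc
  have h3 := DFunLike.congr_fun (h1.unique h2) v
  simp at h3
  linarith

/-- The exterior derivative of the coframe in terms of the structure functions. -/
lemma exterior {y : E} (hy : y ∈ O) (k : Fin n) (v w : E) :
    fderiv ℝ (η k) y v w - fderiv ℝ (η k) y w v =
      - ∑ j, ∑ i, η j y v * η i y w * structureFun e η j i k y := by
  have key : ∀ j i, fderiv ℝ (η k) y (e j y) (e i y) - fderiv ℝ (η k) y (e i y) (e j y) =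
      - structureFun e η j i k y := by
    intro j i
    have hc : ∀ i, ∀ᶠ z in 𝓝 y, η k z (e i z) = if k = i then 1 else 0 := fun i => by
      filter_upwards [h.isOpen.mem_nhds hy] with z hz using h.dual z hz k i
    rw [h.fderiv_coframe_apply hy (h.differentiableAt_frame hy i) (hc i),
      h.fderiv_coframe_apply hy (h.differentiableAt_frame hy j) (hc j), structureFun, lieBracket,
      map_sub]
    ring
  have e1 : fderiv ℝ (η k) y v w =
      ∑ j, ∑ i, η j y v * η i y w * fderiv ℝ (η k) y (e j y) (e i y) := by
    conv_lhs => rw [← h.expand y hy v, ← h.expand y hy w]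
    simp [map_sum, Finset.mul_sum, mul_assoc]
    rw [Finset.sum_comm]
    refine Finset.sum_congr rfl fun _ _ => Finset.sum_congr rfl fun _ _ => by ring
  have e2 : fderiv ℝ (η k) y w v =
      ∑ j, ∑ i, η j y v * η i y w * fderiv ℝ (η k) y (e i y) (e j y) := by
    conv_lhs => rw [← h.expand y hy v, ← h.expand y hy w]
    simp [map_sum, Finset.mul_sum, mul_assoc]
  rw [e1, e2, ← Finset.sum_sub_distrib, ← Finset.sum_neg_distrib]
  refine Finset.sum_congr rfl fun j _ => ?_
  rw [← Finset.sum_sub_distrib, ← Finset.sum_neg_distrib]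
  refine Finset.sum_congr rfl fun i _ => ?_
  rw [← mul_sub, key]; ring

lemma contDiffOn_structureFun (j i k : Fin n) :
    ContDiffOn ℝ ∞ (structureFun e η j i k) O := by
  have hf : ∀ i, ContDiffOn ℝ ∞ (fderiv ℝ (e i)) O := fun i =>
    (h.smooth_frame i).fderiv_of_isOpen h.isOpen (by simp)
  exact (h.smooth_coframe k).clm_apply
    (((hf i).clm_apply (h.smooth_frame j)).sub ((hf j).clm_apply (h.smooth_frame i)))

variable {F : Type*} [NormedAddCommGroup F] [NormedSpace ℝ F]

/-- The components of the bracket of two fields on `E × F` along a frame of `E`. -/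
lemma lieBracket_fst {V W : E × F → E × F} {z : E × F} (hz : z.1 ∈ O)
    (hV : DifferentiableAt ℝ V z) (hW : DifferentiableAt ℝ W z) (k : Fin n) :
    η k z.1 (lieBracket ℝ V W z).1 =
      fderiv ℝ (fun z => η k z.1 (W z).1) z (V z) - fderiv ℝ (fun z => η k z.1 (V z).1) z (W z)
      + ∑ j, ∑ i, η j z.1 (V z).1 * η i z.1 (W z).1 * structureFun e η j i k z.1 := by
  have hd : ∀ {Y : E × F → E × F}, DifferentiableAt ℝ Y z → ∀ v,
      fderiv ℝ (fun z => η k z.1 (Y z).1) z v =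
        fderiv ℝ (η k) z.1 v.1 (Y z).1 + η k z.1 (fderiv ℝ Y z v).1 := by
    intro Y hY v
    have h1 : HasFDerivAt (fun z : E × F => η k z.1)
        ((fderiv ℝ (η k) z.1).comp (ContinuousLinearMap.fst ℝ E F)) z :=
      (h.differentiableAt_coframe hz k).hasFDerivAt.comp z hasFDerivAt_fst
    have h2 : HasFDerivAt (fun z => (Y z).1)
        ((ContinuousLinearMap.fst ℝ E F).comp (fderiv ℝ Y z)) z :=
      hasFDerivAt_fst.comp z hY.hasFDerivAt
    rw [(h1.clm_apply h2).fderiv]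
    simp [add_comm]
  have := h.exterior hz k (V z).1 (W z).1
  rw [hd hV, hd hW, lieBracket, Prod.fst_sub, map_sub]
  linarith

end IsCoframe

omit [NormedSpace ℝ E] in
lemma lieBracket_snd [NormedSpace ℝ E] {F : Type*} [NormedAddCommGroup F] [NormedSpace ℝ F]
    {V W : E × F → E × F} {z : E × F}
    (hV : DifferentiableAt ℝ V z) (hW : DifferentiableAt ℝ W z) :
    (lieBracket ℝ V W z).2 =
      fderiv ℝ (fun z => (W z).2) z (V z) - fderiv ℝ (fun z => (V z).2) z (W z) := by
  have hd : ∀ {Y : E × F → E × F}, DifferentiableAt ℝ Y z → ∀ v,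
      fderiv ℝ (fun z => (Y z).2) z v = (fderiv ℝ Y z v).2 := by
    intro Y hY v
    have h2 : HasFDerivAt (fun z => (Y z).2)
        ((ContinuousLinearMap.snd ℝ E F).comp (fderiv ℝ Y z)) z :=
      hasFDerivAt_snd.comp z hY.hasFDerivAt
    rw [h2.fderiv]; rfl
  rw [hd hV, hd hW, lieBracket, Prod.snd_sub]

end Coframe

/-! ### The derived systems of the prolongation and the obstruction. -/

section Adapted

open VectorField

variable {E : Type*} [NormedAddCommGroup E] [NormedSpace ℝ E]

lemma structureFun_swap {n : ℕ} (e : Fin n → E → E) (η : Fin n → E → E →L[ℝ] ℝ)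
    (j i k : Fin n) (y : E) : structureFun e η j i k y = - structureFun e η i j k y := by
  rw [structureFun, structureFun, lieBracket_swap, map_neg]

/-- The coframe of an adapted frame `e 0, e 1, e 2, e 3` completed by
`e 4 = [e 0, e 2]`, `e 5 = [e 0, e 3]`, `e 6 = [e 1, e 3]`. -/
structure IsAdaptedCoframe (e : Fin 7 → E → E) (η : Fin 7 → E → E →L[ℝ] ℝ) (O : Set E) : Prop
    extends IsCoframe e η O where
  zero_one : ∀ y ∈ O, ∀ k, 4 ≤ k → structureFun e η 0 1 k y = 0
  two_three : ∀ y ∈ O, ∀ k, 4 ≤ k → structureFun e η 2 3 k y = 0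
  zero_two : ∀ y ∈ O, ∀ k, 4 ≤ k → structureFun e η 0 2 k y = if k = 4 then 1 else 0
  zero_three : ∀ y ∈ O, ∀ k, 4 ≤ k → structureFun e η 0 3 k y = if k = 5 then 1 else 0
  one_two : ∀ y ∈ O, ∀ k, 4 ≤ k → structureFun e η 1 2 k y = if k = 5 then 1 else 0
  one_three : ∀ y ∈ O, ∀ k, 4 ≤ k → structureFun e η 1 3 k y = if k = 6 then 1 else 0

/-- The components of `e 0 + θ e 1 + φ e 2 + θ φ e 3`. -/
def coneCoef (θ φ : ℝ) : Fin 7 → ℝ := ![1, θ, φ, θ * φ, 0, 0, 0]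

/-- The covector `(θ², -θ, 1)` in the coframe `η 4, η 5, η 6`, applied to the bracket of the
cone vector with `e i`. -/
def drift (e : Fin 7 → E → E) (η : Fin 7 → E → E →L[ℝ] ℝ) (i : Fin 7) (θ φ : ℝ) (y : E) : ℝ :=
  ∑ j, coneCoef θ φ j * (θ ^ 2 * structureFun e η j i 4 y - θ * structureFun e η j i 5 y
    + structureFun e η j i 6 y)

/-- The function on the prolonged space whose vanishing decides the growth of the prolongation. -/
def obstruction (e : Fin 7 → E → E) (η : Fin 7 → E → E →L[ℝ] ℝ) (θ φ : ℝ) (y : E) : ℝ :=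
  drift e η 4 θ φ y + 2 * θ * drift e η 5 θ φ y + θ ^ 2 * drift e η 6 θ φ y

variable {e : Fin 7 → E → E} {η : Fin 7 → E → E →L[ℝ] ℝ} {O : Set E}

namespace IsAdaptedCoframe

variable (h : IsAdaptedCoframe e η O)
include h

/-- The bracket pairing of `v` in the span of `e 0, ..., e 3` with arbitrary `w`, modulo that
span. -/
lemma sum_structureFun {y : E} (hy : y ∈ O) {v w : Fin 7 → ℝ} (h4 : v 4 = 0) (h5 : v 5 = 0)
    (h6 : v 6 = 0) :
    (∑ j, ∑ i, v j * w i * structureFun e η j i 4 y = v 0 * w 2 - v 2 * w 0 +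
      (w 4 * ∑ j, v j * structureFun e η j 4 4 y + w 5 * ∑ j, v j * structureFun e η j 5 4 y +
        w 6 * ∑ j, v j * structureFun e η j 6 4 y)) ∧
    (∑ j, ∑ i, v j * w i * structureFun e η j i 5 y =
      v 0 * w 3 - v 3 * w 0 + v 1 * w 2 - v 2 * w 1 +
      (w 4 * ∑ j, v j * structureFun e η j 4 5 y + w 5 * ∑ j, v j * structureFun e η j 5 5 y +
        w 6 * ∑ j, v j * structureFun e η j 6 5 y)) ∧
    (∑ j, ∑ i, v j * w i * structureFun e η j i 6 y = v 1 * w 3 - v 3 * w 1 +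
      (w 4 * ∑ j, v j * structureFun e η j 4 6 y + w 5 * ∑ j, v j * structureFun e η j 5 6 y +
        w 6 * ∑ j, v j * structureFun e η j 6 6 y)) := by
  have hself : ∀ j k, structureFun e η j j k y = 0 := fun j k => by
    have := structureFun_swap e η j j k y; linarith
  have k4 : ∀ k : Fin 7, 4 ≤ k → ∑ j, ∑ i, v j * w i * structureFun e η j i k y =
      (v 0 * w 2 - v 2 * w 0) * (if k = 4 then 1 else 0) +
      (v 0 * w 3 - v 3 * w 0 + v 1 * w 2 - v 2 * w 1) * (if k = 5 then 1 else 0) +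
      (v 1 * w 3 - v 3 * w 1) * (if k = 6 then 1 else 0) +
      (w 4 * ∑ j, v j * structureFun e η j 4 k y + w 5 * ∑ j, v j * structureFun e η j 5 k y +
        w 6 * ∑ j, v j * structureFun e η j 6 k y) := by
    intro k hk
    -- The indicators are turned back into structure functions, so that one polynomial identity
    -- covers k = 4, 5 and 6.
    rw [← h.zero_two y hy k hk, ← h.zero_three y hy k hk, ← h.one_three y hy k hk]
    have a1 := h.zero_one y hy k hk
    have a2 := h.two_three y hy k hk
    have a3 := (h.one_two y hy k hk).trans (h.zero_three y hy k hk).symm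
    have s := fun j i => structureFun_swap e η j i k y
    simp only [Fin.sum_univ_seven, h4, h5, h6, hself, s 1 0, s 2 0, s 3 0, s 2 1, s 3 1, s 3 2,
      a1, a2, a3]
    ring
  refine ⟨?_, ?_, ?_⟩
  · rw [k4 4 le_rfl]; simp
  · rw [k4 5 (by decide)]; simp
  · rw [k4 6 (by decide)]; simp

end IsAdaptedCoframe

/-- `Y z` lies in the prolongation. -/
def InProlongation (η : Fin 7 → E → E →L[ℝ] ℝ) (Y : E × ℝ × ℝ → E × ℝ × ℝ) (z : E × ℝ × ℝ) :
    Prop :=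
  ∀ k, η k z.1 (Y z).1 = coneCoef z.2.1 z.2.2 k * η 0 z.1 (Y z).1

/-- `Y z` lies in the first derived distribution of the prolongation. -/
def InDerived (η : Fin 7 → E → E →L[ℝ] ℝ) (Y : E × ℝ × ℝ → E × ℝ × ℝ) (z : E × ℝ × ℝ) : Prop :=
  η 3 z.1 (Y z).1 = z.2.1 * η 2 z.1 (Y z).1 + z.2.2 * η 1 z.1 (Y z).1
      - z.2.1 * z.2.2 * η 0 z.1 (Y z).1 ∧
    η 4 z.1 (Y z).1 = 0 ∧ η 5 z.1 (Y z).1 = 0 ∧ η 6 z.1 (Y z).1 = 0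

/-- `Y z` lies in the second derived distribution of the prolongation. -/
def InSecondDerived (η : Fin 7 → E → E →L[ℝ] ℝ) (Y : E × ℝ × ℝ → E × ℝ × ℝ) (z : E × ℝ × ℝ) :
    Prop :=
  η 5 z.1 (Y z).1 = 2 * z.2.1 * η 4 z.1 (Y z).1 ∧
    η 6 z.1 (Y z).1 = z.2.1 ^ 2 * η 4 z.1 (Y z).1

/-- The moment covector `(θ², -θ, 1)` on `Y z`. -/
def moment (η : Fin 7 → E → E →L[ℝ] ℝ) (z : E × ℝ × ℝ) (v : E × ℝ × ℝ) : ℝ :=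
  z.2.1 ^ 2 * η 4 z.1 v.1 - z.2.1 * η 5 z.1 v.1 + η 6 z.1 v.1

lemma InProlongation.inDerived {Y : E × ℝ × ℝ → E × ℝ × ℝ} {z : E × ℝ × ℝ}
    (hY : InProlongation η Y z) : InDerived η Y z := by
  have := hY 1; have := hY 2; have := hY 3; have := hY 4; have := hY 5; have := hY 6
  simp [coneCoef] at *
  refine ⟨?_, ?_, ?_, ?_⟩ <;> simp only [*]
  ring

lemma InDerived.inSecondDerived {Y : E × ℝ × ℝ → E × ℝ × ℝ} {z : E × ℝ × ℝ}
    (hY : InDerived η Y z) : InSecondDerived η Y z := by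
  obtain ⟨-, h4, h5, h6⟩ := hY
  simp [InSecondDerived, h4, h5, h6]

lemma InSecondDerived.moment_eq_zero {Y : E × ℝ × ℝ → E × ℝ × ℝ} {z : E × ℝ × ℝ}
    (hY : InSecondDerived η Y z) : moment η z (Y z) = 0 := by
  rw [moment, hY.1, hY.2]; ring

/-- The derivative of a relation `f = p * g` between functions near `z`. -/
lemma fderiv_eq_of_eventually_mul {G : Type*} [NormedAddCommGroup G] [NormedSpace ℝ G]
    {f g p : G → ℝ} {p' : G →L[ℝ] ℝ} {z : G} (hfg : ∀ᶠ x in 𝓝 z, f x = p x * g x)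
    (hp : HasFDerivAt p p' z) (hg : DifferentiableAt ℝ g z) (u : G) :
    fderiv ℝ f z u = p' u * g z + p z * fderiv ℝ g z u := by
  have h1 : f =ᶠ[𝓝 z] fun x => p x * g x := hfg
  have h2 : HasFDerivAt (fun x => p x * g x) (p z • fderiv ℝ g z + g z • p') z :=
    hp.mul hg.hasFDerivAt
  rw [h1.fderiv_eq, h2.fderiv]
  simp; ring

lemma fderiv_eq_zero_of_eventually {G : Type*} [NormedAddCommGroup G] [NormedSpace ℝ G]
    {f : G → ℝ} {z : G} (hf : ∀ᶠ x in 𝓝 z, f x = 0) (u : G) : fderiv ℝ f z u = 0 := by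
  have h1 : f =ᶠ[𝓝 z] fun _ => 0 := hf
  rw [h1.fderiv_eq]; simp

section FibreCoordinates

variable (z : E × ℝ × ℝ)

/-- The differential of the first fibre coordinate. -/
def dtheta : E × ℝ × ℝ →L[ℝ] ℝ :=
  (ContinuousLinearMap.fst ℝ ℝ ℝ).comp (ContinuousLinearMap.snd ℝ E (ℝ × ℝ))

/-- The differential of the second fibre coordinate. -/
def dphi : E × ℝ × ℝ →L[ℝ] ℝ :=
  (ContinuousLinearMap.snd ℝ ℝ ℝ).comp (ContinuousLinearMap.snd ℝ E (ℝ × ℝ))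

@[simp] lemma dtheta_apply : dtheta z = z.2.1 := rfl
@[simp] lemma dphi_apply : dphi z = z.2.2 := rfl

lemma hasFDerivAt_theta : HasFDerivAt (fun z : E × ℝ × ℝ => z.2.1) dtheta z :=
  (dtheta (E := E)).hasFDerivAt

lemma hasFDerivAt_phi : HasFDerivAt (fun z : E × ℝ × ℝ => z.2.2) dphi z :=
  (dphi (E := E)).hasFDerivAt

end FibreCoordinates

namespace IsAdaptedCoframe

variable (h : IsAdaptedCoframe e η O)
include h

lemma differentiableAt_component {Y : E × ℝ × ℝ → E × ℝ × ℝ} {z : E × ℝ × ℝ} (hz : z.1 ∈ O)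
    (hY : DifferentiableAt ℝ Y z) (k : Fin 7) :
    DifferentiableAt ℝ (fun z => η k z.1 (Y z).1) z := by
  have h1 : DifferentiableAt ℝ (fun z : E × ℝ × ℝ => η k z.1) z :=
    (h.differentiableAt_coframe hz k).comp z differentiableAt_fst
  exact h1.clm_apply (differentiableAt_fst.comp z hY)

variable {V W : E × ℝ × ℝ → E × ℝ × ℝ} {z : E × ℝ × ℝ} (hz : z.1 ∈ O)
  (hV : DifferentiableAt ℝ V z) (hW : DifferentiableAt ℝ W z)
  (hVE : ∀ᶠ x in 𝓝 z, InProlongation η V x)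
include hz hV hW hVE

/-- The X-components of both fields are multiples of ζ, so only derivatives of the coefficients of ζ
and of the multiples survive. These are tangent to the quadric u0 u3 = u1 u2 along ζ, which is the
relation in `InDerived`. -/
lemma inDerived_lieBracket (hWE : ∀ᶠ x in 𝓝 z, InProlongation η W x) :
    InDerived η (lieBracket ℝ V W) z := by
  have key : ∀ {Y : E × ℝ × ℝ → E × ℝ × ℝ}, DifferentiableAt ℝ Y z →
      (∀ᶠ x in 𝓝 z, InProlongation η Y x) → ∀ u,
      fderiv ℝ (fun x => η 1 x.1 (Y x).1) z u =
        u.2.1 * η 0 z.1 (Y z).1 + z.2.1 * fderiv ℝ (fun x => η 0 x.1 (Y x).1) z u ∧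
      fderiv ℝ (fun x => η 2 x.1 (Y x).1) z u =
        u.2.2 * η 0 z.1 (Y z).1 + z.2.2 * fderiv ℝ (fun x => η 0 x.1 (Y x).1) z u ∧
      fderiv ℝ (fun x => η 3 x.1 (Y x).1) z u =
        (z.2.1 * u.2.2 + z.2.2 * u.2.1) * η 0 z.1 (Y z).1
          + z.2.1 * z.2.2 * fderiv ℝ (fun x => η 0 x.1 (Y x).1) z u ∧
      fderiv ℝ (fun x => η 4 x.1 (Y x).1) z u = 0 ∧
      fderiv ℝ (fun x => η 5 x.1 (Y x).1) z u = 0 ∧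
      fderiv ℝ (fun x => η 6 x.1 (Y x).1) z u = 0 := by
    intro Y hY hYE u
    have h0 := h.differentiableAt_component hz hY 0
    refine ⟨?_, ?_, ?_, ?_, ?_, ?_⟩
    · have := fderiv_eq_of_eventually_mul (f := fun x => η 1 x.1 (Y x).1)
        (hYE.mono fun x hx => hx 1) (hasFDerivAt_theta z) h0 u
      simpa [coneCoef] using this
    · have := fderiv_eq_of_eventually_mul (f := fun x => η 2 x.1 (Y x).1)
        (hYE.mono fun x hx => hx 2) (hasFDerivAt_phi z) h0 u
      simpa [coneCoef] using this
    · have := fderiv_eq_of_eventually_mul (f := fun x => η 3 x.1 (Y x).1)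
        (hYE.mono fun x hx => hx 3) ((hasFDerivAt_theta z).mul (hasFDerivAt_phi z)) h0 u
      simpa [coneCoef] using this
    all_goals
      refine fderiv_eq_zero_of_eventually (hYE.mono fun x hx => ?_) u
    · simpa [coneCoef] using hx 4
    · simpa [coneCoef] using hx 5
    · simpa [coneCoef] using hx 6
  have hv := hVE.self_of_nhds
  have hw := hWE.self_of_nhds
  -- The coefficients of `V` and `W` are proportional, so their product is symmetric in j and i,
  -- while the structure functions are antisymmetric.
  have anti : ∀ k, ∑ j, ∑ i, η j z.1 (V z).1 * η i z.1 (W z).1 * structureFun e η j i k z.1 = 0 := by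
    intro k
    have h1 : ∑ j, ∑ i, η j z.1 (V z).1 * η i z.1 (W z).1 * structureFun e η j i k z.1 =
        ∑ i, ∑ j, η j z.1 (V z).1 * η i z.1 (W z).1 * structureFun e η j i k z.1 :=
      Finset.sum_comm
    have h2 : ∑ i, ∑ j, η j z.1 (V z).1 * η i z.1 (W z).1 * structureFun e η j i k z.1 =
        - ∑ j, ∑ i, η j z.1 (V z).1 * η i z.1 (W z).1 * structureFun e η j i k z.1 := by
      rw [← Finset.sum_neg_distrib]
      refine Finset.sum_congr rfl fun i _ => ?_
      rw [← Finset.sum_neg_distrib]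
      refine Finset.sum_congr rfl fun j _ => ?_
      rw [hv j, hv i, hw j, hw i, structureFun_swap e η j i]; ring
    linarith
  obtain ⟨a1, a2, a3, a4, a5, a6⟩ := key hW hWE (V z)
  obtain ⟨b1, b2, b3, b4, b5, b6⟩ := key hV hVE (W z)
  unfold InDerived
  simp only [h.lieBracket_fst hz hV hW, anti, a1, a2, a3, a4, a5, a6, b1, b2, b3, b4, b5, b6]
  refine ⟨by ring, by ring, by ring, by ring⟩

/-- The η4, η5, η6 components of `V` and `W` vanish identically nearby, so only the algebraic
bracket pairing remains. Pairing ζ with the tangent hyperplane of the cone gives (w2 - φ w0)(1, 2θ,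
θ²) modulo D. -/
lemma inSecondDerived_lieBracket (hWE : ∀ᶠ x in 𝓝 z, InDerived η W x) :
    InSecondDerived η (lieBracket ℝ V W) z := by
  have hv := hVE.self_of_nhds
  have v1 := hv 1; have v2 := hv 2; have v3 := hv 3; have v4 := hv 4; have v5 := hv 5
  have v6 := hv 6
  simp [coneCoef] at v1 v2 v3 v4 v5 v6
  obtain ⟨w3, w4, w5, w6⟩ := hWE.self_of_nhds
  have a4 := fderiv_eq_zero_of_eventually (hWE.mono fun x hx => hx.2.1) (V z)
  have a5 := fderiv_eq_zero_of_eventually (hWE.mono fun x hx => hx.2.2.1) (V z)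
  have a6 := fderiv_eq_zero_of_eventually (hWE.mono fun x hx => hx.2.2.2) (V z)
  have b4 := fderiv_eq_zero_of_eventually (hVE.mono fun x hx => hx.inDerived.2.1) (W z)
  have b5 := fderiv_eq_zero_of_eventually (hVE.mono fun x hx => hx.inDerived.2.2.1) (W z)
  have b6 := fderiv_eq_zero_of_eventually (hVE.mono fun x hx => hx.inDerived.2.2.2) (W z)
  obtain ⟨s4, s5, s6⟩ := h.sum_structureFun hz (v := fun j => η j z.1 (V z).1)
    (w := fun i => η i z.1 (W z).1) v4 v5 v6
  unfold InSecondDerived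
  simp only [h.lieBracket_fst hz hV hW, s4, s5, s6, a4, a5, a6, b4, b5, b6, w4, w5, w6, v1, v2, v3,
    w3]
  constructor <;> ring

/-- The moment covector kills [ζ, D] modulo D, the direction (1, 2θ, θ²) and its θ-derivative (0, 2,
2θ). What is left is the drift of (1, 2θ, θ²) along ζ, which is the obstruction. -/
lemma moment_lieBracket (hF : obstruction e η z.2.1 z.2.2 z.1 = 0)
    (hWE : ∀ᶠ x in 𝓝 z, InSecondDerived η W x) :
    moment η z (lieBracket ℝ V W z) = 0 := by
  have hv := hVE.self_of_nhds
  have v1 := hv 1; have v2 := hv 2; have v3 := hv 3; have v4 := hv 4; have v5 := hv 5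
  have v6 := hv 6
  simp [coneCoef] at v1 v2 v3 v4 v5 v6
  obtain ⟨w5, w6⟩ := hWE.self_of_nhds
  have h4 := h.differentiableAt_component hz hW 4
  have a5 := fderiv_eq_of_eventually_mul (hWE.mono fun x hx => hx.1)
    ((hasFDerivAt_theta z).const_mul 2) h4 (V z)
  have a6 := fderiv_eq_of_eventually_mul (hWE.mono fun x hx => hx.2)
    ((hasFDerivAt_theta z).pow 2) h4 (V z)
  simp at a5 a6
  have b4 := fderiv_eq_zero_of_eventually (hVE.mono fun x hx => hx.inDerived.2.1) (W z)
  have b5 := fderiv_eq_zero_of_eventually (hVE.mono fun x hx => hx.inDerived.2.2.1) (W z)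
  have b6 := fderiv_eq_zero_of_eventually (hVE.mono fun x hx => hx.inDerived.2.2.2) (W z)
  obtain ⟨s4, s5, s6⟩ := h.sum_structureFun hz (v := fun j => η j z.1 (V z).1)
    (w := fun i => η i z.1 (W z).1) v4 v5 v6
  unfold moment
  simp only [h.lieBracket_fst hz hV hW, s4, s5, s6, a5, a6, b4, b5, b6, w5, w6]
  simp only [obstruction, drift, Fin.sum_univ_seven] at hF
  simp only [Fin.sum_univ_seven]
  simp only [v1, v2, v3, v4, v5, v6]
  simp only [coneCoef, Matrix.cons_val] at hF ⊢
  -- `V` has ζ-coefficient η0(V), and `W` is η4(W) times (1, 2θ, θ²) modulo D. The moment of the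
  -- bracket is the product of these two coefficients with the obstruction.
  linear_combination (η 0 z.1 (V z).1 * η 4 z.1 (W z).1) * hF

end IsAdaptedCoframe

end Adapted

/-! ### Iterated brackets of the three generators of the prolongation. -/

section Spanning

open VectorField

lemma contDiffOn_lieBracket {G : Type*} [NormedAddCommGroup G] [NormedSpace ℝ G] {S : Set G}
    (hS : IsOpen S) {V W : G → G} (hV : ContDiffOn ℝ ∞ V S) (hW : ContDiffOn ℝ ∞ W S) :
    ContDiffOn ℝ ∞ (lieBracket ℝ V W) S :=
  ((hW.fderiv_of_isOpen hS (by simp)).clm_apply hV).sub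
    ((hV.fderiv_of_isOpen hS (by simp)).clm_apply hW)

variable {E : Type*} [NormedAddCommGroup E] [NormedSpace ℝ E]

/-- The coordinate field of the first fibre coordinate. -/
def thetaField (_ : E × ℝ × ℝ) : E × ℝ × ℝ := (0, 1, 0)

/-- The coordinate field of the second fibre coordinate. -/
def phiField (_ : E × ℝ × ℝ) : E × ℝ × ℝ := (0, 0, 1)

/-- The horizontal lift of the cone vector. -/
def coneField (e : Fin 7 → E → E) (z : E × ℝ × ℝ) : E × ℝ × ℝ :=
  (∑ k, coneCoef z.2.1 z.2.2 k • e k z.1, 0, 0)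

lemma hasFDerivAt_coneCoef (k : Fin 7) (z : E × ℝ × ℝ) :
    HasFDerivAt (fun z : E × ℝ × ℝ => coneCoef z.2.1 z.2.2 k)
      ((![0, 1, 0, z.2.2, 0, 0, 0] : Fin 7 → ℝ) k • dtheta +
        (![0, 0, 1, z.2.1, 0, 0, 0] : Fin 7 → ℝ) k • dphi) z := by
  have ht := hasFDerivAt_theta z
  have hp := hasFDerivAt_phi z
  fin_cases k
  · simpa [coneCoef] using hasFDerivAt_const (1 : ℝ) z
  · simpa [coneCoef] using ht
  · simpa [coneCoef] using hp
  · simpa [coneCoef, add_comm] using ht.fun_mul hp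
  all_goals simpa [coneCoef] using hasFDerivAt_const (0 : ℝ) z

lemma contDiff_coneCoef (k : Fin 7) :
    ContDiff ℝ ∞ (fun z : E × ℝ × ℝ => coneCoef z.2.1 z.2.2 k) := by
  fin_cases k <;> simp [coneCoef] <;> fun_prop

variable {e : Fin 7 → E → E} {η : Fin 7 → E → E →L[ℝ] ℝ} {O : Set E}

namespace IsAdaptedCoframe

variable (h : IsAdaptedCoframe e η O)
include h

lemma contDiffOn_coneField : ContDiffOn ℝ ∞ (coneField e) (O ×ˢ univ) := by
  refine ContDiffOn.prodMk (ContDiffOn.sum fun k _ => ?_) contDiffOn_const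
  exact (contDiff_coneCoef k).contDiffOn.smul
    ((h.smooth_frame k).comp contDiff_fst.contDiffOn fun z hz => hz.1)

lemma component_coneField {z : E × ℝ × ℝ} (hz : z.1 ∈ O) (k : Fin 7) :
    η k z.1 (coneField e z).1 = coneCoef z.2.1 z.2.2 k := by
  simp [coneField, h.dual z.1 hz]

lemma inProlongation_of_mem_span {Y : E × ℝ × ℝ → E × ℝ × ℝ} {z : E × ℝ × ℝ} (hz : z.1 ∈ O)
    (hY : (Y z).1 ∈ Submodule.span ℝ {(coneField e z).1}) : InProlongation η Y z := by
  obtain ⟨c, hc⟩ := Submodule.mem_span_singleton.1 hY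
  intro k
  rw [← hc, map_smul, map_smul, h.component_coneField hz, h.component_coneField hz]
  simp [coneCoef]; ring

/-- The components of the bracket with the first fibre coordinate field. -/
lemma component_thetaField_bracket {W : E × ℝ × ℝ → E × ℝ × ℝ} {z : E × ℝ × ℝ} (hz : z.1 ∈ O)
    (hW : DifferentiableAt ℝ W z) {k : Fin 7} {c : E × ℝ × ℝ → ℝ} {c' : E × ℝ × ℝ →L[ℝ] ℝ}
    (hc : HasFDerivAt c c' z) (hWc : ∀ x : E × ℝ × ℝ, x.1 ∈ O → η k x.1 (W x).1 = c x) :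
    η k z.1 (lieBracket ℝ thetaField W z).1 = c' (0, 1, 0) := by
  have hT : DifferentiableAt ℝ (thetaField : E × ℝ × ℝ → E × ℝ × ℝ) z :=
    differentiableAt_const ((0 : E), (1 : ℝ), (0 : ℝ))
  have hev : (fun x => η k x.1 (W x).1) =ᶠ[𝓝 z] c := by
    filter_upwards [continuousAt_fst.preimage_mem_nhds (h.isOpen.mem_nhds hz)] with x hx
      using hWc x hx
  rw [h.lieBracket_fst hz hT hW, hev.fderiv_eq, hc.fderiv]
  simp [thetaField]

lemma component_phiField_bracket {W : E × ℝ × ℝ → E × ℝ × ℝ} {z : E × ℝ × ℝ} (hz : z.1 ∈ O)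
    (hW : DifferentiableAt ℝ W z) {k : Fin 7} {c : E × ℝ × ℝ → ℝ} {c' : E × ℝ × ℝ →L[ℝ] ℝ}
    (hc : HasFDerivAt c c' z) (hWc : ∀ x : E × ℝ × ℝ, x.1 ∈ O → η k x.1 (W x).1 = c x) :
    η k z.1 (lieBracket ℝ phiField W z).1 = c' (0, 0, 1) := by
  have hT : DifferentiableAt ℝ (phiField : E × ℝ × ℝ → E × ℝ × ℝ) z :=
    differentiableAt_const ((0 : E), (0 : ℝ), (1 : ℝ))
  have hev : (fun x => η k x.1 (W x).1) =ᶠ[𝓝 z] c := by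
    filter_upwards [continuousAt_fst.preimage_mem_nhds (h.isOpen.mem_nhds hz)] with x hx
      using hWc x hx
  rw [h.lieBracket_fst hz hT hW, hev.fderiv_eq, hc.fderiv]
  simp [phiField]

/-- The components of the bracket with the cone field of a field whose fibre components vanish and
whose component along `e k` depends only on the fibre coordinates. -/
lemma component_coneField_bracket {W : E × ℝ × ℝ → E × ℝ × ℝ} {z : E × ℝ × ℝ} (hz : z.1 ∈ O)
    (hW : DifferentiableAt ℝ W z) (hW2 : (W z).2 = 0) {k : Fin 7} {c : E × ℝ × ℝ → ℝ} {a b : ℝ}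
    (hc : HasFDerivAt c (a • dtheta + b • dphi) z)
    (hWc : ∀ x : E × ℝ × ℝ, x.1 ∈ O → η k x.1 (W x).1 = c x) :
    η k z.1 (lieBracket ℝ (coneField e) W z).1 =
      ∑ j, ∑ i, coneCoef z.2.1 z.2.2 j * η i z.1 (W z).1 * structureFun e η j i k z.1 := by
  have hnhds : O ×ˢ (univ : Set (ℝ × ℝ)) ∈ 𝓝 z :=
    (h.isOpen.prod isOpen_univ).mem_nhds ⟨hz, trivial⟩
  have hT : DifferentiableAt ℝ (coneField e) z :=
    (h.contDiffOn_coneField.contDiffAt hnhds).differentiableAt (by simp)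
  have hev : (fun x => η k x.1 (W x).1) =ᶠ[𝓝 z] c := by
    filter_upwards [hnhds] with x hx using hWc x hx.1
  have hev2 : (fun x => η k x.1 (coneField e x).1) =ᶠ[𝓝 z] fun x => coneCoef x.2.1 x.2.2 k := by
    filter_upwards [hnhds] with x hx using h.component_coneField hx.1 k
  rw [h.lieBracket_fst hz hT hW, hev.fderiv_eq, hev2.fderiv_eq, hc.fderiv,
    (hasFDerivAt_coneCoef k z).fderiv]
  simp only [h.component_coneField hz]
  simp [coneField, hW2]

-- Keeps the iterated brackets free of fibre components, as `component_coneField_bracket` requires.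
omit h in
lemma snd_lieBracket_eq_zero {V W : E × ℝ × ℝ → E × ℝ × ℝ} {z : E × ℝ × ℝ} (hO : IsOpen O)
    (hz : z.1 ∈ O) (hV : DifferentiableAt ℝ V z) (hW : DifferentiableAt ℝ W z) (c : ℝ × ℝ)
    (hV2 : ∀ x : E × ℝ × ℝ, x.1 ∈ O → (V x).2 = c)
    (hW2 : ∀ x : E × ℝ × ℝ, x.1 ∈ O → (W x).2 = 0) : (lieBracket ℝ V W z).2 = 0 := by
  have hev : (fun x => (V x).2) =ᶠ[𝓝 z] fun _ => c := by
    filter_upwards [continuousAt_fst.preimage_mem_nhds (hO.mem_nhds hz)] with x hx using hV2 x hx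
  have hev2 : (fun x => (W x).2) =ᶠ[𝓝 z] fun _ => 0 := by
    filter_upwards [continuousAt_fst.preimage_mem_nhds (hO.mem_nhds hz)] with x hx using hW2 x hx
  rw [lieBracket_snd hV hW, hev.fderiv_eq, hev2.fderiv_eq]
  simp

/-- Where the obstruction does not vanish, iterated brackets of length at most four of sections of
the prolongation span the tangent space. -/
lemma eq_zero_of_iterated_brackets {z : E × ℝ × ℝ} (hz : z.1 ∈ O)
    (hF : obstruction e η z.2.1 z.2.2 z.1 ≠ 0) (β : E × ℝ × ℝ →L[ℝ] ℝ)
    (b1 : β (thetaField z) = 0) (b2 : β (phiField z) = 0) (b3 : β (coneField e z) = 0)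
    (b4 : β (lieBracket ℝ thetaField (coneField e) z) = 0)
    (b5 : β (lieBracket ℝ phiField (coneField e) z) = 0)
    (b6 : β (lieBracket ℝ thetaField (lieBracket ℝ phiField (coneField e)) z) = 0)
    (b7 : β (lieBracket ℝ (coneField e) (lieBracket ℝ phiField (coneField e)) z) = 0)
    (b8 : β (lieBracket ℝ thetaField
      (lieBracket ℝ (coneField e) (lieBracket ℝ phiField (coneField e))) z) = 0)
    (b9 : β (lieBracket ℝ (coneField e)
      (lieBracket ℝ (coneField e) (lieBracket ℝ phiField (coneField e))) z) = 0) : β = 0 := by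
  have hS : IsOpen (O ×ˢ (univ : Set (ℝ × ℝ))) := h.isOpen.prod isOpen_univ
  have hdiff : ∀ {Y : E × ℝ × ℝ → E × ℝ × ℝ}, ContDiffOn ℝ ∞ Y (O ×ˢ univ) →
      ∀ x : E × ℝ × ℝ, x.1 ∈ O → DifferentiableAt ℝ Y x := fun hY x hx =>
    (hY.contDiffAt (hS.mem_nhds ⟨hx, trivial⟩)).differentiableAt (by simp)
  have sT : ContDiffOn ℝ ∞ (thetaField : E × ℝ × ℝ → E × ℝ × ℝ) (O ×ˢ univ) :=
    contDiffOn_const (c := ((0 : E), (1 : ℝ), (0 : ℝ)))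
  have sP : ContDiffOn ℝ ∞ (phiField : E × ℝ × ℝ → E × ℝ × ℝ) (O ×ˢ univ) :=
    contDiffOn_const (c := ((0 : E), (0 : ℝ), (1 : ℝ)))
  have sZ := h.contDiffOn_coneField
  set B := lieBracket ℝ phiField (coneField e) with hB
  set C := lieBracket ℝ (coneField e) B with hC
  have sB : ContDiffOn ℝ ∞ B (O ×ˢ univ) := contDiffOn_lieBracket hS sP sZ
  have sC : ContDiffOn ℝ ∞ C (O ×ˢ univ) := contDiffOn_lieBracket hS sZ sB
  have Z2 : ∀ x : E × ℝ × ℝ, x.1 ∈ O → (coneField e x).2 = 0 := fun x _ => rfl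
  have B2 : ∀ x : E × ℝ × ℝ, x.1 ∈ O → (B x).2 = 0 := fun x hx =>
    snd_lieBracket_eq_zero h.isOpen hx (hdiff sP x hx) (hdiff sZ x hx) (0, 1) (fun _ _ => rfl) Z2
  have C2 : ∀ x : E × ℝ × ℝ, x.1 ∈ O → (C x).2 = 0 := fun x hx =>
    snd_lieBracket_eq_zero h.isOpen hx (hdiff sZ x hx) (hdiff sB x hx) 0 Z2 B2
  -- The bracket `B` = [∂φ, ζ] is e2 + θ e3.
  have compB : ∀ k, ∀ x : E × ℝ × ℝ, x.1 ∈ O →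
      η k x.1 (B x).1 = (![0, 0, 1, x.2.1, 0, 0, 0] : Fin 7 → ℝ) k := fun k x hx => by
    rw [hB, h.component_phiField_bracket hx (hdiff sZ x hx) (hasFDerivAt_coneCoef k x)
      (fun x hx => h.component_coneField hx k)]
    simp
  have derB : ∀ k, ∀ x : E × ℝ × ℝ,
      HasFDerivAt (fun x : E × ℝ × ℝ => (![0, 0, 1, x.2.1, 0, 0, 0] : Fin 7 → ℝ) k)
        ((![0, 0, 0, 1, 0, 0, 0] : Fin 7 → ℝ) k • dtheta + (0 : ℝ) • dphi) x := fun k x => by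
    fin_cases k
    · simpa using hasFDerivAt_const (0 : ℝ) x
    · simpa using hasFDerivAt_const (0 : ℝ) x
    · simpa using hasFDerivAt_const (1 : ℝ) x
    · simpa using hasFDerivAt_theta x
    all_goals simpa using hasFDerivAt_const (0 : ℝ) x
  -- Modulo D, the bracket `C` = [ζ, `B`] is e4 + 2θ e5 + θ² e6.
  have compC : ∀ x : E × ℝ × ℝ, x.1 ∈ O → η 4 x.1 (C x).1 = 1 ∧ η 5 x.1 (C x).1 = 2 * x.2.1 ∧
      η 6 x.1 (C x).1 = x.2.1 ^ 2 := fun x hx => by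
    have hk := fun k => h.component_coneField_bracket hx (hdiff sB x hx) (B2 x hx) (derB k x)
      (compB k)
    obtain ⟨s4, s5, s6⟩ := h.sum_structureFun hx (v := coneCoef x.2.1 x.2.2)
      (w := fun i => η i x.1 (B x).1) rfl rfl rfl
    rw [hk 4, hk 5, hk 6, s4, s5, s6]
    simp only [compB _ x hx]
    simp only [coneCoef, Matrix.cons_val]
    refine ⟨by ring, by ring, by ring⟩
  have expand : ∀ Y : E × ℝ × ℝ, β Y = ∑ k, η k z.1 Y.1 * β (e k z.1, 0, 0)
      + Y.2.1 * β (thetaField z) + Y.2.2 * β (phiField z) := by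
    intro Y
    have : Y = (∑ k, η k z.1 Y.1 • ((e k z.1, 0, 0) : E × ℝ × ℝ)) + Y.2.1 • thetaField z
        + Y.2.2 • phiField z := by
      refine Prod.ext ?_ (Prod.ext ?_ ?_)
      · simp [thetaField, phiField, Prod.fst_sum, h.expand z.1 hz]
      · simp [thetaField, phiField, Prod.snd_sum]
      · simp [thetaField, phiField, Prod.snd_sum]
    conv_lhs => rw [this]
    simp only [map_add, map_sum, map_smul, smul_eq_mul]
  simp only [b1, b2, mul_zero, add_zero] at expand
  rw [expand] at b3 b4 b5 b6 b7 b8 b9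
  have c4 : ∀ k, η k z.1 (lieBracket ℝ thetaField (coneField e) z).1 =
      (![0, 1, 0, z.2.2, 0, 0, 0] : Fin 7 → ℝ) k := fun k => by
    rw [h.component_thetaField_bracket hz (hdiff sZ z hz) (hasFDerivAt_coneCoef k z)
      (fun x hx => h.component_coneField hx k)]
    simp
  have c6 : ∀ k, η k z.1 (lieBracket ℝ thetaField B z).1 =
      (![0, 0, 0, 1, 0, 0, 0] : Fin 7 → ℝ) k := fun k => by
    rw [h.component_thetaField_bracket hz (hdiff sB z hz) (derB k z) (compB k)]
    simp
  simp only [h.component_coneField hz] at b3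
  simp only [c4] at b4
  simp only [compB _ z hz] at b5
  simp only [c6] at b6
  simp only [Fin.sum_univ_seven, coneCoef, Matrix.cons_val] at b3 b4 b5 b6
  -- The system is triangular: [∂θ, `B`] = e3, then `B` gives e2, [∂θ, ζ] = e1 + φ e3 gives e1, and
  -- ζ gives e0.
  have e3 : β (e 3 z.1, 0, 0) = 0 := by linarith
  have e2 : β (e 2 z.1, 0, 0) = 0 := by rw [e3] at b5; linarith
  have e1 : β (e 1 z.1, 0, 0) = 0 := by rw [e3] at b4; linarith
  have e0 : β (e 0 z.1, 0, 0) = 0 := by rw [e1, e2, e3] at b3; linarith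
  simp only [Fin.sum_univ_seven, e0, e1, e2, e3, mul_zero, zero_add] at b7 b8 b9
  obtain ⟨C4, C5, C6⟩ := compC z hz
  have d4 : HasFDerivAt (fun _ : E × ℝ × ℝ => (1 : ℝ)) ((0 : ℝ) • dtheta + (0 : ℝ) • dphi) z := by
    simpa using hasFDerivAt_const (1 : ℝ) z
  have d5 : HasFDerivAt (fun x : E × ℝ × ℝ => 2 * x.2.1) ((2 : ℝ) • dtheta + (0 : ℝ) • dphi) z := by
    simpa using (hasFDerivAt_theta z).const_mul 2
  have d6 : HasFDerivAt (fun x : E × ℝ × ℝ => x.2.1 ^ 2)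
      ((2 * z.2.1 : ℝ) • dtheta + (0 : ℝ) • dphi) z := by
    simpa using (hasFDerivAt_theta z).pow 2
  rw [h.component_thetaField_bracket hz (hdiff sC z hz) d4 (fun x hx => (compC x hx).1),
    h.component_thetaField_bracket hz (hdiff sC z hz) d5 (fun x hx => (compC x hx).2.1),
    h.component_thetaField_bracket hz (hdiff sC z hz) d6 (fun x hx => (compC x hx).2.2)] at b8
  rw [C4, C5, C6] at b7
  obtain ⟨s4, s5, s6⟩ := h.sum_structureFun hz (v := coneCoef z.2.1 z.2.2)
    (w := fun i => η i z.1 (C z).1) rfl rfl rfl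
  rw [h.component_coneField_bracket hz (hdiff sC z hz) (C2 z hz) d4 (fun x hx => (compC x hx).1),
    h.component_coneField_bracket hz (hdiff sC z hz) (C2 z hz) d5 (fun x hx => (compC x hx).2.1),
    h.component_coneField_bracket hz (hdiff sC z hz) (C2 z hz) d6 (fun x hx => (compC x hx).2.2),
    s4, s5, s6, C4, C5, C6] at b9
  simp at b8
  have e5 : β (e 5 z.1, 0, 0) = - z.2.1 * β (e 6 z.1, 0, 0) := by linarith
  have e4 : β (e 4 z.1, 0, 0) = z.2.1 ^ 2 * β (e 6 z.1, 0, 0) := by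
    rw [e5] at b7; linear_combination b7
  -- `C` and [∂θ, `C`] have made β a multiple of the moment covector modulo D. Its value on [ζ, `C`]
  -- is that multiple times the obstruction.
  have e6 : obstruction e η z.2.1 z.2.2 z.1 * β (e 6 z.1, 0, 0) = 0 := by
    rw [e4, e5] at b9
    simp only [Fin.sum_univ_seven, coneCoef, Matrix.cons_val] at b9
    simp only [obstruction, drift, Fin.sum_univ_seven, coneCoef, Matrix.cons_val]
    linear_combination b9
  have e6' := (mul_eq_zero.1 e6).resolve_left hF
  ext Y
  · simp only [ContinuousLinearMap.comp_apply, ContinuousLinearMap.inl_apply]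
    rw [expand]
    simp [Fin.sum_univ_seven, e0, e1, e2, e3, e4, e5, e6']
  all_goals
    simp only [ContinuousLinearMap.comp_apply, ContinuousLinearMap.inr_apply]
    rw [expand]
    simp

end IsAdaptedCoframe

end Spanning

/-! ### The adapted coframe of a hyperbolic distribution in a chart. -/

section AdaptedChart

open VectorField

variable {X : Type*} [TopologicalSpace X] [ChartedSpace (EuclideanSpace ℝ (Fin 7)) X]
  [IsManifold (𝓡 7) ∞ X]

/-- The chart representatives of an adapted frame, completed by brackets. -/
def frameRep (p : X) (ξ : Fin 4 → Π x : X, TangentSpace (𝓡 7) x) :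
    Fin 7 → EuclideanSpace ℝ (Fin 7) → EuclideanSpace ℝ (Fin 7) :=
  ![chartField (𝓡 7) p (ξ 0), chartField (𝓡 7) p (ξ 1), chartField (𝓡 7) p (ξ 2),
    chartField (𝓡 7) p (ξ 3),
    lieBracket ℝ (chartField (𝓡 7) p (ξ 0)) (chartField (𝓡 7) p (ξ 2)),
    lieBracket ℝ (chartField (𝓡 7) p (ξ 0)) (chartField (𝓡 7) p (ξ 3)),
    lieBracket ℝ (chartField (𝓡 7) p (ξ 1)) (chartField (𝓡 7) p (ξ 3))]

variable {D : Π x : X, Submodule ℝ (TangentSpace (𝓡 7) x)} {U : Set X}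
  {ξ : Fin 4 → Π x : X, TangentSpace (𝓡 7) x}

/-- A covector killing the frame of `D` kills `D`. -/
lemma IsAdaptedFrameOn.map_eq_zero (hξ : IsAdaptedFrameOn D U ξ) {x : X} (hx : x ∈ U)
    {w : TangentSpace (𝓡 7) x} (hw : w ∈ D x) (f : TangentSpace (𝓡 7) x →ₗ[ℝ] ℝ)
    (hf : ∀ i, f (ξ i x) = 0) : f w = 0 := by
  have : D x ≤ LinearMap.ker f := by
    rw [← (hξ.1.2 x hx).2, Submodule.span_le]
    rintro _ ⟨i, rfl⟩
    exact hf i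
  exact this hw

omit [IsManifold (𝓡 7) ∞ X] in
lemma frameRep_castLE (p : X) (i : Fin 4) :
    frameRep p ξ (Fin.castLE (by decide) i) = chartField (𝓡 7) p (ξ i) := by
  fin_cases i <;> rfl

lemma IsCoframe.eq_zero_of_mem {η : Fin 7 → EuclideanSpace ℝ (Fin 7) →
      EuclideanSpace ℝ (Fin 7) →L[ℝ] ℝ} {p : X}
    (h : IsCoframe (frameRep p ξ) η (chartSet (𝓡 7) p U)) (hξ : IsAdaptedFrameOn D U ξ)
    {y : EuclideanSpace ℝ (Fin 7)} (hy : y ∈ chartSet (𝓡 7) p U)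
    {w : TangentSpace (𝓡 7) ((extChartAt (𝓡 7) p).symm y)}
    (hw : w ∈ D ((extChartAt (𝓡 7) p).symm y)) {k : Fin 7} (hk : 4 ≤ k) :
    η k y (mfderiv (𝓡 7) 𝓘(ℝ, EuclideanSpace ℝ (Fin 7)) (extChartAt (𝓡 7) p)
      ((extChartAt (𝓡 7) p).symm y) w) = 0 := by
  refine hξ.map_eq_zero hy.2 hw ((η k y).toLinearMap ∘ₗ
    (mfderiv (𝓡 7) 𝓘(ℝ, EuclideanSpace ℝ (Fin 7)) (extChartAt (𝓡 7) p)
      ((extChartAt (𝓡 7) p).symm y)).toLinearMap) fun i => ?_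
  have h1 := h.dual y hy k (Fin.castLE (by decide) i)
  rw [frameRep_castLE] at h1
  refine h1.trans (if_neg ?_)
  rintro rfl
  revert hk
  fin_cases i <;> decide

/-- The three completing fields are brackets, so `zero_two`, `zero_three` and `one_three` are mere
duality. The other identities say that a field with values in D has no components along e4, e5, e6.
-/
lemma exists_adaptedCoframe (hU : IsOpen U) (hξ : IsAdaptedFrameOn D U ξ) (p : X) :
    ∃ η, IsAdaptedCoframe (frameRep p ξ) η (chartSet (𝓡 7) p U) := by
  have hO := isOpen_chartSet (I := 𝓡 7) p hU
  have hs : ∀ i, ContDiffOn ℝ ∞ (chartField (𝓡 7) p (ξ i)) (chartSet (𝓡 7) p U) := fun i =>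
    contDiffOn_chartField hU (hξ.1.1 i)
  have hbr : ∀ i j, ∀ y ∈ chartSet (𝓡 7) p U,
      chartField (𝓡 7) p (mlieBracket (𝓡 7) (ξ i) (ξ j)) y =
        lieBracket ℝ (chartField (𝓡 7) p (ξ i)) (chartField (𝓡 7) p (ξ j)) y := fun i j y hy =>
    chartField_mlieBracket hU (hξ.1.1 i) (hξ.1.1 j) hy
  obtain ⟨η, hη⟩ := exists_coframe (e := frameRep p ξ) hO (by simp) (fun i => by
    fin_cases i
    · exact hs 0
    · exact hs 1
    · exact hs 2
    · exact hs 3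
    · exact contDiffOn_lieBracket hO (hs 0) (hs 2)
    · exact contDiffOn_lieBracket hO (hs 0) (hs 3)
    · exact contDiffOn_lieBracket hO (hs 1) (hs 3)) (fun y hy => by
    have hli := (hξ.2 _ hy.2).2.2.2
    have hinj : LinearMap.ker (mfderiv (𝓡 7) 𝓘(ℝ, EuclideanSpace ℝ (Fin 7)) (extChartAt (𝓡 7) p)
        ((extChartAt (𝓡 7) p).symm y)).toLinearMap = ⊥ :=
      LinearMap.ker_eq_bot.2 (mfderiv_extChartAt_isInvertible
        ((extChartAt (𝓡 7) p).map_target hy.1)).injective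
    have h2 := hli.map' _ hinj
    have hcongr : ∀ {u v : Fin 7 → EuclideanSpace ℝ (Fin 7)}, LinearIndependent ℝ u → v = u →
        LinearIndependent ℝ v := fun h e => e ▸ h
    refine hcongr h2 (funext fun i => ?_)
    fin_cases i
    · rfl
    · rfl
    · rfl
    · rfl
    · exact (hbr 0 2 y hy).symm
    · exact (hbr 0 3 y hy).symm
    · exact (hbr 1 3 y hy).symm)
  have hmem : ∀ y ∈ chartSet (𝓡 7) p U, ∀ k : Fin 7, 4 ≤ k → ∀ V : Π x : X, TangentSpace (𝓡 7) x,
      V ((extChartAt (𝓡 7) p).symm y) ∈ D ((extChartAt (𝓡 7) p).symm y) →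
      η k y (chartField (𝓡 7) p V y) = 0 := fun y hy k hk V hV =>
    hη.eq_zero_of_mem hξ hy hV hk
  refine ⟨η, hη, fun y hy k hk => ?_, fun y hy k hk => ?_, fun y hy k hk => ?_, fun y hy k hk => ?_,
    fun y hy k hk => ?_, fun y hy k hk => ?_⟩
  · refine (congrArg (η k y) (hbr 0 1 y hy)).symm.trans (hmem y hy k hk _ (hξ.2 _ hy.2).1)
  · refine (congrArg (η k y) (hbr 2 3 y hy)).symm.trans (hmem y hy k hk _ (hξ.2 _ hy.2).2.1)
  · exact hη.dual y hy k 4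
  · exact hη.dual y hy k 5
  · have h1 := hmem y hy k hk (mlieBracket (𝓡 7) (ξ 0) (ξ 3) - mlieBracket (𝓡 7) (ξ 1) (ξ 2))
      (hξ.2 _ hy.2).2.2.1
    have h2 : chartField (𝓡 7) p
        (mlieBracket (𝓡 7) (ξ 0) (ξ 3) - mlieBracket (𝓡 7) (ξ 1) (ξ 2)) y =
        lieBracket ℝ (chartField (𝓡 7) p (ξ 0)) (chartField (𝓡 7) p (ξ 3)) y -
        lieBracket ℝ (chartField (𝓡 7) p (ξ 1)) (chartField (𝓡 7) p (ξ 2)) y := by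
      rw [← hbr 0 3 y hy, ← hbr 1 2 y hy]
      exact map_sub (mfderiv (𝓡 7) 𝓘(ℝ, EuclideanSpace ℝ (Fin 7)) (extChartAt (𝓡 7) p)
        ((extChartAt (𝓡 7) p).symm y)) _ _
    rw [h2, map_sub, sub_eq_zero] at h1
    exact h1.symm.trans (hη.dual y hy k 5)
  · exact hη.dual y hy k 6

end AdaptedChart

/-! ### The prolongation in the product chart. -/

section Growth

open VectorField

variable {X : Type*} [TopologicalSpace X] [ChartedSpace (EuclideanSpace ℝ (Fin 7)) X]

lemma extChartAt_chartModel (p : X) (q₀ : ℝ × ℝ) :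
    extChartAt chartModel (p, q₀) =
      (extChartAt (𝓡 7) p).prod (PartialEquiv.refl (ℝ × ℝ)) := by
  rw [extChartAt_prod, extChartAt_model_space_eq_id]

lemma extChartAt_chartModel_coe (p : X) (q₀ : ℝ × ℝ) :
    (extChartAt chartModel (p, q₀) : X × (ℝ × ℝ) → EuclideanSpace ℝ (Fin 7) × (ℝ × ℝ)) =
      Prod.map (extChartAt (𝓡 7) p) id := by
  rw [extChartAt_chartModel]; rfl

lemma extChartAt_chartModel_symm_apply (p : X) (q₀ : ℝ × ℝ)
    (z : EuclideanSpace ℝ (Fin 7) × (ℝ × ℝ)) :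
    (extChartAt chartModel (p, q₀)).symm z = ((extChartAt (𝓡 7) p).symm z.1, z.2) := by
  rw [extChartAt_chartModel]; rfl

lemma chartSet_chartModel (p : X) (q₀ : ℝ × ℝ) (U : Set X) :
    chartSet chartModel (p, q₀) (U ×ˢ univ) = chartSet (𝓡 7) p U ×ˢ univ := by
  ext z
  simp only [chartSet, mem_inter_iff, mem_preimage, extChartAt_chartModel_symm_apply]
  rw [extChartAt_chartModel]
  simp only [PartialEquiv.prod_target, PartialEquiv.refl_target, mem_prod, mem_univ, and_true,
    mem_inter_iff, mem_preimage]

variable [IsManifold (𝓡 7) ∞ X]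

/-- The chart of the product is the chart of X times the identity of ℝ², so its derivative leaves
the fibre component alone. -/
lemma mfderiv_extChartAt_chartModel {p x : X} (hx : x ∈ (extChartAt (𝓡 7) p).source)
    (q₀ q : ℝ × ℝ) (w : TangentSpace chartModel (x, q)) :
    mfderiv chartModel 𝓘(ℝ, EuclideanSpace ℝ (Fin 7) × (ℝ × ℝ)) (extChartAt chartModel (p, q₀))
      (x, q) w =
    (mfderiv (𝓡 7) 𝓘(ℝ, EuclideanSpace ℝ (Fin 7)) (extChartAt (𝓡 7) p) x w.1, w.2) := by
  have h1 : MDifferentiableAt (𝓡 7) 𝓘(ℝ, EuclideanSpace ℝ (Fin 7)) (extChartAt (𝓡 7) p) x :=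
    (contMDiffAt_chart hx).mdifferentiableAt (by simp)
  have h2 : MDifferentiableAt 𝓘(ℝ, ℝ × ℝ) 𝓘(ℝ, ℝ × ℝ) (id : ℝ × ℝ → ℝ × ℝ) q :=
    mdifferentiableAt_id
  have h3 := mfderiv_prodMap (p := (x, q)) h1 h2
  rw [extChartAt_chartModel_coe, modelWithCornersSelf_prod, ← chartedSpaceSelf_prod]
  rw [h3, mfderiv_id]
  rfl

lemma chartField_chartModel {p : X} (q₀ : ℝ × ℝ) (V : Π z, TangentSpace (M := X × (ℝ × ℝ)) chartModel z)
    {z : EuclideanSpace ℝ (Fin 7) × (ℝ × ℝ)} (hz : z.1 ∈ (extChartAt (𝓡 7) p).target) :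
    chartField chartModel (p, q₀) V z =
      (mfderiv (𝓡 7) 𝓘(ℝ, EuclideanSpace ℝ (Fin 7)) (extChartAt (𝓡 7) p)
        ((extChartAt (𝓡 7) p).symm z.1) (V ((extChartAt (𝓡 7) p).symm z.1, z.2)).1,
        (V ((extChartAt (𝓡 7) p).symm z.1, z.2)).2) := by
  unfold chartField
  rw [extChartAt_chartModel_symm_apply]
  exact mfderiv_extChartAt_chartModel ((extChartAt (𝓡 7) p).map_target hz) q₀ z.2 _

variable {ξ : Fin 4 → Π x : X, TangentSpace (𝓡 7) x}

omit [IsManifold (𝓡 7) ∞ X] in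
lemma mem_prolongation {z : X × (ℝ × ℝ)} {w : TangentSpace chartModel z} :
    w ∈ prolongation ξ z ↔ w.1 ∈ Submodule.span ℝ {chartVector ξ z} := by
  unfold prolongation
  rw [mfderiv_fst]
  rfl

omit [IsManifold (𝓡 7) ∞ X] in
lemma chartField_chartVector {p : X} {z : EuclideanSpace ℝ (Fin 7) × (ℝ × ℝ)} :
    mfderiv (𝓡 7) 𝓘(ℝ, EuclideanSpace ℝ (Fin 7)) (extChartAt (𝓡 7) p)
      ((extChartAt (𝓡 7) p).symm z.1) (chartVector ξ ((extChartAt (𝓡 7) p).symm z.1, z.2)) =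
    (coneField (frameRep p ξ) z).1 := by
  unfold chartVector
  rw [map_add, map_add, map_add, map_smul, map_smul, map_smul]
  simp only [coneField, Fin.sum_univ_seven, coneCoef, Matrix.cons_val, one_smul, zero_smul,
    add_zero]
  rfl

lemma map_mem_span_singleton_iff {A B : Type*} [AddCommGroup A] [Module ℝ A] [TopologicalSpace A]
    [AddCommGroup B] [Module ℝ B] [TopologicalSpace B] (L : A →L[ℝ] B) (hL : Function.Injective L)
    {v w : A} : L v ∈ Submodule.span ℝ {L w} ↔ v ∈ Submodule.span ℝ {w} := by
  simp only [Submodule.mem_span_singleton, ← map_smul, hL.eq_iff]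

/-- The chart derivative is injective and carries the cone vector to the horizontal part of
`coneField`, so the condition of being proportional to it is the same on both sides. -/
lemma mem_prolongation_iff {p : X} (q₀ : ℝ × ℝ)
    {V : Π z, TangentSpace (M := X × (ℝ × ℝ)) chartModel z}
    {z : EuclideanSpace ℝ (Fin 7) × (ℝ × ℝ)} (hz : z.1 ∈ (extChartAt (𝓡 7) p).target) :
    V ((extChartAt (𝓡 7) p).symm z.1, z.2) ∈
      prolongation ξ ((extChartAt (𝓡 7) p).symm z.1, z.2) ↔
    (chartField chartModel (p, q₀) V z).1 ∈ Submodule.span ℝ {(coneField (frameRep p ξ) z).1} := by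
  rw [mem_prolongation, chartField_chartModel q₀ V hz, ← chartField_chartVector]
  have hinj := (mfderiv_extChartAt_isInvertible (I := 𝓡 7)
    ((extChartAt (𝓡 7) p).map_target hz)).injective
  exact (map_mem_span_singleton_iff _ hinj).symm

end Growth

/-! ### Upper bounds for the derived systems. -/

section GrowthBounds

open VectorField

/-- The fields whose chart representative is smooth on `S` with values in `N`. -/
def fieldsWithValuesIn {E : Type*} [NormedAddCommGroup E] [NormedSpace ℝ E]
    {H : Type*} [TopologicalSpace H]
    (I : ModelWithCorners ℝ E H) {M : Type*} [TopologicalSpace M] [ChartedSpace H M]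
    [IsManifold I ∞ M] (p : M) (S : Set E) (N : E → Submodule ℝ E) :
    Submodule ℝ (Π x : M, TangentSpace I x) where
  carrier := {V | ContDiffOn ℝ ∞ (chartField I p V) S ∧ ∀ z ∈ S, chartField I p V z ∈ N z}
  add_mem' := by
    intro V W hV hW
    have : chartField I p (V + W) = chartField I p V + chartField I p W :=
      funext fun y => map_add (chartFieldLinear I p y) _ _
    rw [mem_ofPred_eq, this]
    exact ⟨hV.1.add hW.1, fun z hz => (N z).add_mem (hV.2 z hz) (hW.2 z hz)⟩
  zero_mem' := by
    have : chartField I p (0 : Π x : M, TangentSpace I x) = 0 :=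
      funext fun y => map_zero (chartFieldLinear I p y)
    rw [mem_ofPred_eq, this]
    exact ⟨contDiffOn_const, fun z _ => (N z).zero_mem⟩
  smul_mem' := by
    intro c V hV
    have : chartField I p (c • V) = c • chartField I p V :=
      funext fun y => map_smul (chartFieldLinear I p y) _ _
    rw [mem_ofPred_eq, this]
    exact ⟨contDiffOn_const.smul hV.1, fun z hz => (N z).smul_mem c (hV.2 z hz)⟩

section Submodules

variable {E : Type*} [NormedAddCommGroup E] [NormedSpace ℝ E]
  (η : Fin 7 → E → E →L[ℝ] ℝ) (z : E × ℝ × ℝ)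

/-- The fibre of the prolongation. -/
def prolongationSubmodule : Submodule ℝ (E × ℝ × ℝ) where
  carrier := {v | InProlongation η (fun _ => v) z}
  add_mem' := by
    intro v w hv hw k
    have a := hv k
    have b := hw k
    simp only [Prod.fst_add, map_add] at a b ⊢
    rw [a, b]; ring
  zero_mem' := fun k => by simp
  smul_mem' := by
    intro c v hv k
    have a := hv k
    simp only [Prod.smul_fst, map_smul, smul_eq_mul] at a ⊢
    rw [a]; ring

/-- The fibre of the first derived distribution. -/
def derivedSubmodule : Submodule ℝ (E × ℝ × ℝ) where
  carrier := {v | InDerived η (fun _ => v) z}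
  add_mem' := by
    rintro v w ⟨a1, a2, a3, a4⟩ ⟨b1, b2, b3, b4⟩
    refine ⟨?_, ?_, ?_, ?_⟩ <;> simp only [Prod.fst_add, map_add, a2, a3, a4, b2, b3, b4, add_zero]
    rw [a1, b1]; ring
  zero_mem' := by simp [InDerived]
  smul_mem' := by
    rintro c v ⟨a1, a2, a3, a4⟩
    refine ⟨?_, ?_, ?_, ?_⟩ <;>
      simp only [Prod.smul_fst, map_smul, smul_eq_mul, a2, a3, a4, mul_zero]
    rw [a1]; ring

/-- The fibre of the second derived distribution. -/
def secondDerivedSubmodule : Submodule ℝ (E × ℝ × ℝ) where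
  carrier := {v | InSecondDerived η (fun _ => v) z}
  add_mem' := by
    rintro v w ⟨a1, a2⟩ ⟨b1, b2⟩
    refine ⟨?_, ?_⟩ <;> simp only [Prod.fst_add, map_add] <;> simp only [a1, a2, b1, b2] <;> ring
  zero_mem' := by simp [InSecondDerived]
  smul_mem' := by
    rintro c v ⟨a1, a2⟩
    refine ⟨?_, ?_⟩ <;> simp only [Prod.smul_fst, map_smul, smul_eq_mul] <;> simp only [a1, a2] <;>
      ring

/-- The moment covector as a linear map. -/
def momentLinear : E × ℝ × ℝ →ₗ[ℝ] ℝ :=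
  (z.2.1 ^ 2 • (η 4 z.1).toLinearMap - z.2.1 • (η 5 z.1).toLinearMap + (η 6 z.1).toLinearMap) ∘ₗ
    LinearMap.fst ℝ E (ℝ × ℝ)

lemma momentLinear_apply (v : E × ℝ × ℝ) : momentLinear η z v = moment η z v := by
  simp [momentLinear, moment]

end Submodules

variable {X : Type*} [TopologicalSpace X] [ChartedSpace (EuclideanSpace ℝ (Fin 7)) X]
  [IsManifold (𝓡 7) ∞ X] {D : Π x : X, Submodule ℝ (TangentSpace (𝓡 7) x)} {U : Set X}
  {ξ : Fin 4 → Π x : X, TangentSpace (𝓡 7) x} {p : X}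
  {η : Fin 7 → EuclideanSpace ℝ (Fin 7) → EuclideanSpace ℝ (Fin 7) →L[ℝ] ℝ}

lemma weakDerived_mono {E : Type*} [NormedAddCommGroup E] [NormedSpace ℝ E]
    {H : Type*} [TopologicalSpace H]
    {I : ModelWithCorners ℝ E H} {M : Type*} [TopologicalSpace M] [ChartedSpace H M]
    [IsManifold I ∞ M] (Δ : Π x : M, Submodule ℝ (TangentSpace I x)) (Ω : Set M) (r : ℕ) :
    weakDerived I Δ Ω r ≤ weakDerived I Δ Ω (r + 1) := le_sup_left

lemma mlieBracket_mem_weakDerived {E : Type*} [NormedAddCommGroup E] [NormedSpace ℝ E]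
    {H : Type*} [TopologicalSpace H]
    {I : ModelWithCorners ℝ E H} {M : Type*} [TopologicalSpace M] [ChartedSpace H M]
    [IsManifold I ∞ M] {Δ : Π x : M, Submodule ℝ (TangentSpace I x)} {Ω : Set M} {r : ℕ}
    {V W : Π x : M, TangentSpace I x} (hV : V ∈ sectionsOn I Δ Ω) (hW : W ∈ weakDerived I Δ Ω r) :
    mlieBracket I V W ∈ weakDerived I Δ Ω (r + 1) :=
  (le_sup_right : _ ≤ weakDerived I Δ Ω (r + 1)) (Submodule.subset_span ⟨V, hV, W, hW, rfl⟩)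

section

variable (h : IsAdaptedCoframe (frameRep p ξ) η (chartSet (𝓡 7) p U)) (hU : IsOpen U)
  (q₀ : ℝ × ℝ) {Ω : Set (X × (ℝ × ℝ))} (hΩ : IsOpen Ω)
include h hU hΩ

lemma sectionsOn_prolongation {V : Π z : X × (ℝ × ℝ), TangentSpace chartModel z}
    (hV : V ∈ sectionsOn chartModel (prolongation ξ) Ω) :
    ContDiffOn ℝ ∞ (chartField chartModel (p, q₀) V) (chartSet chartModel (p, q₀) (Ω ∩ U ×ˢ univ)) ∧
      ∀ z ∈ chartSet chartModel (p, q₀) (Ω ∩ U ×ˢ univ),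
        InProlongation η (chartField chartModel (p, q₀) V) z := by
  refine ⟨contDiffOn_chartField (hΩ.inter (hU.prod isOpen_univ)) (hV.1.mono inter_subset_left),
    fun z hz => ?_⟩
  have hz' : z ∈ chartSet chartModel (p, q₀) (U ×ˢ univ) := ⟨hz.1, hz.2.2⟩
  rw [chartSet_chartModel] at hz'
  refine h.inProlongation_of_mem_span hz'.1 ((mem_prolongation_iff q₀ hz'.1.1).1 ?_)
  have h2 := hV.2 _ hz.2.1
  rwa [extChartAt_chartModel_symm_apply] at h2

/-- The three pointwise conditions are linear and hold on an open set, so they can be fed into the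
next bracket. Induction over the derived systems then reduces to single brackets of representatives.
-/
lemma weakDerived_prolongation_two_le :
    weakDerived chartModel (prolongation ξ) Ω 2 ≤ fieldsWithValuesIn chartModel (p, q₀)
      (chartSet chartModel (p, q₀) (Ω ∩ U ×ˢ univ)) (secondDerivedSubmodule η) := by
  set S := chartSet chartModel (p, q₀) (Ω ∩ U ×ˢ univ) with hS
  have hSo : IsOpen S := isOpen_chartSet _ (hΩ.inter (hU.prod isOpen_univ))
  have hSt : S ⊆ (extChartAt chartModel (p, q₀)).target := inter_subset_left
  have hz1 : ∀ z ∈ S, z.1 ∈ chartSet (𝓡 7) p U := fun z hz => by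
    have hz' : z ∈ chartSet chartModel (p, q₀) (U ×ˢ univ) := ⟨hz.1, hz.2.2⟩
    rw [chartSet_chartModel] at hz'
    exact hz'.1
  have hdiff : ∀ {Y : EuclideanSpace ℝ (Fin 7) × ℝ × ℝ → EuclideanSpace ℝ (Fin 7) × ℝ × ℝ},
      ContDiffOn ℝ ∞ Y S → ∀ z ∈ S, DifferentiableAt ℝ Y z := fun hY z hz =>
    (hY.contDiffAt (hSo.mem_nhds hz)).differentiableAt (by simp)
  have hbr : ∀ V W : Π z : X × (ℝ × ℝ), TangentSpace chartModel z,
      ContDiffOn ℝ ∞ (chartField chartModel (p, q₀) V) S →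
      ContDiffOn ℝ ∞ (chartField chartModel (p, q₀) W) S → ∀ z ∈ S,
      chartField chartModel (p, q₀) (mlieBracket chartModel V W) z =
        lieBracket ℝ (chartField chartModel (p, q₀) V) (chartField chartModel (p, q₀) W) z :=
    fun V W hV hW z hz => chartField_mlieBracket_of_contDiffOn hSo hSt hV hW hz
  have hsec := fun V hV => sectionsOn_prolongation h hU q₀ hΩ (V := V) hV
  have h0 : weakDerived chartModel (prolongation ξ) Ω 0 ≤
      fieldsWithValuesIn chartModel (p, q₀) S (prolongationSubmodule η) :=
    Submodule.span_le.2 hsec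
  have h1 : weakDerived chartModel (prolongation ξ) Ω 1 ≤
      fieldsWithValuesIn chartModel (p, q₀) S (derivedSubmodule η) := by
    refine sup_le (fun V hV => ⟨(h0 hV).1, fun z hz =>
      InProlongation.inDerived ((h0 hV).2 z hz)⟩)
      (Submodule.span_le.2 ?_)
    rintro _ ⟨V, hV, W, hW, rfl⟩
    obtain ⟨sV, eV⟩ := hsec V hV
    obtain ⟨sW, eW⟩ := h0 hW
    refine ⟨(contDiffOn_lieBracket hSo sV sW).congr (hbr V W sV sW), fun z hz => ?_⟩
    rw [hbr V W sV sW z hz]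
    exact h.inDerived_lieBracket (hz1 z hz) (hdiff sV z hz) (hdiff sW z hz)
      (Filter.eventually_of_mem (hSo.mem_nhds hz) eV) (Filter.eventually_of_mem (hSo.mem_nhds hz) eW)
  refine sup_le (fun V hV => ⟨(h1 hV).1, fun z hz =>
    InDerived.inSecondDerived ((h1 hV).2 z hz)⟩) (Submodule.span_le.2 ?_)
  rintro _ ⟨V, hV, W, hW, rfl⟩
  obtain ⟨sV, eV⟩ := hsec V hV
  obtain ⟨sW, eW⟩ := h1 hW
  refine ⟨(contDiffOn_lieBracket hSo sV sW).congr (hbr V W sV sW), fun z hz => ?_⟩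
  rw [hbr V W sV sW z hz]
  exact h.inSecondDerived_lieBracket (hz1 z hz) (hdiff sV z hz) (hdiff sW z hz)
    (Filter.eventually_of_mem (hSo.mem_nhds hz) eV) (Filter.eventually_of_mem (hSo.mem_nhds hz) eW)

/-- Only the point `z` has to be a zero of the obstruction, because `moment_lieBracket` evaluates at
one point. Its hypothesis on the inner field holds throughout a neighbourhood by the preceding
bound. -/
lemma moment_weakDerived_three {V : Π z : X × (ℝ × ℝ), TangentSpace chartModel z}
    (hV : V ∈ weakDerived chartModel (prolongation ξ) Ω 3)
    {z : EuclideanSpace ℝ (Fin 7) × ℝ × ℝ}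
    (hz : z ∈ chartSet chartModel (p, q₀) (Ω ∩ U ×ˢ univ))
    (hF : obstruction (frameRep p ξ) η z.2.1 z.2.2 z.1 = 0) :
    moment η z (chartField chartModel (p, q₀) V z) = 0 := by
  set S := chartSet chartModel (p, q₀) (Ω ∩ U ×ˢ univ) with hS
  have hSo : IsOpen S := isOpen_chartSet _ (hΩ.inter (hU.prod isOpen_univ))
  have hSt : S ⊆ (extChartAt chartModel (p, q₀)).target := inter_subset_left
  have hz1 : z.1 ∈ chartSet (𝓡 7) p U := by
    have hz' : z ∈ chartSet chartModel (p, q₀) (U ×ˢ univ) := ⟨hz.1, hz.2.2⟩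
    rw [chartSet_chartModel] at hz'
    exact hz'.1
  have hdiff : ∀ {Y : EuclideanSpace ℝ (Fin 7) × ℝ × ℝ → EuclideanSpace ℝ (Fin 7) × ℝ × ℝ},
      ContDiffOn ℝ ∞ Y S → DifferentiableAt ℝ Y z := fun hY =>
    (hY.contDiffAt (hSo.mem_nhds hz)).differentiableAt (by simp)
  have h2 := weakDerived_prolongation_two_le h hU q₀ hΩ
  let f : (Π z : X × (ℝ × ℝ), TangentSpace chartModel z) →ₗ[ℝ] ℝ :=
    momentLinear η z ∘ₗ chartFieldLinear chartModel (p, q₀) z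
  have hf : ∀ V, f V = moment η z (chartField chartModel (p, q₀) V z) := fun V =>
    momentLinear_apply η z _
  -- The moment at `z` is linear in the field, so it is enough to check the generators of the
  -- derived system.
  suffices hle : weakDerived chartModel (prolongation ξ) Ω 3 ≤ LinearMap.ker f from
    (hf V).symm.trans (hle hV)
  refine sup_le (fun V hV => ?_) (Submodule.span_le.2 ?_)
  · rw [LinearMap.mem_ker, hf]
    exact InSecondDerived.moment_eq_zero ((h2 hV).2 z hz)
  rintro _ ⟨V, hV, W, hW, rfl⟩
  obtain ⟨sV, eV⟩ := sectionsOn_prolongation h hU q₀ hΩ hV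
  obtain ⟨sW, eW⟩ := h2 hW
  rw [SetLike.mem_coe, LinearMap.mem_ker, hf, chartField_mlieBracket_of_contDiffOn hSo hSt sV sW hz]
  exact h.moment_lieBracket hz1 (hdiff sV) (hdiff sW)
    (Filter.eventually_of_mem (hSo.mem_nhds hz) eV) hF
    (Filter.eventually_of_mem (hSo.mem_nhds hz) eW)

end

end GrowthBounds

/-! ### The fourth rank of the growth vector and the obstruction. -/

section GrowthDichotomy

open VectorField

lemma chartField_mlieBracket_eqOn {E : Type*} [NormedAddCommGroup E] [NormedSpace ℝ E]
    [CompleteSpace E] {H : Type*} [TopologicalSpace H]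
    {I : ModelWithCorners ℝ E H} {M : Type*} [TopologicalSpace M] [ChartedSpace H M]
    [IsManifold I ∞ M] [I.Boundaryless] {p : M}
    {V V' : Π x : M, TangentSpace I x} {W W' : E → E} {S : Set E} (hS : IsOpen S)
    (hSt : S ⊆ (extChartAt I p).target) (hW : ContDiffOn ℝ ∞ W S) (hW' : ContDiffOn ℝ ∞ W' S)
    (hV : EqOn (chartField I p V) W S) (hV' : EqOn (chartField I p V') W' S) :
    EqOn (chartField I p (mlieBracket I V V')) (lieBracket ℝ W W') S := by
  intro y hy
  refine (chartField_mlieBracket_of_contDiffOn hS hSt (hW.congr hV) (hW'.congr hV') hy).trans ?_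
  exact EventuallyEq.lieBracket_vectorField_eq (hV.eventuallyEq_of_mem (hS.mem_nhds hy))
    (hV'.eventuallyEq_of_mem (hS.mem_nhds hy))

variable {X : Type*} [TopologicalSpace X] [ChartedSpace (EuclideanSpace ℝ (Fin 7)) X]
  [IsManifold (𝓡 7) ∞ X] {D : Π x : X, Submodule ℝ (TangentSpace (𝓡 7) x)} {U : Set X}
  {ξ : Fin 4 → Π x : X, TangentSpace (𝓡 7) x} {p : X}
  {η : Fin 7 → EuclideanSpace ℝ (Fin 7) → EuclideanSpace ℝ (Fin 7) →L[ℝ] ℝ}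

omit [IsManifold (𝓡 7) ∞ X] in
lemma finrank_tangentSpace_chartModel (z : X × (ℝ × ℝ)) :
    Module.finrank ℝ (TangentSpace chartModel z) = 9 := by
  have : Module.finrank ℝ (EuclideanSpace ℝ (Fin 7) × (ℝ × ℝ)) = 9 := by
    simp [Module.finrank_prod]
  exact this

instance finiteDimensional_tangentSpace_chartModel (z : X × (ℝ × ℝ)) :
    FiniteDimensional ℝ (TangentSpace chartModel z) :=
  inferInstanceAs (FiniteDimensional ℝ (EuclideanSpace ℝ (Fin 7) × (ℝ × ℝ)))

variable (h : IsAdaptedCoframe (frameRep p ξ) η (chartSet (𝓡 7) p U)) (hU : IsOpen U)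
  (q₀ : ℝ × ℝ) {z : EuclideanSpace ℝ (Fin 7) × ℝ × ℝ}
  (hz : z ∈ chartSet chartModel (p, q₀) (U ×ˢ univ))
include h hU hz

/-- If the fibre were everything, the moment covector would vanish; but it takes the value 1 on e6.
-/
lemma finrank_derivedFiber_ne_nine (hF : obstruction (frameRep p ξ) η z.2.1 z.2.2 z.1 = 0) :
    Module.finrank ℝ (derivedFiber chartModel (prolongation ξ) 3
      ((extChartAt chartModel (p, q₀)).symm z)) ≠ 9 := by
  intro h9
  have htop := Submodule.eq_top_of_finrank_eq (h9.trans (finrank_tangentSpace_chartModel _).symm)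
  have hz1 : z.1 ∈ chartSet (𝓡 7) p U := by
    rw [chartSet_chartModel] at hz
    exact hz.1
  have hinv := mfderiv_extChartAt_isInvertible (I := chartModel)
    ((extChartAt chartModel (p, q₀)).map_target hz.1)
  let f := momentLinear η z ∘ₗ (mfderiv chartModel 𝓘(ℝ, EuclideanSpace ℝ (Fin 7) × ℝ × ℝ)
    (extChartAt chartModel (p, q₀)) ((extChartAt chartModel (p, q₀)).symm z)).toLinearMap
  have hle : derivedFiber chartModel (prolongation ξ) 3
      ((extChartAt chartModel (p, q₀)).symm z) ≤ LinearMap.ker f := by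
    refine Submodule.span_le.2 ?_
    rintro _ ⟨Ω, hΩ, hzΩ, V, hV, rfl⟩
    exact (momentLinear_apply η z _).trans
      (moment_weakDerived_three h hU q₀ hΩ hV ⟨hz.1, hzΩ, hz.2⟩ hF)
  obtain ⟨w, hw⟩ := hinv.surjective (frameRep p ξ 6 z.1, 0, 0)
  have h0 : f w = 0 := hle (by rw [htop]; trivial)
  have h1 : f w = 1 := by
    refine (congrArg (momentLinear η z) hw).trans ?_
    rw [momentLinear_apply, moment, h.dual _ hz1, h.dual _ hz1, h.dual _ hz1]
    rw [if_neg (by decide), if_neg (by decide), if_pos rfl]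
    ring
  rw [h1] at h0
  exact one_ne_zero h0

/-- The coordinate fields and ζ, pushed to the manifold, are sections of the prolongation. By
`eq_zero_of_iterated_brackets` no nonzero covector kills their brackets of length at most four. -/
lemma finrank_derivedFiber_eq_nine (hF : obstruction (frameRep p ξ) η z.2.1 z.2.2 z.1 ≠ 0) :
    Module.finrank ℝ (derivedFiber chartModel (prolongation ξ) 3
      ((extChartAt chartModel (p, q₀)).symm z)) = 9 := by
  set S := chartSet chartModel (p, q₀) (U ×ˢ univ) with hS
  have hSprod : S = chartSet (𝓡 7) p U ×ˢ univ := chartSet_chartModel p q₀ U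
  have hSo : IsOpen S := isOpen_chartSet _ (hU.prod isOpen_univ)
  have hSt : S ⊆ (extChartAt chartModel (p, q₀)).target := inter_subset_left
  have hz1 : ∀ z ∈ S, z.1 ∈ chartSet (𝓡 7) p U := fun z hz => by
    rw [hSprod] at hz
    exact hz.1
  -- Pushed fields are controlled only on the chart domain over `U`, so the derived system is taken
  -- over this open set. The definition of the fibre allows any neighbourhood.
  set Ω := (extChartAt chartModel (p, q₀)).source ∩ extChartAt chartModel (p, q₀) ⁻¹' S with hΩd
  have hΩ : IsOpen Ω := isOpen_source_inter_preimage hSo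
  have hzΩ : (extChartAt chartModel (p, q₀)).symm z ∈ Ω := by
    refine ⟨(extChartAt chartModel (p, q₀)).map_target hz.1, ?_⟩
    rw [mem_preimage, (extChartAt chartModel (p, q₀)).right_inv hz.1]
    exact hz
  have hpush : ∀ W, EqOn (chartField chartModel (p, q₀) (pushField chartModel (p, q₀) W)) W S :=
    fun W y hy => chartField_pushField (hSt hy)
  have hsec : ∀ W : EuclideanSpace ℝ (Fin 7) × ℝ × ℝ → EuclideanSpace ℝ (Fin 7) × ℝ × ℝ,
      ContDiffOn ℝ ∞ W S → (∀ z, (W z).1 ∈ Submodule.span ℝ {(coneField (frameRep p ξ) z).1}) →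
      pushField chartModel (p, q₀) W ∈ sectionsOn chartModel (prolongation ξ) Ω := by
    intro W hW hWs
    refine ⟨smoothFieldOn_pushField hΩ inter_subset_left (by rwa [chartSet_preimage hSt]),
      fun x hx => ?_⟩
    obtain ⟨y, hy, rfl⟩ : ∃ y ∈ S, (extChartAt chartModel (p, q₀)).symm y = x :=
      ⟨_, hx.2, (extChartAt chartModel (p, q₀)).left_inv hx.1⟩
    rw [extChartAt_chartModel_symm_apply]
    refine (mem_prolongation_iff q₀ (hz1 y hy).1).2 ?_
    rw [hpush W hy]
    exact hWs y
  have sc : ContDiffOn ℝ ∞ (coneField (frameRep p ξ)) S := hSprod ▸ h.contDiffOn_coneField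
  have st : ContDiffOn ℝ ∞ (thetaField (E := EuclideanSpace ℝ (Fin 7))) S := contDiffOn_const
  have sp : ContDiffOn ℝ ∞ (phiField (E := EuclideanSpace ℝ (Fin 7))) S := contDiffOn_const
  have mt := hsec _ st fun z => Submodule.zero_mem _
  have mp := hsec _ sp fun z => Submodule.zero_mem _
  have mc := hsec _ sc fun z => Submodule.mem_span_singleton_self _
  have span0 : ∀ V ∈ sectionsOn chartModel (prolongation ξ) Ω,
      V ∈ weakDerived chartModel (prolongation ξ) Ω 0 := fun V hV => Submodule.subset_span hV
  have up := fun r => weakDerived_mono (I := chartModel) (prolongation ξ) Ω r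
  have e1 := chartField_mlieBracket_eqOn hSo hSt st sc (hpush _) (hpush _)
  have e2 := chartField_mlieBracket_eqOn hSo hSt sp sc (hpush _) (hpush _)
  have s2 := contDiffOn_lieBracket hSo sp sc
  have e3 := chartField_mlieBracket_eqOn hSo hSt st s2 (hpush _) e2
  have e4 := chartField_mlieBracket_eqOn hSo hSt sc s2 (hpush _) e2
  have s4 := contDiffOn_lieBracket hSo sc s2
  have e5 := chartField_mlieBracket_eqOn hSo hSt st s4 (hpush _) e4
  have e6 := chartField_mlieBracket_eqOn hSo hSt sc s4 (hpush _) e4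
  have m1 := mlieBracket_mem_weakDerived mt (span0 _ mc)
  have m2 := mlieBracket_mem_weakDerived mp (span0 _ mc)
  have m3 := mlieBracket_mem_weakDerived mt m2
  have m4 := mlieBracket_mem_weakDerived mc m2
  have m5 := mlieBracket_mem_weakDerived mt m4
  have m6 := mlieBracket_mem_weakDerived mc m4
  let L : TangentSpace chartModel ((extChartAt chartModel (p, q₀)).symm z) →ₗ[ℝ]
      EuclideanSpace ℝ (Fin 7) × ℝ × ℝ := (mfderiv chartModel 𝓘(ℝ, EuclideanSpace ℝ (Fin 7) × ℝ × ℝ)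
    (extChartAt chartModel (p, q₀)) ((extChartAt chartModel (p, q₀)).symm z)).toLinearMap
  have hK : (derivedFiber chartModel (prolongation ξ) 3
      ((extChartAt chartModel (p, q₀)).symm z)).map L = ⊤ := by
    -- A proper image would be contained in the kernel of a nonzero covector.
    by_contra hne
    obtain ⟨f, hf0, hf⟩ := Submodule.exists_le_ker_of_lt_top _ (lt_top_iff_ne_top.2 hne)
    have hβ : ∀ (V : Π z : X × (ℝ × ℝ), TangentSpace chartModel z),
        V ∈ weakDerived chartModel (prolongation ξ) Ω 3 → ∀ w,
        chartField chartModel (p, q₀) V z = w → LinearMap.toContinuousLinearMap f w = 0 := by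
      rintro V hV _ rfl
      exact hf (Submodule.mem_map_of_mem (Submodule.subset_span ⟨Ω, hΩ, hzΩ, V, hV, rfl⟩))
    have hβ0 := h.eq_zero_of_iterated_brackets (hz1 z hz) hF (LinearMap.toContinuousLinearMap f)
      (hβ _ (up 2 (up 1 (up 0 (span0 _ mt)))) _ (hpush _ hz))
      (hβ _ (up 2 (up 1 (up 0 (span0 _ mp)))) _ (hpush _ hz))
      (hβ _ (up 2 (up 1 (up 0 (span0 _ mc)))) _ (hpush _ hz))
      (hβ _ (up 2 (up 1 m1)) _ (e1 hz)) (hβ _ (up 2 (up 1 m2)) _ (e2 hz))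
      (hβ _ (up 2 m3) _ (e3 hz)) (hβ _ (up 2 m4) _ (e4 hz)) (hβ _ m5 _ (e5 hz))
      (hβ _ m6 _ (e6 hz))
    exact hf0 ((LinearMap.toContinuousLinearMap (𝕜 := ℝ)).map_eq_zero_iff.1 hβ0)
  refine le_antisymm ((Submodule.finrank_le _).trans (finrank_tangentSpace_chartModel _).le) ?_
  have h1 := Submodule.finrank_map_le L (derivedFiber chartModel (prolongation ξ) 3
      ((extChartAt chartModel (p, q₀)).symm z))
  rw [hK, finrank_top] at h1
  exact (by simp [Module.finrank_prod] : (9 : ℕ) = Module.finrank ℝ _).trans_le h1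

end GrowthDichotomy

/-! ### Translation of the two types into conditions on the obstruction. -/

section Types

variable {X : Type*} [TopologicalSpace X] [ChartedSpace (EuclideanSpace ℝ (Fin 7)) X]
  [IsManifold (𝓡 7) ∞ X] {D : Π x : X, Submodule ℝ (TangentSpace (𝓡 7) x)}
  {x₀ : X} {u₀ : TangentSpace (𝓡 7) x₀}

/-- The chart records only the direction. The factor κ is kept throughout because the curves must
have velocity `u₀` itself. -/
lemma IsChartPoint.exists_smul {ξ : Fin 4 → Π x : X, TangentSpace (𝓡 7) x} {q : ℝ × ℝ}
    (hc : IsChartPoint D x₀ u₀ ξ q) (hne : u₀ ≠ 0) :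
    ∃ κ : ℝ, κ ≠ 0 ∧ u₀ = κ • chartVector ξ (x₀, q) := by
  have h1 : u₀ ∈ Submodule.span ℝ {chartVector ξ (x₀, q)} :=
    hc.2 ▸ Submodule.mem_span_singleton_self u₀
  obtain ⟨κ, hκ⟩ := Submodule.mem_span_singleton.1 h1
  refine ⟨κ, ?_, hκ.symm⟩
  rintro rfl
  exact hne (hκ.symm.trans (zero_smul _ _))

/-- A direction of `C₃`-type, in the chart. -/
lemma IsC3Type.exists_chart (hu : IsC3Type D x₀ u₀) (hne : u₀ ≠ 0) :
    ∃ (U : Set X) (ξ : Fin 4 → Π x : X, TangentSpace (𝓡 7) x) (q : ℝ × ℝ) (κ : ℝ)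
      (η : Fin 7 → EuclideanSpace ℝ (Fin 7) → EuclideanSpace ℝ (Fin 7) →L[ℝ] ℝ),
      IsOpen U ∧ x₀ ∈ U ∧ IsAdaptedFrameOn D U ξ ∧ κ ≠ 0 ∧ u₀ = κ • chartVector ξ (x₀, q) ∧
      IsAdaptedCoframe (frameRep x₀ ξ) η (chartSet (𝓡 7) x₀ U) ∧
      ∀ᶠ z in 𝓝 ((extChartAt (𝓡 7) x₀ x₀, q) : EuclideanSpace ℝ (Fin 7) × (ℝ × ℝ)),
        obstruction (frameRep x₀ ξ) η z.2.1 z.2.2 z.1 = 0 := by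
  obtain ⟨ξ, q, hc, hg⟩ := hu
  obtain ⟨κ, hκ, hκu⟩ := hc.exists_smul hne
  obtain ⟨⟨U, hU, hxU, hξ⟩, -⟩ := hc
  obtain ⟨η, hη⟩ := exists_adaptedCoframe hU hξ x₀
  refine ⟨U, ξ, q, κ, η, hU, hxU, hξ, hκ, hκu, hη, ?_⟩
  have hx : x₀ ∈ (extChartAt (𝓡 7) x₀).source := mem_extChartAt_source x₀
  have hsymm : (extChartAt chartModel (x₀, q)).symm (extChartAt (𝓡 7) x₀ x₀, q) = (x₀, q) := by
    rw [extChartAt_chartModel_symm_apply, (extChartAt (𝓡 7) x₀).left_inv hx]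
  have hS : (extChartAt (𝓡 7) x₀ x₀, q) ∈ chartSet chartModel (x₀, q) (U ×ˢ univ) := by
    rw [chartSet_chartModel]
    refine ⟨⟨(extChartAt (𝓡 7) x₀).map_source hx, ?_⟩, trivial⟩
    rw [mem_preimage, (extChartAt (𝓡 7) x₀).left_inv hx]
    exact hxU
  have hcont : ContinuousAt (extChartAt chartModel (x₀, q)).symm (extChartAt (𝓡 7) x₀ x₀, q) :=
    (contMDiffAt_symm hS.1).continuousAt
  have hev := hcont.eventually (p := fun z =>
    HasSmallGrowth chartModel (prolongation ξ) z [3, 5, 7, 8, 9]) (by rw [hsymm]; exact hg)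
  filter_upwards [hev, (isOpen_chartSet (I := chartModel) (x₀, q)
    (hU.prod isOpen_univ)).mem_nhds hS] with z hzg hz
  by_contra hne'
  -- Counting from zero, entry 3 is the rank of the fourth term. It equals 8 here, which excludes
  -- the value 9 forced by a nonzero obstruction.
  have h8 := hzg ⟨3, by simp⟩
  have h9 := finrank_derivedFiber_eq_nine hη hU q hz hne'
  rw [h9] at h8
  simp at h8

/-- A direction of regular type, in the chart. -/
lemma IsRegularType.exists_chart (hu : IsRegularType D x₀ u₀) (hne : u₀ ≠ 0) :
    ∃ (U : Set X) (ξ : Fin 4 → Π x : X, TangentSpace (𝓡 7) x) (q : ℝ × ℝ) (κ : ℝ)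
      (η : Fin 7 → EuclideanSpace ℝ (Fin 7) → EuclideanSpace ℝ (Fin 7) →L[ℝ] ℝ),
      IsOpen U ∧ x₀ ∈ U ∧ IsAdaptedFrameOn D U ξ ∧ κ ≠ 0 ∧ u₀ = κ • chartVector ξ (x₀, q) ∧
      IsAdaptedCoframe (frameRep x₀ ξ) η (chartSet (𝓡 7) x₀ U) ∧
      obstruction (frameRep x₀ ξ) η q.1 q.2 (extChartAt (𝓡 7) x₀ x₀) ≠ 0 := by
  obtain ⟨ξ, q, hc, hg⟩ := hu
  obtain ⟨κ, hκ, hκu⟩ := hc.exists_smul hne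
  obtain ⟨⟨U, hU, hxU, hξ⟩, -⟩ := hc
  obtain ⟨η, hη⟩ := exists_adaptedCoframe hU hξ x₀
  refine ⟨U, ξ, q, κ, η, hU, hxU, hξ, hκ, hκu, hη, fun hF => ?_⟩
  have hx : x₀ ∈ (extChartAt (𝓡 7) x₀).source := mem_extChartAt_source x₀
  have hsymm : (extChartAt chartModel (x₀, q)).symm (extChartAt (𝓡 7) x₀ x₀, q) = (x₀, q) := by
    rw [extChartAt_chartModel_symm_apply, (extChartAt (𝓡 7) x₀).left_inv hx]
  have hS : (extChartAt (𝓡 7) x₀ x₀, q) ∈ chartSet chartModel (x₀, q) (U ×ˢ univ) := by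
    rw [chartSet_chartModel]
    refine ⟨⟨(extChartAt (𝓡 7) x₀).map_source hx, ?_⟩, trivial⟩
    rw [mem_preimage, (extChartAt (𝓡 7) x₀).left_inv hx]
    exact hxU
  have h9 := hg ⟨3, by simp⟩
  have h9' := finrank_derivedFiber_ne_nine hη hU q hS hF
  rw [hsymm] at h9'
  exact h9' h9

end Types

/-! ### Quantitative estimates for controlled trajectories. -/

section Tube

open Metric NNReal

variable {E : Type*} [NormedAddCommGroup E] [NormedSpace ℝ E]

/-- A Picard–Lindelöf solution stays in the closed ball. -/
lemma exists_solution_mem_closedBall [CompleteSpace E] {f : ℝ → E → E} {tmin tmax : ℝ}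
    {t₀ : Icc tmin tmax} {x₀ x : E} {a r L K : ℝ≥0} (hf : IsPicardLindelof f t₀ x₀ a r L K)
    (hx : x ∈ closedBall x₀ r) :
    ∃ α : ℝ → E, α t₀ = x ∧ ∀ t ∈ Icc tmin tmax, α t ∈ closedBall x₀ a ∧
      HasDerivWithinAt α (f t (α t)) (Icc tmin tmax) t := by
  -- The fixed point is used directly, since its function space carries the bound that keeps the
  -- solution in the ball.
  obtain ⟨α, hα⟩ := ODE.FunSpace.exists_isFixedPt_next hf hx
  rw [ODE.FunSpace.isFixedPt_next_iff] at hα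
  have heq : ∀ t ∈ Icc tmin tmax, α.compProj t = ODE.picard f t₀ x α.compProj t := fun t ht => by
    rw [ODE.FunSpace.compProj_of_mem ht]
    exact hα ⟨t, ht⟩
  refine ⟨α.compProj, ?_, fun t ht => ⟨α.compProj_mem_closedBall hf.mul_max_le, ?_⟩⟩
  · rw [heq _ t₀.2, ODE.picard_apply₀]
  · refine (ODE.hasDerivWithinAt_picard_Icc t₀.2 hf.continuousOn_uncurry
      α.continuous_compProj.continuousOn
      (fun t _ => α.compProj_mem_closedBall hf.mul_max_le) x ht).congr heq (heq t ht)

/-- Uniform first and second order bounds for a smooth map near a compact set. -/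
lemma exists_uniform_taylor_bound {F : Type*} [NormedAddCommGroup F] [NormedSpace ℝ F] {f : E → F}
    {W K : Set E} (hW : IsOpen W) (hf : ContDiffOn ℝ ∞ f W) (hK : IsCompact K) (hKW : K ⊆ W) :
    ∃ δ > 0, ∃ C > 0, ∀ x ∈ K, ∀ x', ‖x' - x‖ < δ → x' ∈ W ∧ ‖f x'‖ ≤ C ∧
      ‖f x' - f x‖ ≤ C * ‖x' - x‖ ∧
      ‖f x' - f x - fderiv ℝ f x (x' - x)‖ ≤ C * ‖x' - x‖ ^ 2 := by
  let P : Set E → Prop := fun s => ∃ δ > 0, ∃ C > 0, ∀ x ∈ s, ∀ x', ‖x' - x‖ < δ → x' ∈ W ∧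
      ‖f x'‖ ≤ C ∧ ‖f x' - f x‖ ≤ C * ‖x' - x‖ ∧
      ‖f x' - f x - fderiv ℝ f x (x' - x)‖ ≤ C * ‖x' - x‖ ^ 2
  refine hK.induction_on (p := P) ⟨1, one_pos, 1, one_pos, by simp⟩ ?_ ?_ ?_
  · rintro s t hst ⟨δ, hδ, C, hC, h⟩
    exact ⟨δ, hδ, C, hC, fun x hx => h x (hst hx)⟩
  · rintro s t ⟨δ₁, hδ₁, C₁, hC₁, h₁⟩ ⟨δ₂, hδ₂, C₂, hC₂, h₂⟩
    refine ⟨min δ₁ δ₂, lt_min hδ₁ hδ₂, max C₁ C₂, lt_max_of_lt_left hC₁, ?_⟩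
    rintro x (hx | hx) x' hx'
    · obtain ⟨a, b, c, d⟩ := h₁ x hx x' (hx'.trans_le (min_le_left _ _))
      refine ⟨a, b.trans (le_max_left _ _), c.trans ?_, d.trans ?_⟩ <;> gcongr <;>
        exact le_max_left _ _
    · obtain ⟨a, b, c, d⟩ := h₂ x hx x' (hx'.trans_le (min_le_right _ _))
      refine ⟨a, b.trans (le_max_right _ _), c.trans ?_, d.trans ?_⟩ <;> gcongr <;>
        exact le_max_right _ _
  · intro x₀ hx₀
    have hf' : ContDiffOn ℝ ∞ (fderiv ℝ f) W := hf.fderiv_of_isOpen hW (by simp)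
    obtain ⟨L, s, hs, hL⟩ := ((hf'.contDiffAt (hW.mem_nhds (hKW hx₀))).of_le
      (by simp : (1 : ℕ∞ω) ≤ ∞)).exists_lipschitzOnWith
    have hb1 : ∀ᶠ x in 𝓝 x₀, ‖f x‖ < ‖f x₀‖ + 1 :=
      ((hf.contDiffAt (hW.mem_nhds (hKW hx₀))).continuousAt.norm).eventually
        (gt_mem_nhds (lt_add_one _))
    have hb2 : ∀ᶠ x in 𝓝 x₀, ‖fderiv ℝ f x‖ < ‖fderiv ℝ f x₀‖ + 1 :=
      ((hf'.contDiffAt (hW.mem_nhds (hKW hx₀))).continuousAt.norm).eventually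
        (gt_mem_nhds (lt_add_one _))
    obtain ⟨r, hr, hball⟩ := Metric.mem_nhds_iff.1
      (inter_mem (inter_mem hs (hW.mem_nhds (hKW hx₀))) (inter_mem hb1 hb2))
    -- Halving the radius keeps both `x` and any `x'` within `r / 2` of it inside `ball x₀ r`.
    refine ⟨ball x₀ (r / 2), mem_nhdsWithin_of_mem_nhds (ball_mem_nhds _ (by positivity)), r / 2,
      by positivity, max (max (‖f x₀‖ + 1) (‖fderiv ℝ f x₀‖ + 1)) L,
      lt_max_of_lt_left (lt_max_of_lt_left (by positivity)), ?_⟩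
    intro x hx x' hxx'
    have hxr : x ∈ ball x₀ r := ball_subset_ball (by linarith) hx
    have hxr' : x' ∈ ball x₀ r := by
      rw [mem_ball, dist_eq_norm] at hx ⊢
      calc ‖x' - x₀‖ ≤ ‖x' - x‖ + ‖x - x₀‖ := norm_sub_le_norm_sub_add_norm_sub _ _ _
        _ < r := by linarith
    have hd : ∀ w ∈ ball x₀ r, HasFDerivAt f (fderiv ℝ f w) w := fun w hw =>
      ((hf.contDiffAt (hW.mem_nhds (hball hw).1.2)).differentiableAt (by simp)).hasFDerivAt
    refine ⟨(hball hxr').1.2, ?_, ?_, ?_⟩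
    · exact (hball hxr').2.1.le.trans (le_max_of_le_left (le_max_left _ _))
    · have h1 := (convex_ball x₀ r).norm_image_sub_le_of_norm_hasFDerivWithin_le
        (fun w hw => (hd w hw).hasFDerivWithinAt) (fun w hw => (hball hw).2.2.le) hxr hxr'
      refine h1.trans ?_
      gcongr
      exact le_max_of_le_left (le_max_right _ _)
    · have hseg : segment ℝ x x' ⊆ ball x₀ r := (convex_ball x₀ r).segment_subset hxr hxr'
      -- Mean value inequality for f minus its linearisation at `x`: on the segment the derivative
      -- of f varies by at most `L * ‖x' - x‖`, which yields the quadratic remainder.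
      have h1 := (convex_segment (𝕜 := ℝ) x x').norm_image_sub_le_of_norm_hasFDerivWithin_le'
        (φ := fderiv ℝ f x) (C := L * ‖x' - x‖)
        (fun w hw => (hd w (hseg hw)).hasFDerivWithinAt) (fun w hw => ?_)
        (left_mem_segment ℝ x x') (right_mem_segment ℝ x x')
      · refine h1.trans ?_
        rw [pow_two, ← mul_assoc]
        gcongr
        exact le_max_right _ _
      · refine (hL.norm_sub_le (hball (hseg hw)).1.1 (hball hxr).1.1).trans ?_
        gcongr
        have := norm_sub_le_of_mem_segment hw
        simpa using this

/-- Bounds for time dependent fields `G`, `H` in a tube of radius `δ` around the curve `y₀`. -/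
structure TubeBound (G H : ℝ → E → E) (A : ℝ → E →L[ℝ] E) (y₀ : ℝ → E) (a b δ C : ℝ) : Prop where
  radius_pos : 0 < δ
  const_pos : 0 < C
  lipschitz : ∀ t ∈ Icc a b, ∀ x, ‖x - y₀ t‖ < δ → ‖G t x - G t (y₀ t)‖ ≤ C * ‖x - y₀ t‖
  taylor : ∀ t ∈ Icc a b, ∀ x, ‖x - y₀ t‖ < δ →
    ‖G t x - G t (y₀ t) - A t (x - y₀ t)‖ ≤ C * ‖x - y₀ t‖ ^ 2
  bound : ∀ t ∈ Icc a b, ∀ x, ‖x - y₀ t‖ < δ → ‖H t x‖ ≤ C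
  lipschitz' : ∀ t ∈ Icc a b, ∀ x, ‖x - y₀ t‖ < δ → ‖H t x - H t (y₀ t)‖ ≤ C * ‖x - y₀ t‖

/-- The field with control `u`. -/
def controlled {m : ℕ} (f : Fin m → E → E) (u : Fin m → ℝ → ℝ) (t : ℝ) (x : E) : E :=
  ∑ j, u j t • f j x

/-- The trajectory is compact, so the uniform Taylor bounds of the finitely many fields hold in a
common tube around it. Bounded controls then transfer them to the control-weighted sums. -/
lemma exists_tubeBound {m : ℕ} {f : Fin m → E → E} {W : Set E} (hW : IsOpen W)
    (hf : ∀ j, ContDiffOn ℝ ∞ (f j) W) {u v : Fin m → ℝ → ℝ} {a b : ℝ}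
    (hu : ∀ j, ContinuousOn (u j) (Icc a b)) (hv : ∀ j, ContinuousOn (v j) (Icc a b))
    {y₀ : ℝ → E} (hy : ContinuousOn y₀ (Icc a b)) (hyW : ∀ t ∈ Icc a b, y₀ t ∈ W) :
    ∃ δ C, (∀ t ∈ Icc a b, ∀ x, ‖x - y₀ t‖ < δ → x ∈ W) ∧
      TubeBound (controlled f u) (controlled f v)
        (fun t => ∑ j, u j t • fderiv ℝ (f j) (y₀ t)) y₀ a b δ C := by
  have hK : IsCompact (y₀ '' Icc a b) := isCompact_Icc.image_of_continuousOn hy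
  have hKW : y₀ '' Icc a b ⊆ W := by
    rintro _ ⟨t, ht, rfl⟩
    exact hyW t ht
  have hmk : ∀ t ∈ Icc a b, y₀ t ∈ y₀ '' Icc a b := fun t ht => mem_image_of_mem _ ht
  choose δ hδ C hC hb using fun j => exists_uniform_taylor_bound hW (hf j) hK hKW
  -- The zero function contributes a radius whose tube lies in `W` even when there are no fields at
  -- all; the index type `Option (Fin m)` below accounts for it.
  obtain ⟨δ₀, hδ₀, C₀, hC₀, hb₀⟩ :=
    exists_uniform_taylor_bound hW (contDiffOn_const (c := (0 : ℝ))) hK hKW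
  have hbd : ∀ w : Fin m → ℝ → ℝ, (∀ j, ContinuousOn (w j) (Icc a b)) →
      ∃ M : ℝ, 0 ≤ M ∧ ∀ t ∈ Icc a b, ∀ j, ‖w j t‖ ≤ M := by
    intro w hw
    choose B hB using fun j => isCompact_Icc.exists_bound_of_continuousOn (hw j)
    refine ⟨∑ j, |B j|, Finset.sum_nonneg fun j _ => abs_nonneg _, fun t ht j => ?_⟩
    exact ((hB j t ht).trans (le_abs_self _)).trans
      (Finset.single_le_sum (f := fun j => |B j|) (fun j _ => abs_nonneg _) (Finset.mem_univ j))
  obtain ⟨Mu, hMu, hu'⟩ := hbd u hu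
  obtain ⟨Mv, hMv, hv'⟩ := hbd v hv
  obtain ⟨d, hd, hdδ⟩ : ∃ d > 0, d ≤ δ₀ ∧ ∀ j, d ≤ δ j := by
    have hpos : ∀ o : Option (Fin m), 0 < o.elim δ₀ δ := by rintro (_ | j); exacts [hδ₀, hδ j]
    refine ⟨Finset.univ.inf' Finset.univ_nonempty fun o : Option (Fin m) => o.elim δ₀ δ,
      (Finset.lt_inf'_iff _).2 fun o _ => hpos o, ?_, fun j => ?_⟩
    · exact Finset.inf'_le (fun o : Option (Fin m) => o.elim δ₀ δ) (Finset.mem_univ none)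
    · exact Finset.inf'_le (fun o : Option (Fin m) => o.elim δ₀ δ) (Finset.mem_univ (some j))
  have hS : 0 ≤ ∑ j, C j := Finset.sum_nonneg fun j _ => (hC j).le
  have est : ∀ (w : Fin m → ℝ) (M R : ℝ) (g : Fin m → E), 0 ≤ M → 0 ≤ R → (∀ j, ‖w j‖ ≤ M) →
      M ≤ Mu + Mv + 1 →
      (∀ j, ‖g j‖ ≤ C j * R) → ‖∑ j, w j • g j‖ ≤ (Mu + Mv + 1) * (∑ j, C j + 1) * R := by
    intro w M R g hM hR hw hM' hg
    calc ‖∑ j, w j • g j‖ ≤ ∑ j, ‖w j • g j‖ := norm_sum_le _ _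
      _ ≤ ∑ j, M * (C j * R) := Finset.sum_le_sum fun j _ => by
          rw [norm_smul]
          exact mul_le_mul (hw j) (hg j) (norm_nonneg _) hM
      _ = M * (∑ j, C j) * R := by rw [← Finset.mul_sum, ← Finset.sum_mul, mul_assoc]
      _ ≤ (Mu + Mv + 1) * (∑ j, C j + 1) * R := by gcongr; linarith
  refine ⟨d, (Mu + Mv + 1) * (∑ j, C j + 1),
    fun t ht x hx => (hb₀ _ (hmk t ht) x (hx.trans_le hdδ.1)).1, hd, by positivity, ?_, ?_, ?_, ?_⟩
  · intro t ht x hx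
    rw [controlled, controlled, ← Finset.sum_sub_distrib]
    simp only [← smul_sub]
    exact est _ Mu _ _ hMu (norm_nonneg _) (hu' t ht) (by linarith) fun j =>
      (hb j _ (hmk t ht) x (hx.trans_le (hdδ.2 j))).2.2.1
  · intro t ht x hx
    rw [controlled, controlled, sum_apply, ← Finset.sum_sub_distrib,
      ← Finset.sum_sub_distrib]
    simp only [smul_apply, ← smul_sub]
    exact est _ Mu _ _ hMu (by positivity) (hu' t ht) (by linarith) fun j =>
      (hb j _ (hmk t ht) x (hx.trans_le (hdδ.2 j))).2.2.2
  · intro t ht x hx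
    rw [controlled, ← mul_one ((Mu + Mv + 1) * (∑ j, C j + 1))]
    exact est _ Mv _ _ hMv zero_le_one (hv' t ht) (by linarith) fun j => by
      rw [mul_one]; exact (hb j _ (hmk t ht) x (hx.trans_le (hdδ.2 j))).2.1
  · intro t ht x hx
    rw [controlled, controlled, ← Finset.sum_sub_distrib]
    simp only [← smul_sub]
    exact est _ Mv _ _ hMv (norm_nonneg _) (hv' t ht) (by linarith) fun j =>
      (hb j _ (hmk t ht) x (hx.trans_le (hdδ.2 j))).2.2.1

namespace TubeBound

variable {G H : ℝ → E → E} {A : ℝ → E →L[ℝ] E} {y₀ y : ℝ → E} {a b δ C s : ℝ}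

/-- Grönwall's estimate for the variation of a trajectory. -/
lemma norm_sub_le (h : TubeBound G H A y₀ a b δ C) {t₁ : ℝ} (ht₁ : t₁ ≤ b)
    (hy₀ : ∀ t ∈ Icc a b, HasDerivWithinAt y₀ (G t (y₀ t)) (Icc a b) t)
    (hy : ∀ t ∈ Icc a t₁, HasDerivWithinAt y (G t (y t) + s • H t (y t)) (Icc a t₁) t)
    (hya : y a = y₀ a) (htube : ∀ t ∈ Icc a t₁, ‖y t - y₀ t‖ < δ) :
    ∀ t ∈ Icc a t₁, ‖y t - y₀ t‖ ≤ |s| * Real.exp (C * (b - a)) := by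
  have hd : ∀ t ∈ Icc a t₁, HasDerivWithinAt (fun t => y t - y₀ t)
      (G t (y t) + s • H t (y t) - G t (y₀ t)) (Icc a t₁) t := fun t ht =>
    (hy t ht).sub ((hy₀ t ⟨ht.1, ht.2.trans ht₁⟩).mono (Icc_subset_Icc_right ht₁))
  -- The difference starts at 0, grows at rate `C`, and is forced by at most `|s| * C`. The quotient
  -- of forcing by rate is `|s|`, which is why no factor `C` remains in front of the exponential.
  have hg := norm_le_gronwallBound_of_norm_deriv_right_le (δ := 0) (K := C) (ε := |s| * C)
    (fun t ht => (hd t ht).continuousWithinAt)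
    (fun t ht => (hd t (Ico_subset_Icc_self ht)).mono_of_mem_nhdsWithin
      (Icc_mem_nhdsGE_of_mem ht)) (by simp [hya])
    (fun t ht => by
      have htb : t ∈ Icc a b := ⟨ht.1, ht.2.le.trans ht₁⟩
      have hx := htube t (Ico_subset_Icc_self ht)
      have e : G t (y t) + s • H t (y t) - G t (y₀ t) =
        (G t (y t) - G t (y₀ t)) + s • H t (y t) := by abel
      rw [e]
      refine (norm_add_le _ _).trans (add_le_add (h.lipschitz t htb _ hx) ?_)
      rw [norm_smul, Real.norm_eq_abs]
      gcongr
      exact h.bound t htb _ hx)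
  intro t ht
  refine (hg t ht).trans ?_
  have hC := h.const_pos
  rw [gronwallBound_of_K_ne_0 hC.ne']
  beta_reduce
  rw [zero_mul, zero_add, mul_div_assoc, div_self hC.ne', mul_one]
  gcongr
  refine (sub_le_self _ zero_le_one).trans (Real.exp_le_exp.2 ?_)
  have : t ≤ b := ht.2.trans ht₁
  gcongr

/-- The first variation of the endpoint, along a solution `P` of the adjoint equation. -/
lemma hasDerivAt_endpoint {F : Type*} [NormedAddCommGroup F] [NormedSpace ℝ F] {y : ℝ → ℝ → E}
    (h : TubeBound G H A y₀ a b δ C) (hab : a ≤ b)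
    (hy₀ : ∀ t ∈ Icc a b, HasDerivWithinAt y₀ (G t (y₀ t)) (Icc a b) t)
    (h0 : y 0 b = y₀ b)
    (hy : ∀ᶠ s in 𝓝 (0 : ℝ), y s a = y₀ a ∧ ∀ t ∈ Icc a b, ‖y s t - y₀ t‖ < δ ∧
      HasDerivWithinAt (y s) (G t (y s t) + s • H t (y s t)) (Icc a b) t)
    {P : ℝ → E →L[ℝ] F} (hP : ∀ t ∈ Icc a b, HasDerivWithinAt P (-(P t).comp (A t)) (Icc a b) t)
    {Q : ℝ → F} (hQa : Q a = 0)
    (hQ : ∀ t ∈ Icc a b, HasDerivWithinAt Q (P t (H t (y₀ t))) (Icc a b) t) :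
    HasDerivAt (fun s => P b (y s b)) (Q b) 0 := by
  obtain ⟨M, hM⟩ := isCompact_Icc.exists_bound_of_continuousOn
    (fun t ht => (hP t ht).continuousWithinAt : ContinuousOn P (Icc a b))
  have hM0 : 0 ≤ M := (norm_nonneg _).trans (hM a (left_mem_Icc.2 hab))
  set R := Real.exp (C * (b - a)) with hR
  have hR0 : 0 < R := Real.exp_pos _
  have hC := h.const_pos
  -- The adjoint equation cancels the linear part of the derivative of P(y_s - y₀) - s Q. There
  -- remain the Taylor remainder of `G` and s times the increment of `H`, both of order s² by
  -- Grönwall.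
  have key : ∀ᶠ s in 𝓝 (0 : ℝ), ‖P b (y s b) - P b (y₀ b) - s • Q b‖ ≤
      (M * (C * R ^ 2 + C * R) * (b - a)) * ‖s‖ ^ 2 := by
    filter_upwards [hy] with s ⟨hsa, hs⟩
    have hgr := h.norm_sub_le le_rfl hy₀ (fun t ht => (hs t ht).2) hsa (fun t ht => (hs t ht).1)
    have hz : ∀ t ∈ Icc a b, HasDerivWithinAt (fun t => P t (y s t - y₀ t) - s • Q t)
        ((-(P t).comp (A t)) (y s t - y₀ t) + P t (G t (y s t) + s • H t (y s t) - G t (y₀ t)) -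
          s • P t (H t (y₀ t))) (Icc a b) t := fun t ht =>
      ((hP t ht).clm_apply ((hs t ht).2.sub (hy₀ t ht))).sub ((hQ t ht).const_smul s)
    have hb := norm_image_sub_le_of_norm_deriv_le_segment' hz
      (C := M * (C * R ^ 2 + C * R) * ‖s‖ ^ 2) (fun t ht => by
        have htb := Ico_subset_Icc_self ht
        have hx := (hs t htb).1
        have e : (-(P t).comp (A t)) (y s t - y₀ t) +
            P t (G t (y s t) + s • H t (y s t) - G t (y₀ t)) - s • P t (H t (y₀ t)) =
            P t ((G t (y s t) - G t (y₀ t) - A t (y s t - y₀ t)) +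
              s • (H t (y s t) - H t (y₀ t))) := by
          simp only [neg_apply, ContinuousLinearMap.comp_apply, map_add,
            map_sub, map_smul, smul_sub]
          abel
        rw [e, mul_assoc]
        refine ((P t).le_opNorm _).trans (mul_le_mul (hM t htb) ?_ (norm_nonneg _) hM0)
        refine (norm_add_le _ _).trans ?_
        rw [add_mul, norm_smul]
        refine add_le_add ((h.taylor t htb _ hx).trans ?_) ?_
        · rw [mul_assoc, ← mul_pow, mul_comm R]
          gcongr
          exact hgr t htb
        · calc ‖s‖ * ‖H t (y s t) - H t (y₀ t)‖ ≤ ‖s‖ * (C * (‖s‖ * R)) := by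
                gcongr
                refine (h.lipschitz' t htb _ hx).trans ?_
                gcongr
                exact hgr t htb
            _ = C * R * ‖s‖ ^ 2 := by ring) b (right_mem_Icc.2 hab)
    simp only [hsa, hQa, sub_self, map_zero, smul_zero, sub_zero, map_sub] at hb
    linarith
  rw [hasDerivAt_iff_isLittleO]
  simp only [sub_zero, h0]
  have hO : (fun s => P b (y s b) - P b (y₀ b) - s • Q b) =O[𝓝 0] fun s : ℝ => ‖s‖ ^ 2 :=
    Asymptotics.IsBigO.of_bound _ (key.mono fun s hs => by simpa using hs)
  refine hO.trans_isLittleO ?_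
  have := (Asymptotics.isLittleO_pow_id (𝕜 := ℝ) (n := 2) (by norm_num))
  simpa using this

end TubeBound

end Tube

/-! ### Velocities of curves in a chart. -/

section CurvesInCharts

variable {E : Type*} [NormedAddCommGroup E] [NormedSpace ℝ E]
  {H : Type*} [TopologicalSpace H]
  {I : ModelWithCorners ℝ E H} {M : Type*} [TopologicalSpace M] [ChartedSpace H M]
  [IsManifold I ∞ M] {p : M}

lemma hasDerivWithinAt_of_apply_one {f : ℝ → E} {L : ℝ →L[ℝ] E} {v : E} {S : Set ℝ} {t : ℝ}
    (h : HasFDerivWithinAt f L S t) (hL : L 1 = v) : HasDerivWithinAt f v S t :=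
  hL ▸ h.hasDerivWithinAt

lemma hasDerivWithinAt_chart {c : ℝ → M} {S : Set ℝ} {t : ℝ} {w : TangentSpace I (c t)}
    (hc : HasMFDerivWithinAt 𝓘(ℝ, ℝ) I c S t
      (ContinuousLinearMap.smulRight (1 : ℝ →L[ℝ] ℝ) w))
    (hs : c t ∈ (extChartAt I p).source) :
    HasDerivWithinAt (fun τ => extChartAt I p (c τ))
      (mfderiv I 𝓘(ℝ, E) (extChartAt I p) (c t) w) S t := by
  have h1 := ((contMDiffAt_chart hs).mdifferentiableAt (by simp)).hasMFDerivAt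
  have h2 : HasFDerivWithinAt (fun τ => extChartAt I p (c τ))
      ((mfderiv I 𝓘(ℝ, E) (extChartAt I p) (c t)).comp
        (ContinuousLinearMap.smulRight (1 : ℝ →L[ℝ] ℝ) w) : ℝ →L[ℝ] E) S t :=
    (h1.comp_hasMFDerivWithinAt t hc).hasFDerivWithinAt
  refine hasDerivWithinAt_of_apply_one (E := E) h2 ?_
  exact congrArg (mfderiv I 𝓘(ℝ, E) (extChartAt I p) (c t)) (one_smul ℝ w)

lemma mfderiv_symm_mfderiv [I.Boundaryless] {y : E} (hy : y ∈ (extChartAt I p).target)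
    (w : TangentSpace I ((extChartAt I p).symm y)) :
    mfderiv 𝓘(ℝ, E) I (extChartAt I p).symm y
      (mfderiv I 𝓘(ℝ, E) (extChartAt I p) ((extChartAt I p).symm y) w) = w := by
  have : IsManifold I 1 M := isManifold_one
  have h2 := mfderivWithin_extChartAt_symm_comp_mfderiv_extChartAt (I := I) hy
  rw [I.range_eq_univ, mfderivWithin_univ] at h2
  exact DFunLike.congr_fun h2 w

lemma hasMFDerivWithinAt_symm [I.Boundaryless] {y : ℝ → E} {S : Set ℝ} {t : ℝ}
    (hy : y t ∈ (extChartAt I p).target)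
    {w : TangentSpace I ((extChartAt I p).symm (y t))}
    (hd : HasDerivWithinAt y
      (mfderiv I 𝓘(ℝ, E) (extChartAt I p) ((extChartAt I p).symm (y t)) w) S t) :
    HasMFDerivWithinAt 𝓘(ℝ, ℝ) I (fun τ => (extChartAt I p).symm (y τ)) S t
      (ContinuousLinearMap.smulRight (1 : ℝ →L[ℝ] ℝ) w) := by
  have h1 := ((contMDiffAt_symm hy).mdifferentiableAt (by simp)).hasMFDerivAt
  have h2 := h1.comp_hasMFDerivWithinAt t hd.hasFDerivWithinAt.hasMFDerivWithinAt
  refine h2.congr_mfderiv ?_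
  refine ContinuousLinearMap.ext_ring ?_
  refine Eq.trans ?_ (one_smul ℝ w).symm
  refine Eq.trans ?_ (mfderiv_symm_mfderiv hy w)
  refine congrArg (mfderiv 𝓘(ℝ, E) I (extChartAt I p).symm (y t)) ?_
  exact one_smul ℝ (mfderiv I 𝓘(ℝ, E) (extChartAt I p) ((extChartAt I p).symm (y t)) w)

lemma hasDerivAt_chart_of_velocity {c : ℝ → M} {t : ℝ} {x : M} {w : TangentSpace I x}
    (hc : MDifferentiableAt 𝓘(ℝ, ℝ) I c t) (hv : velocity I c t = ⟨x, w⟩)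
    (hx : x ∈ (extChartAt I p).source) :
    HasDerivAt (fun τ => extChartAt I p (c τ)) (mfderiv I 𝓘(ℝ, E) (extChartAt I p) x w) t := by
  obtain ⟨rfl, h⟩ := Bundle.TotalSpace.mk.inj hv
  obtain rfl := eq_of_heq h
  refine hasDerivWithinAt_univ.1 ?_
  refine hasDerivWithinAt_chart (HasMFDerivAt.hasMFDerivWithinAt ?_) hx
  refine hc.hasMFDerivAt.congr_mfderiv ?_
  exact ContinuousLinearMap.ext_ring (one_smul ℝ _).symm

omit [IsManifold I ∞ M] in
lemma velocity_eq {c : ℝ → M} {t : ℝ} {w : TangentSpace I (c t)}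
    (hc : HasMFDerivAt 𝓘(ℝ, ℝ) I c t (ContinuousLinearMap.smulRight (1 : ℝ →L[ℝ] ℝ) w)) :
    velocity I c t = ⟨c t, w⟩ := by
  rw [velocity, hc.mfderiv]
  congr 1
  exact one_smul ℝ w

end CurvesInCharts

/-! ### An annihilating adjoint covector makes a curve critical. -/

section Critical

variable {E : Type*} [NormedAddCommGroup E] [NormedSpace ℝ E]
  {H : Type*} [TopologicalSpace H]
  {I : ModelWithCorners ℝ E H} {M : Type*} [TopologicalSpace M] [ChartedSpace H M]
  [IsManifold I ∞ M] {p : M}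

omit [IsManifold I ∞ M] in
lemma chartField_sum {m : ℕ} (ξ : Fin m → Π x : M, TangentSpace I x) (w : Fin m → ℝ) {x : M}
    (hx : x ∈ (extChartAt I p).source) :
    mfderiv I 𝓘(ℝ, E) (extChartAt I p) x (∑ j, w j • ξ j x) =
      ∑ j, w j • chartField I p (ξ j) (extChartAt I p x) := by
  refine (map_sum _ _ _).trans (Finset.sum_congr rfl fun j _ => ?_)
  rw [map_smul]
  unfold chartField
  rw [(extChartAt I p).left_inv hx]
  rfl

/-- If the covector `P` annihilates all sections along `γ` and solves the adjoint equation, then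
`γ` is a critical point of the endpoint map. -/
theorem isEndpointCritical_of_adjoint [FiniteDimensional ℝ E] [I.Boundaryless] [T2Space M]
    {Δ : Π x : M, Submodule ℝ (TangentSpace I x)}
    {γ : ℝ → M} {a b : ℝ} (hab : a ≤ b) (hγ : ∀ t ∈ Icc a b, γ t ∈ (extChartAt I p).source)
    {P : ℝ → E →L[ℝ] ℝ} (hPb : P b ≠ 0)
    (hP : ∀ (m : ℕ) (ξ : Fin m → Π x : M, TangentSpace I x) (U : Set M) (u : Fin m → ℝ → ℝ),
      IsOpen U → (∀ j, ξ j ∈ sectionsOn I Δ U) → (∀ t ∈ Icc a b, γ t ∈ U) →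
      (∀ t ∈ Icc a b, HasDerivWithinAt (fun t => extChartAt I p (γ t))
        (∑ j, u j t • chartField I p (ξ j) (extChartAt I p (γ t))) (Icc a b) t) →
      ∀ t ∈ Icc a b, (∀ j, P t (chartField I p (ξ j) (extChartAt I p (γ t))) = 0) ∧
        HasDerivWithinAt P (-(P t).comp
          (∑ j, u j t • fderiv ℝ (chartField I p (ξ j)) (extChartAt I p (γ t)))) (Icc a b) t) :
    IsEndpointCritical I Δ γ a b := by
  have : CompleteSpace E := FiniteDimensional.complete ℝ E
  intro huniv
  have hb : b ∈ Icc a b := right_mem_Icc.2 hab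
  obtain ⟨v, hv⟩ : ∃ v, P b v ≠ 0 := by
    by_contra! h
    exact hPb (ContinuousLinearMap.ext h)
  obtain ⟨w, rfl⟩ := (mfderiv_extChartAt_isInvertible (I := I) (hγ b hb)).surjective v
  obtain ⟨Γ, ⟨m, ξ, U, u, v, hU, hξ, huv, hΓ0, hΓ⟩, hmd, hvel⟩ :
    w ∈ endpointDifferentialImage I Δ γ a b := by rw [huniv]; trivial
  set y₀ : ℝ → E := fun t => extChartAt I p (γ t) with hy₀def
  set f : Fin m → E → E := fun j => chartField I p (ξ j) with hf
  have h0 := hΓ.self_of_nhds.2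
  have hγU : ∀ t ∈ Icc a b, γ t ∈ U := fun t ht => hΓ0 t ht ▸ (h0 t ht).1
  have hder : ∀ {s : ℝ} {t₁ t : ℝ}, HasMFDerivWithinAt 𝓘(ℝ, ℝ) I (Γ s) (Icc a t₁) t
        (ContinuousLinearMap.smulRight (1 : ℝ →L[ℝ] ℝ)
          (∑ j, (u j t + s * v j t) • ξ j (Γ s t))) → Γ s t ∈ (extChartAt I p).source →
      HasDerivWithinAt (fun t => extChartAt I p (Γ s t)) (controlled f u t (extChartAt I p (Γ s t)) +
        s • controlled f v t (extChartAt I p (Γ s t))) (Icc a t₁) t := by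
    intro s t₁ t h1 h2
    refine (hasDerivWithinAt_chart h1 h2).congr_deriv ?_
    rw [chartField_sum ξ (fun j => u j t + s * v j t) h2, controlled, controlled, Finset.smul_sum,
      ← Finset.sum_add_distrib]
    exact Finset.sum_congr rfl fun j _ => by rw [add_smul, mul_smul]
  have hy₀ : ∀ t ∈ Icc a b, HasDerivWithinAt y₀ (controlled f u t (y₀ t)) (Icc a b) t := by
    intro t ht
    have h1 := hder (h0 t ht).2 (by rw [hΓ0 t ht]; exact hγ t ht)
    rw [zero_smul, add_zero, hΓ0 t ht] at h1
    exact h1.congr (fun τ hτ => by rw [hΓ0 τ hτ]) (by rw [hΓ0 t ht])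
  have hyc : ContinuousOn y₀ (Icc a b) := fun t ht => (hy₀ t ht).continuousWithinAt
  have hyt : ∀ t ∈ Icc a b, y₀ t ∈ chartSet I p U := fun t ht =>
    ⟨(extChartAt I p).map_source (hγ t ht), by
      rw [mem_preimage, (extChartAt I p).left_inv (hγ t ht)]; exact hγU t ht⟩
  obtain ⟨δ, C, hδW, hT⟩ := exists_tubeBound (isOpen_chartSet p hU)
    (fun j => contDiffOn_chartField hU (hξ j).1) (fun j => (huv j).1) (fun j => (huv j).2) hyc hyt
  have hδ := hT.radius_pos
  set R := Real.exp (C * (b - a)) with hR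
  have hR0 : 0 < R := Real.exp_pos _
  have hsmall : ∀ᶠ s : ℝ in 𝓝 0, |s| * R < δ / 2 := by
    have hc : Continuous fun s : ℝ => |s| * R := by fun_prop
    exact hc.continuousAt.eventually (gt_mem_nhds (by simp [hδ]))
  have htube : ∀ᶠ s in 𝓝 (0 : ℝ), ∀ t ∈ Icc a b, Γ s t ∈ (extChartAt I p).source ∧
      ‖extChartAt I p (Γ s t) - y₀ t‖ ≤ δ / 2 := by
    filter_upwards [hΓ, hsmall] with s ⟨hsa, hs⟩ hsR
    have hΓc : ContinuousOn (Γ s) (Icc a b) := fun t ht => (hs t ht).2.continuousWithinAt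
    -- The closed tube around the curve, transported to the manifold together with time. It is
    -- compact, hence closed as `M` is Hausdorff; so a varied curve cannot leave the chart domain
    -- while remaining in the tube.
    let K : Set (M × ℝ) := (fun z : E × ℝ => ((extChartAt I p).symm (y₀ z.2 + z.1), z.2)) ''
      (Metric.closedBall 0 (δ / 2) ×ˢ Icc a b)
    have hball : ∀ z ∈ Metric.closedBall (0 : E) (δ / 2) ×ˢ Icc a b,
        y₀ z.2 + z.1 ∈ (extChartAt I p).target := fun z hz =>
      (hδW z.2 hz.2 _ (by
        have := mem_closedBall_zero_iff.1 hz.1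
        rw [add_sub_cancel_left]; linarith)).1
    have hKc : IsClosed K := by
      refine (((isCompact_closedBall _ _).prod isCompact_Icc).image_of_continuousOn ?_).isClosed
      refine ContinuousOn.prodMk ((continuousOn_extChartAt_symm p).comp ?_ hball)
        continuous_snd.continuousOn
      exact (hyc.comp continuous_snd.continuousOn fun z hz => hz.2).add continuous_fst.continuousOn
    let S : Set ℝ := {t | Γ s t ∈ (extChartAt I p).source ∧
      ‖extChartAt I p (Γ s t) - y₀ t‖ ≤ δ / 2}
    have hSc : IsClosed (S ∩ Icc a b) := by
      have hpre : IsClosed (Icc a b ∩ (fun t => (Γ s t, t)) ⁻¹' K) :=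
        (hΓc.prodMk continuousOn_id).preimage_isClosed_of_isClosed isClosed_Icc hKc
      convert hpre using 1
      ext t
      refine ⟨fun ⟨h1, h2⟩ => ⟨h2, (extChartAt I p (Γ s t) - y₀ t, t),
        ⟨mem_closedBall_zero_iff.2 h1.2, h2⟩, ?_⟩, ?_⟩
      · refine Prod.ext ?_ rfl
        beta_reduce
        rw [add_sub_cancel, (extChartAt I p).left_inv h1.1]
      · rintro ⟨h2, z, hz, hzt⟩
        obtain ⟨e1, e2⟩ := Prod.mk.inj hzt
        have htar := hball z hz
        refine ⟨⟨?_, ?_⟩, h2⟩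
        · rw [← e1]; exact (extChartAt I p).map_target htar
        · rw [← e1, (extChartAt I p).right_inv htar, ← e2, add_sub_cancel_left]
          exact mem_closedBall_zero_iff.1 hz.1
    -- Continuity method: the set of good times is closed, and as long as the curve has been good
    -- Grönwall gives a bound strictly below `δ / 2`, so goodness persists a little longer.
    refine hSc.Icc_subset_of_forall_mem_nhdsGT_of_Icc_subset ?_ ?_
    · refine ⟨by rw [hsa]; exact hγ a (left_mem_Icc.2 hab), ?_⟩
      rw [hsa, hy₀def, sub_self, norm_zero]
      positivity
    · intro t₁ ht₁ hsub
      have htb : t₁ ∈ Icc a b := Ico_subset_Icc_self ht₁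
      have hgr := hT.norm_sub_le (y := fun t => extChartAt I p (Γ s t)) ht₁.2.le hy₀
        (fun t ht => hder ((hs t ⟨ht.1, ht.2.trans ht₁.2.le⟩).2.mono
          (Icc_subset_Icc_right ht₁.2.le)) (hsub ht).1) (by rw [hsa])
        (fun t ht => (hsub ht).2.trans_lt (by linarith)) t₁ (right_mem_Icc.2 ht₁.1)
      have hsrc := (hsub (right_mem_Icc.2 ht₁.1)).1
      have hcd : ContinuousWithinAt (fun t => extChartAt I p (Γ s t) - y₀ t) (Icc a b) t₁ :=
        (hder (hs t₁ htb).2 hsrc).continuousWithinAt.sub (hyc t₁ htb)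
      have hnear : ∀ᶠ t in 𝓝[Icc a b] t₁, t ∈ S := by
        filter_upwards [hΓc t₁ htb |>.eventually ((isOpen_extChartAt_source p).mem_nhds hsrc),
          hcd.norm.eventually (gt_mem_nhds (hgr.trans_lt hsR))] with t e1 e2
        exact ⟨e1, e2.le⟩
      exact nhdsWithin_le_of_mem (Icc_mem_nhdsGT_of_mem ht₁) hnear
  have hPu := hP m ξ U u hU hξ hγU hy₀
  -- `P` annihilates all the controlled fields, so the source term vanishes and `Q = 0` is
  -- admissible. Hence `P b` kills every endpoint derivative, including the one chosen with nonzero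
  -- value.
  have hend := hT.hasDerivAt_endpoint hab hy₀ (y := fun s t => extChartAt I p (Γ s t))
    (by simp only [hy₀def, hΓ0 b hb]) (by
      filter_upwards [hΓ, htube] with s ⟨hsa, hs⟩ hst
      exact ⟨by rw [hsa], fun t ht => ⟨(hst t ht).2.trans_lt (by linarith),
        hder (hs t ht).2 (hst t ht).1⟩⟩)
    (P := P) (fun t ht => (hPu t ht).2) (Q := fun _ => 0) rfl (fun t ht => by
      have : P t (controlled f v t (y₀ t)) = 0 := by
        rw [controlled, map_sum]
        exact Finset.sum_eq_zero fun j _ => by rw [map_smul, (hPu t ht).1 j, smul_zero]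
      rw [this]
      exact hasDerivWithinAt_const _ _ _)
  have hend' := (P b).hasFDerivAt.comp_hasDerivAt (0 : ℝ)
    (hasDerivAt_chart_of_velocity hmd hvel (hγ b hb))
  exact hv (hend'.unique hend)

end Critical

/-! ### The differential equation of singular curves. -/

section SingularCurve

open VectorField

variable {E : Type*} [NormedAddCommGroup E] [NormedSpace ℝ E]
  {e : Fin 7 → E → E} {η : Fin 7 → E → E →L[ℝ] ℝ} {O : Set E}

lemma drift_eq (e : Fin 7 → E → E) (η : Fin 7 → E → E →L[ℝ] ℝ) (i : Fin 7) (θ φ : ℝ) (y : E) :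
    drift e η i θ φ y = θ ^ 2 * ∑ j, coneCoef θ φ j * structureFun e η j i 4 y -
      θ * ∑ j, coneCoef θ φ j * structureFun e η j i 5 y +
      ∑ j, coneCoef θ φ j * structureFun e η j i 6 y := by
  rw [drift, Finset.mul_sum, Finset.mul_sum, ← Finset.sum_sub_distrib, ← Finset.sum_add_distrib]
  exact Finset.sum_congr rfl fun j _ => by ring

/-- The adjoint covector along a curve tangent to a field of cone vectors. -/
def coneCovector (η : Fin 7 → E → E →L[ℝ] ℝ) (l θ : ℝ) (y : E) : E →L[ℝ] ℝ :=
  l • (θ ^ 2 • η 4 y - θ • η 5 y + η 6 y)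

lemma coneCovector_apply (l θ : ℝ) (y v : E) :
    coneCovector η l θ y v = l * (θ ^ 2 * η 4 y v - θ * η 5 y v + η 6 y v) := rfl

namespace IsAdaptedCoframe

variable (h : IsAdaptedCoframe e η O)
include h

/-- The adjoint equation, where the obstruction vanishes. -/
lemma hasDerivWithinAt_coneCovector {y : ℝ → E} {θ l : ℝ → ℝ} {φ κ : ℝ} {S : Set ℝ} {t : ℝ}
    (hyO : y t ∈ O)
    (hy : HasDerivWithinAt y (κ • ∑ j, coneCoef (θ t) φ j • e j (y t)) S t)
    (hθ : HasDerivWithinAt θ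
      (-κ * (drift e η 5 (θ t) φ (y t) + θ t * drift e η 6 (θ t) φ (y t))) S t)
    (hl : HasDerivWithinAt l (κ * l t * drift e η 6 (θ t) φ (y t)) S t)
    (hF : obstruction e η (θ t) φ (y t) = 0) {f : E → E} (hf : DifferentiableAt ℝ f (y t))
    (hfD : ∀ k, 4 ≤ k → ∀ᶠ z in 𝓝 (y t), η k z (f z) = 0)
    (hfy : f (y t) = κ • ∑ j, coneCoef (θ t) φ j • e j (y t)) :
    HasDerivWithinAt (fun τ => coneCovector η (l τ) (θ τ) (y τ))
      (-(coneCovector η (l t) (θ t) (y t)).comp (fderiv ℝ f (y t))) S t := by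
  have hη : ∀ k, HasDerivWithinAt (fun τ => η k (y τ)) (fderiv ℝ (η k) (y t) (f (y t))) S t :=
    fun k => by
    rw [hfy]
    exact (h.differentiableAt_coframe hyO k).hasFDerivAt.comp_hasDerivWithinAt t hy
  have hd := hl.fun_smul ((((hθ.fun_pow 2).fun_smul (hη 4)).fun_sub (hθ.fun_smul (hη 5))).fun_add
    (hη 6))
  refine hd.congr_deriv ?_
  ext v
  have hcomp : ∀ j, η j (y t) (f (y t)) = κ * coneCoef (θ t) φ j := by
    intro j
    rw [hfy]
    simp [h.dual _ hyO]
  -- The exterior derivative of η_k replaces the derivative of the coframe along the curve by minus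
  -- η_k composed with the derivative of `f`, up to structure functions.
  have hext : ∀ k, 4 ≤ k → fderiv ℝ (η k) (y t) (f (y t)) v = -η k (y t) (fderiv ℝ f (y t) v) -
      κ * ∑ j, ∑ i, coneCoef (θ t) φ j * η i (y t) v * structureFun e η j i k (y t) := by
    intro k hk
    have e1 := h.exterior hyO k (f (y t)) v
    rw [h.fderiv_coframe_apply hyO hf (hfD k hk)] at e1
    have e2 : ∑ j, ∑ i, η j (y t) (f (y t)) * η i (y t) v * structureFun e η j i k (y t) =
        κ * ∑ j, ∑ i, coneCoef (θ t) φ j * η i (y t) v * structureFun e η j i k (y t) := by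
      simp only [Finset.mul_sum, hcomp, mul_assoc]
    linarith
  obtain ⟨s4, s5, s6⟩ := h.sum_structureFun hyO (v := coneCoef (θ t) φ)
    (w := fun i => η i (y t) v) rfl rfl rfl
  have d4 := drift_eq e η 4 (θ t) φ (y t)
  have d5 := drift_eq e η 5 (θ t) φ (y t)
  have d6 := drift_eq e η 6 (θ t) φ (y t)
  have x4 := hext 4 le_rfl
  have x5 := hext 5 (by decide)
  have x6 := hext 6 (by decide)
  rw [s4] at x4
  rw [s5] at x5
  rw [s6] at x6
  have c0 : coneCoef (θ t) φ 0 = 1 := rfl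
  have c1 : coneCoef (θ t) φ 1 = θ t := rfl
  have c2 : coneCoef (θ t) φ 2 = φ := rfl
  have c3 : coneCoef (θ t) φ 3 = θ t * φ := rfl
  simp only [c0, c1, c2, c3] at x4 x5 x6
  simp only [add_apply, sub_apply, smul_apply, neg_apply, ContinuousLinearMap.comp_apply,
    coneCovector_apply, smul_eq_mul, x4, x5, x6]
  rw [obstruction] at hF
  simp only [d4, d5, d6] at hF ⊢
  -- The coefficients of η5 and η6 match by the choice of θ' and l'. The coefficient of η4 matches
  -- up to a multiple of the obstruction.
  linear_combination (-(κ * l t * η 4 (y t) v)) * hF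

/-- The vector field whose integral curves are the singular curves with their adjoint
covectors. -/
def singularField (e : Fin 7 → E → E) (η : Fin 7 → E → E →L[ℝ] ℝ) (κ φ : ℝ) (z : E × ℝ × ℝ) :
    E × ℝ × ℝ :=
  (κ • ∑ j, coneCoef z.2.1 φ j • e j z.1,
    -κ * (drift e η 5 z.2.1 φ z.1 + z.2.1 * drift e η 6 z.2.1 φ z.1),
    κ * z.2.2 * drift e η 6 z.2.1 φ z.1)

lemma contDiffOn_singularField (κ φ : ℝ) :
    ContDiffOn ℝ ∞ (singularField e η κ φ) (O ×ˢ univ) := by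
  have hfst : ContDiffOn ℝ ∞ (fun z : E × ℝ × ℝ => z.1) (O ×ˢ univ) := contDiff_fst.contDiffOn
  have hmaps : MapsTo (fun z : E × ℝ × ℝ => z.1) (O ×ˢ univ) O := fun z hz => hz.1
  have hθ : ContDiffOn ℝ ∞ (fun z : E × ℝ × ℝ => z.2.1) (O ×ˢ univ) := by fun_prop
  have hl : ContDiffOn ℝ ∞ (fun z : E × ℝ × ℝ => z.2.2) (O ×ˢ univ) := by fun_prop
  have hc : ∀ j, ContDiffOn ℝ ∞ (fun z : E × ℝ × ℝ => coneCoef z.2.1 φ j) (O ×ˢ univ) := by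
    intro j
    fin_cases j <;> simp [coneCoef] <;> fun_prop
  have hs : ∀ j i k, ContDiffOn ℝ ∞ (fun z : E × ℝ × ℝ => structureFun e η j i k z.1)
      (O ×ˢ univ) := fun j i k => (h.contDiffOn_structureFun j i k).comp hfst hmaps
  have hd : ∀ i, ContDiffOn ℝ ∞ (fun z : E × ℝ × ℝ => drift e η i z.2.1 φ z.1) (O ×ˢ univ) :=
    fun i => ContDiffOn.sum fun j _ => (hc j).mul
      ((((hθ.pow 2).mul (hs j i 4)).sub (hθ.mul (hs j i 5))).add (hs j i 6))
  refine ContDiffOn.prodMk ?_ (ContDiffOn.prodMk ?_ ?_)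
  · exact contDiffOn_const.smul (ContDiffOn.sum fun j _ =>
      (hc j).smul ((h.smooth_frame j).comp hfst hmaps))
  · exact contDiffOn_const.mul ((hd 5).add (hθ.mul (hd 6)))
  · exact (contDiffOn_const.mul hl).mul (hd 6)

/-- Smooth integral curves of the singular field. -/
lemma exists_singular_solution [CompleteSpace E] (κ φ : ℝ) {z₀ : E × ℝ × ℝ} (hz₀ : z₀.1 ∈ O)
    {N : Set (E × ℝ × ℝ)} (hN : N ∈ 𝓝 z₀) :
    ∃ α : ℝ → E × ℝ × ℝ, α 0 = z₀ ∧ ∀ᶠ t in 𝓝 (0 : ℝ), α t ∈ N ∧ (α t).1 ∈ O ∧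
      ContDiffAt ℝ ∞ α t ∧ HasDerivAt α (singularField e η κ φ (α t)) t := by
  have hO : IsOpen (O ×ˢ (univ : Set (ℝ × ℝ))) := h.isOpen.prod isOpen_univ
  have hs := h.contDiffOn_singularField κ φ
  have hz : z₀ ∈ O ×ˢ (univ : Set (ℝ × ℝ)) := ⟨hz₀, trivial⟩
  obtain ⟨α, h0, ε, hε, hα⟩ := ((hs.contDiffAt (hO.mem_nhds hz)).of_le
    (by simp : (1 : ℕ∞ω) ≤ ∞)).exists_forall_mem_closedBall_exists_eq_forall_mem_Ioo_hasDerivAt₀ 0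
  have hcont : ContinuousAt α 0 := (hα 0 (by constructor <;> linarith)).continuousAt
  have hev : ∀ᶠ t in 𝓝 (0 : ℝ), α t ∈ N ∧ α t ∈ O ×ˢ (univ : Set (ℝ × ℝ)) ∧
      HasDerivAt α (singularField e η κ φ (α t)) t := by
    refine (hcont.eventually (h0 ▸ hN)).and ((hcont.eventually ?_).and ?_)
    · rw [h0]; exact hO.mem_nhds hz
    · filter_upwards [Ioo_mem_nhds (by linarith : 0 - ε < 0) (by linarith : (0 : ℝ) < 0 + ε)]
        with t ht using hα t ht
  obtain ⟨r, hr, hball⟩ := Metric.eventually_nhds_iff_ball.1 hev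
  have hsub : Icc (-(r / 2)) (r / 2) ⊆ Metric.ball (0 : ℝ) r := by
    intro t ht
    rw [mem_ball_zero_iff, Real.norm_eq_abs, abs_lt]
    constructor <;> linarith [ht.1, ht.2]
  have hsm : ContDiffOn ℝ ∞ α (Icc (-(r / 2)) (r / 2)) :=
    ODE.contDiffOn_enat_Icc_of_hasDerivWithinAt (n := ⊤) (f := fun _ => singularField e η κ φ)
      (u := O ×ˢ univ) (hs.comp contDiff_snd.contDiffOn fun z hz => hz.2)
      (fun t ht => (hball t (hsub ht)).2.2.hasDerivWithinAt) (fun t ht => (hball t (hsub ht)).2.1)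
  refine ⟨α, h0, ?_⟩
  filter_upwards [hev, Ioo_mem_nhds (by linarith : -(r / 2) < 0) (by linarith : 0 < r / 2)]
    with t ⟨h1, h2, h3⟩ ht
  exact ⟨h1, h2.1, hsm.contDiffAt (Icc_mem_nhds ht.1 ht.2), h3⟩

end IsAdaptedCoframe

end SingularCurve

/-! ### Existence of singular paths when the obstruction vanishes nearby. -/

section SingularPath

variable {X : Type*} [TopologicalSpace X] [ChartedSpace (EuclideanSpace ℝ (Fin 7)) X]
  [IsManifold (𝓡 7) ∞ X] {D : Π x : X, Submodule ℝ (TangentSpace (𝓡 7) x)} {U : Set X}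
  {ξ : Fin 4 → Π x : X, TangentSpace (𝓡 7) x} {p : X}
  {η : Fin 7 → EuclideanSpace ℝ (Fin 7) → EuclideanSpace ℝ (Fin 7) →L[ℝ] ℝ}

lemma IsAdaptedFrameOn.chartVector_mem (hξ : IsAdaptedFrameOn D U ξ) {x : X} (hx : x ∈ U)
    (q : ℝ × ℝ) : chartVector ξ (x, q) ∈ D x := by
  have hmem : ∀ i, ξ i x ∈ D x := fun i => by
    rw [← (hξ.1.2 x hx).2]
    exact Submodule.subset_span ⟨i, rfl⟩
  exact (D x).add_mem ((D x).add_mem ((D x).add_mem (hmem 0) ((D x).smul_mem _ (hmem 1)))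
    ((D x).smul_mem _ (hmem 2))) ((D x).smul_mem _ (hmem 3))

omit [IsManifold (𝓡 7) ∞ X] in
lemma mem_chartSet_of_mem {x : X} (hx : x ∈ (extChartAt (𝓡 7) p).source) (hxU : x ∈ U) :
    extChartAt (𝓡 7) p x ∈ chartSet (𝓡 7) p U :=
  ⟨(extChartAt (𝓡 7) p).map_source hx, by
    rw [mem_preimage, (extChartAt (𝓡 7) p).left_inv hx]; exact hxU⟩

/-- The integral curve of `singularField` provides the path and the components of its covector.
Immersivity holds because the velocity κζ has η0-component κ ≠ 0. -/
theorem exists_singularPath [T2Space X] {x₀ : X} {u₀ : TangentSpace (𝓡 7) x₀} {q : ℝ × ℝ} {κ : ℝ}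
    (hxU : x₀ ∈ U) (hξ : IsAdaptedFrameOn D U ξ) (hκ : κ ≠ 0)
    (hu₀ : u₀ = κ • chartVector ξ (x₀, q))
    (h : IsAdaptedCoframe (frameRep x₀ ξ) η (chartSet (𝓡 7) x₀ U))
    (hF : ∀ᶠ z in 𝓝 ((extChartAt (𝓡 7) x₀ x₀, q) : EuclideanSpace ℝ (Fin 7) × (ℝ × ℝ)),
      obstruction (frameRep x₀ ξ) η z.2.1 z.2.2 z.1 = 0) :
    ∃ γ : ℝ → X, IsSingularPath (𝓡 7) D γ ∧ velocity (𝓡 7) γ 0 = ⟨x₀, u₀⟩ := by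
  have hx : x₀ ∈ (extChartAt (𝓡 7) x₀).source := mem_extChartAt_source x₀
  set e := frameRep x₀ ξ with he
  have hO := h.isOpen
  obtain ⟨α, h0, hα⟩ := h.exists_singular_solution κ q.2
    (z₀ := (extChartAt (𝓡 7) x₀ x₀, q.1, 1)) (mem_chartSet_of_mem hx hxU)
    -- Any nonzero initial value of l would do; 1 is chosen. Near time 0 the solution stays where
    -- the obstruction vanishes and the covector is nonzero.
    (N := {w | obstruction e η w.2.1 q.2 w.1 = 0 ∧ w.2.2 ≠ 0}) (by
      have c1 : ContinuousAt (fun w : EuclideanSpace ℝ (Fin 7) × ℝ × ℝ => (w.1, w.2.1, q.2))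
          (extChartAt (𝓡 7) x₀ x₀, q.1, 1) := by fun_prop
      have c2 : ContinuousAt (fun w : EuclideanSpace ℝ (Fin 7) × ℝ × ℝ => w.2.2)
          (extChartAt (𝓡 7) x₀ x₀, q.1, 1) := by fun_prop
      exact (c1.eventually hF).and (c2.eventually_ne one_ne_zero))
  obtain ⟨r, hr, hball⟩ := Metric.eventually_nhds_iff_ball.1 hα
  set y : ℝ → EuclideanSpace ℝ (Fin 7) := fun t => (α t).1 with hy
  set γ : ℝ → X := fun t => (extChartAt (𝓡 7) x₀).symm (y t) with hγ
  have hyd : ∀ t ∈ Metric.ball (0 : ℝ) r,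
      HasDerivAt y (κ • ∑ j, coneCoef (α t).2.1 q.2 j • e j (y t)) t := fun t ht =>
    (ContinuousLinearMap.fst ℝ (EuclideanSpace ℝ (Fin 7)) (ℝ × ℝ)).hasFDerivAt.comp_hasDerivAt t
      (hball t ht).2.2.2
  have hθd : ∀ t ∈ Metric.ball (0 : ℝ) r, HasDerivAt (fun t => (α t).2.1)
      (-κ * (drift e η 5 (α t).2.1 q.2 (y t) + (α t).2.1 * drift e η 6 (α t).2.1 q.2 (y t))) t :=
    fun t ht => ((ContinuousLinearMap.fst ℝ ℝ ℝ).comp (ContinuousLinearMap.snd ℝ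
      (EuclideanSpace ℝ (Fin 7)) (ℝ × ℝ))).hasFDerivAt.comp_hasDerivAt t (hball t ht).2.2.2
  have hld : ∀ t ∈ Metric.ball (0 : ℝ) r, HasDerivAt (fun t => (α t).2.2)
      (κ * (α t).2.2 * drift e η 6 (α t).2.1 q.2 (y t)) t :=
    fun t ht => ((ContinuousLinearMap.snd ℝ ℝ ℝ).comp (ContinuousLinearMap.snd ℝ
      (EuclideanSpace ℝ (Fin 7)) (ℝ × ℝ))).hasFDerivAt.comp_hasDerivAt t (hball t ht).2.2.2
  let w : Π t : ℝ, TangentSpace (𝓡 7) (γ t) := fun t => κ • chartVector ξ (γ t, ((α t).2.1, q.2))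
  have hγd : ∀ t ∈ Metric.ball (0 : ℝ) r, HasMFDerivAt 𝓘(ℝ, ℝ) (𝓡 7) γ t
      (ContinuousLinearMap.smulRight (1 : ℝ →L[ℝ] ℝ) (w t)) := by
    intro t ht
    refine hasMFDerivWithinAt_univ.1 (hasMFDerivWithinAt_symm (hball t ht).2.1.1 ?_)
    refine (hyd t ht).hasDerivWithinAt.congr_deriv ?_
    refine Eq.symm ((map_smul (mfderiv (𝓡 7) 𝓘(ℝ, EuclideanSpace ℝ (Fin 7)) (extChartAt (𝓡 7) x₀)
      (γ t)) κ _).trans ?_)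
    exact congrArg (κ • ·) (chartField_chartVector (ξ := ξ) (p := x₀)
      (z := (y t, ((α t).2.1, q.2))))
  have hvel : ∀ t ∈ Metric.ball (0 : ℝ) r, velocity (𝓡 7) γ t = ⟨γ t, w t⟩ := fun t ht =>
    velocity_eq (hγd t ht)
  have hvel2 : ∀ t ∈ Metric.ball (0 : ℝ) r, (velocity (𝓡 7) γ t).2 = w t := fun t ht =>
    eq_of_heq (Bundle.TotalSpace.mk.inj (hvel t ht)).2
  have hw0 : ∀ t ∈ Metric.ball (0 : ℝ) r, w t ≠ 0 := by
    intro t ht hwt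
    have hyO := (hball t ht).2.1
    have e1 : (coneField e (y t, ((α t).2.1, q.2))).1 = 0 := by
      have h1 : chartVector ξ (γ t, ((α t).2.1, q.2)) = 0 := (smul_eq_zero.1 hwt).resolve_left hκ
      refine (chartField_chartVector (ξ := ξ) (p := x₀)
        (z := (y t, ((α t).2.1, q.2)))).symm.trans ?_
      refine (congrArg (mfderiv (𝓡 7) 𝓘(ℝ, EuclideanSpace ℝ (Fin 7)) (extChartAt (𝓡 7) x₀)
        (γ t)) h1).trans (map_zero _)
    have e2 := h.component_coneField (z := (y t, ((α t).2.1, q.2))) hyO 0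
    rw [e1, map_zero] at e2
    exact zero_ne_one e2
  have hmem0 : (0 : ℝ) ∈ Metric.ball (0 : ℝ) r := Metric.mem_ball_self hr
  refine ⟨γ, ⟨⟨?_, ?_⟩, ?_⟩, ?_⟩
  · filter_upwards [Metric.ball_mem_nhds (0 : ℝ) hr] with t ht
    have hyO := (hball t ht).2.1
    refine ⟨?_, ?_⟩
    · have c1 : ContDiffAt ℝ ∞ y t := contDiffAt_fst.comp t (hball t ht).2.2.1
      exact (contMDiffAt_symm hyO.1).comp t c1.contMDiffAt
    · rw [hvel2 t ht]
      exact (D (γ t)).smul_mem κ (hξ.chartVector_mem hyO.2 _)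
  · filter_upwards [Ioo_mem_nhdsGT hr] with ε hε
    have hsub : Icc (-ε) ε ⊆ Metric.ball (0 : ℝ) r := by
      intro t ht
      rw [mem_ball_zero_iff, Real.norm_eq_abs]
      exact (abs_le.2 ht).trans_lt hε.2
    have hφγ : ∀ t ∈ Metric.ball (0 : ℝ) r, extChartAt (𝓡 7) x₀ (γ t) = y t := fun t ht =>
      (extChartAt (𝓡 7) x₀).right_inv (hball t ht).2.1.1
    have hlt : -ε < ε := by linarith [hε.1]
    refine isEndpointCritical_of_adjoint (p := x₀) hlt.le
      (fun t ht => (extChartAt (𝓡 7) x₀).map_target (hball t (hsub ht)).2.1.1)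
      (P := fun t => coneCovector η (α t).2.2 (α t).2.1 (y t)) ?_ ?_
    · intro hz
      have hb := hball ε (hsub (right_mem_Icc.2 hlt.le))
      have h1 := DFunLike.congr_fun hz (e 6 (y ε))
      rw [coneCovector_apply, h.dual _ hb.2.1, h.dual _ hb.2.1, h.dual _ hb.2.1,
        if_neg (by decide), if_neg (by decide), if_pos rfl] at h1
      refine hb.1.2 ?_
      simpa using h1
    · intro m ξ' U' u hU' hξ' hγU' hder t ht
      have htb := hsub ht
      have hyO := (hball t htb).2.1
      have hyU' : y t ∈ chartSet (𝓡 7) x₀ U' := ⟨hyO.1, hγU' t ht⟩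
      have hzero : ∀ z ∈ chartSet (𝓡 7) x₀ U, z ∈ chartSet (𝓡 7) x₀ U' → ∀ k : Fin 7, 4 ≤ k →
          ∀ j, η k z (chartField (𝓡 7) x₀ (ξ' j) z) = 0 := fun z hz hz' k hk j =>
        h.eq_zero_of_mem hξ hz ((hξ' j).2 _ hz'.2) hk
      have hdiff : ∀ j, DifferentiableAt ℝ (chartField (𝓡 7) x₀ (ξ' j)) (y t) := fun j =>
        ((contDiffOn_chartField hU' (hξ' j).1).contDiffAt
          ((isOpen_chartSet x₀ hU').mem_nhds hyU')).differentiableAt (by simp)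
      -- The control is frozen at time `t`. The adjoint lemma needs only an autonomous field with
      -- values in D near the point whose value there is the velocity.
      have hf : HasFDerivAt (fun z => ∑ j, u j t • chartField (𝓡 7) x₀ (ξ' j) z)
          (∑ j, u j t • fderiv ℝ (chartField (𝓡 7) x₀ (ξ' j)) (y t)) (y t) :=
        HasFDerivAt.fun_sum (fun j _ => (hdiff j).hasFDerivAt.const_smul (u j t))
      have hfy : ∑ j, u j t • chartField (𝓡 7) x₀ (ξ' j) (y t) =
          κ • ∑ j, coneCoef (α t).2.1 q.2 j • e j (y t) := by
        have hd1 := (hyd t htb).hasDerivWithinAt (s := Icc (-ε) ε)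
        have hd2 := (hder t ht).congr (fun τ hτ => (hφγ τ (hsub hτ)).symm) (hφγ t htb).symm
        rw [hφγ t htb] at hd2
        exact (uniqueDiffOn_Icc hlt t ht).eq_deriv _ hd2 hd1
      rw [hφγ t htb]
      refine ⟨fun j => ?_, ?_⟩
      · rw [coneCovector_apply, hzero _ hyO hyU' 4 le_rfl, hzero _ hyO hyU' 5 (by decide),
          hzero _ hyO hyU' 6 (by decide)]
        ring
      · have hadj := h.hasDerivWithinAt_coneCovector (y := y) (θ := fun t => (α t).2.1)
          (l := fun t => (α t).2.2) (φ := q.2) (κ := κ) (t := t) hyO (hyd t htb).hasDerivWithinAt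
          ((hθd t htb).hasDerivWithinAt (s := Icc (-ε) ε)) (hld t htb).hasDerivWithinAt
          (hball t htb).1.1 (f := fun z => ∑ j, u j t • chartField (𝓡 7) x₀ (ξ' j) z)
          hf.differentiableAt (fun k hk => by
            filter_upwards [hO.mem_nhds hyO, (isOpen_chartSet x₀ hU').mem_nhds hyU'] with z hz hz'
            rw [map_sum]
            exact Finset.sum_eq_zero fun j _ => by
              rw [map_smul, hzero z hz hz' k hk j, smul_zero]) hfy
        rw [hf.fderiv] at hadj
        exact hadj
  · filter_upwards [Metric.ball_mem_nhds (0 : ℝ) hr] with t ht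
    rw [hvel2 t ht]
    exact hw0 t ht
  · rw [hvel 0 hmem0, hu₀]
    have hγ0 : γ 0 = x₀ := by
      rw [hγ, hy]
      beta_reduce
      rw [h0]
      exact (extChartAt (𝓡 7) x₀).left_inv hx
    have hθ0 : (α 0).2.1 = q.1 := by rw [h0]
    have key : ∀ (x : X) (θ : ℝ), x = x₀ → θ = q.1 →
        (⟨x, κ • chartVector ξ (x, (θ, q.2))⟩ : TangentBundle (𝓡 7) X) =
          ⟨x₀, κ • chartVector ξ (x₀, q)⟩ := by
      rintro _ _ rfl rfl
      rfl
    exact key _ _ hγ0 hθ0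

end SingularPath

/-! ### Existence of variations with prescribed control. -/

section Control

open Metric NNReal

variable {E : Type*} [NormedAddCommGroup E] [NormedSpace ℝ E]

/-- The Grönwall estimate presupposes the tube. A continuity argument removes the circularity: while
the distance is at most `δ / 2`, Grönwall shows it is strictly smaller. -/
lemma TubeBound.norm_sub_lt {G H : ℝ → E → E} {A : ℝ → E →L[ℝ] E} {y₀ y : ℝ → E} {a b δ C s : ℝ}
    (h : TubeBound G H A y₀ a b δ C)
    (hy₀ : ∀ t ∈ Icc a b, HasDerivWithinAt y₀ (G t (y₀ t)) (Icc a b) t)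
    (hy : ∀ t ∈ Icc a b, HasDerivWithinAt y (G t (y t) + s • H t (y t)) (Icc a b) t)
    (hya : y a = y₀ a) (hs : |s| * Real.exp (C * (b - a)) < δ / 2) :
    ∀ t ∈ Icc a b, ‖y t - y₀ t‖ < δ := by
  have hδ := h.radius_pos
  have hc : ContinuousOn (fun t => ‖y t - y₀ t‖) (Icc a b) := fun t ht =>
    ((hy t ht).sub (hy₀ t ht)).continuousWithinAt.norm
  let S : Set ℝ := {t | ‖y t - y₀ t‖ ≤ δ / 2}
  have hS : Icc a b ⊆ S := by
    have hSc : IsClosed (S ∩ Icc a b) := by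
      rw [inter_comm]
      exact hc.preimage_isClosed_of_isClosed isClosed_Icc isClosed_Iic
    refine hSc.Icc_subset_of_forall_mem_nhdsGT_of_Icc_subset ?_ fun t₁ ht₁ hsub => ?_
    · change ‖y a - y₀ a‖ ≤ δ / 2
      rw [hya, sub_self, norm_zero]
      positivity
    · have hgr := h.norm_sub_le ht₁.2.le hy₀
        (fun t ht => (hy t ⟨ht.1, ht.2.trans ht₁.2.le⟩).mono (Icc_subset_Icc_right ht₁.2.le)) hya
        (fun t ht => (show ‖y t - y₀ t‖ ≤ δ / 2 from hsub ht).trans_lt (by linarith)) t₁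
        (right_mem_Icc.2 ht₁.1)
      have hnear : ∀ᶠ t in 𝓝[Icc a b] t₁, t ∈ S := by
        filter_upwards [(hc t₁ (Ico_subset_Icc_self ht₁)).eventually
          (gt_mem_nhds (hgr.trans_lt hs))] with t ht using ht.le
      exact nhdsWithin_le_of_mem (Icc_mem_nhdsGT_of_mem ht₁) hnear
  exact fun t ht => (show ‖y t - y₀ t‖ ≤ δ / 2 from hS ht).trans_lt (by linarith)

lemma norm_controlled_le {m : ℕ} {g : Fin m → E} {w : Fin m → ℝ} {M B : ℝ} (hM : 0 ≤ M)
    (hw : ∀ j, ‖w j‖ ≤ M) (hg : ∀ j, ‖g j‖ ≤ B) : ‖∑ j, w j • g j‖ ≤ m * M * B := by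
  calc ‖∑ j, w j • g j‖ ≤ ∑ j : Fin m, M * B := norm_sum_le_of_le _ fun j _ => by
        rw [norm_smul]
        exact mul_le_mul (hw j) (hg j) (norm_nonneg _) hM
    _ = m * M * B := by simp [mul_assoc]

/-- The solution of the adjoint equation with value the identity at the endpoint. -/
lemma exists_adjoint_solution [CompleteSpace E] {A : ℝ → E →L[ℝ] E} {a b N : ℝ} (hab : a ≤ b)
    (hA : ContinuousOn A (Icc a b)) (hN : ∀ t ∈ Icc a b, ‖A t‖ ≤ N) (hsmall : 3 * N * (b - a) ≤ 1) :
    ∃ P : ℝ → E →L[ℝ] E, P b = ContinuousLinearMap.id ℝ E ∧ ∀ t ∈ Icc a b,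
      ‖P t - ContinuousLinearMap.id ℝ E‖ ≤ 1 / 2 ∧
      HasDerivWithinAt P (-(P t).comp (A t)) (Icc a b) t := by
  have hN0 : 0 ≤ N := (norm_nonneg _).trans (hN a (left_mem_Icc.2 hab))
  -- In the ball of radius 1/2 about the identity one has `‖T‖ ≤ 3 / 2`, so the speed is at most `3
  -- / 2 * N`; `hsmall` says exactly that the solution cannot leave the ball. The initial time is
  -- the right endpoint `b`.
  have hpl : IsPicardLindelof (fun t (T : E →L[ℝ] E) => -T.comp (A t)) (tmin := a) (tmax := b)
      ⟨b, right_mem_Icc.2 hab⟩ (ContinuousLinearMap.id ℝ E) (1 / 2) 0 (Real.toNNReal (3 / 2 * N))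
      (Real.toNNReal N) := by
    refine ⟨fun t ht => ?_, fun T _ => ?_, fun t ht T hT => ?_, ?_⟩
    · refine LipschitzOnWith.of_dist_le_mul fun T _ T' _ => ?_
      rw [dist_neg_neg, dist_eq_norm, dist_eq_norm, ← ContinuousLinearMap.sub_comp,
        Real.coe_toNNReal _ hN0, mul_comm]
      exact (ContinuousLinearMap.opNorm_comp_le _ _).trans (by gcongr; exact hN t ht)
    · exact (continuousOn_const.clm_comp hA).neg
    · rw [norm_neg, Real.coe_toNNReal _ (by positivity)]
      refine (ContinuousLinearMap.opNorm_comp_le _ _).trans ?_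
      have h1 : ‖T‖ ≤ 3 / 2 := by
        rw [mem_closedBall, dist_eq_norm] at hT
        have h2 := norm_le_norm_add_norm_sub' T (ContinuousLinearMap.id ℝ E)
        have h3 := ContinuousLinearMap.norm_id_le (𝕜 := ℝ) (E := E)
        have h4 : ((1 / 2 : ℝ≥0) : ℝ) = 1 / 2 := by norm_num
        linarith
      gcongr
      exact hN t ht
    · rw [Real.coe_toNNReal _ (by positivity)]
      have h4 : ((1 / 2 : ℝ≥0) : ℝ) = 1 / 2 := by norm_num
      rw [h4, sub_self, max_eq_right (sub_nonneg.2 hab)]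
      simp only [NNReal.coe_zero]
      linarith
  obtain ⟨P, hPb, hP⟩ := exists_solution_mem_closedBall hpl (x := ContinuousLinearMap.id ℝ E)
    (by simp)
  refine ⟨P, hPb, fun t ht => ⟨?_, (hP t ht).2⟩⟩
  have h1 := (hP t ht).1
  rw [mem_closedBall, dist_eq_norm] at h1
  simpa using h1

/-- A trajectory can be varied by any variation of its control, and the first variation of the
endpoint is given by the adjoint equation. -/
lemma exists_variation [CompleteSpace E] {m : ℕ} {f : Fin m → E → E} {W : Set E} (hW : IsOpen W)
    (hf : ∀ j, ContDiffOn ℝ ∞ (f j) W) {x₀ : E} {R B M : ℝ} (hM : 0 ≤ M)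
    (hR : closedBall x₀ R ⊆ W)
    (hfB : ∀ x ∈ closedBall x₀ R, ∀ j, ‖f j x‖ ≤ B ∧ ‖fderiv ℝ (f j) x‖ ≤ B)
    {u v : Fin m → ℝ → ℝ} {a b : ℝ} (hab : a ≤ b)
    (hu : ∀ j, ContinuousOn (u j) (Icc a b)) (hv : ∀ j, ContinuousOn (v j) (Icc a b))
    (huM : ∀ t ∈ Icc a b, ∀ j, ‖u j t‖ ≤ M) {y : ℝ → E}
    (hyR : ∀ t ∈ Icc a b, y t ∈ closedBall x₀ (R / 2))
    (hy : ∀ t ∈ Icc a b, HasDerivWithinAt y (controlled f u t (y t)) (Icc a b) t)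
    (hsmall : m * (M + 1) * B * (b - a) ≤ R / 2)
    {P : ℝ → E →L[ℝ] E} (hPb : P b = ContinuousLinearMap.id ℝ E)
    (hP : ∀ t ∈ Icc a b, HasDerivWithinAt P
      (-(P t).comp (∑ j, u j t • fderiv ℝ (f j) (y t))) (Icc a b) t)
    {Q : ℝ → E} (hQa : Q a = 0)
    (hQ : ∀ t ∈ Icc a b, HasDerivWithinAt Q (P t (controlled f v t (y t))) (Icc a b) t) :
    ∃ Y : ℝ → ℝ → E, Y 0 = y ∧ (∀ᶠ s in 𝓝 (0 : ℝ), Y s a = y a ∧ ∀ t ∈ Icc a b, Y s t ∈ W ∧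
      HasDerivWithinAt (Y s) (∑ j, (u j t + s * v j t) • f j (Y s t)) (Icc a b) t) ∧
      HasDerivAt (fun s => Y s b) (Q b) 0 := by
  have ha : a ∈ Icc a b := left_mem_Icc.2 hab
  have hR0 : 0 ≤ R := by
    have := nonneg_of_mem_closedBall (hyR a ha)
    linarith
  have hyW : ∀ t ∈ Icc a b, y t ∈ W := fun t ht =>
    hR (closedBall_subset_closedBall (by linarith) (hyR t ht))
  obtain ⟨δ, C, hδW, hT⟩ := exists_tubeBound hW hf hu hv
    (fun t ht => (hy t ht).continuousWithinAt) hyW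
  obtain ⟨Mv, hMv⟩ : ∃ Mv : ℝ, ∀ t ∈ Icc a b, ∀ j, ‖v j t‖ ≤ Mv := by
    choose Bv hBv using fun j => isCompact_Icc.exists_bound_of_continuousOn (hv j)
    refine ⟨∑ j, |Bv j|, fun t ht j => ?_⟩
    exact ((hBv j t ht).trans (le_abs_self _)).trans
      (Finset.single_le_sum (f := fun j => |Bv j|) (fun j _ => abs_nonneg _) (Finset.mem_univ j))
  have hsum : ∀ s t x, controlled f u t x + s • controlled f v t x =
      ∑ j, (u j t + s * v j t) • f j x := fun s t x => by
    rw [controlled, controlled, Finset.smul_sum, ← Finset.sum_add_distrib]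
    exact Finset.sum_congr rfl fun j _ => by rw [add_smul, mul_smul]
  have hN0 : 0 ≤ (m : ℝ) * (M + 1) * B := by
    rcases Nat.eq_zero_or_pos m with rfl | hm
    · simp
    · have hB : 0 ≤ B := (norm_nonneg _).trans (hfB x₀ (mem_closedBall_self hR0) ⟨0, hm⟩).1
      positivity
  have hex : ∀ s : ℝ, |s| * Mv ≤ 1 → ∃ α : ℝ → E, α a = y a ∧ ∀ t ∈ Icc a b,
      α t ∈ closedBall x₀ R ∧
      HasDerivWithinAt α (∑ j, (u j t + s * v j t) • f j (α t)) (Icc a b) t := by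
    intro s hs
    have hcoef : ∀ t ∈ Icc a b, ∀ j, ‖u j t + s * v j t‖ ≤ M + 1 := fun t ht j => by
      refine (norm_add_le _ _).trans (add_le_add (huM t ht j) ?_)
      rw [norm_mul, Real.norm_eq_abs]
      exact (mul_le_mul_of_nonneg_left (hMv t ht j) (abs_nonneg s)).trans hs
    -- The start `y a` lies in the ball of radius `R / 2`, and `hsmall` bounds the distance
    -- travelled by `R / 2`. The same constant serves as Lipschitz constant and as bound for the
    -- speed.
    have hpl : IsPicardLindelof (fun t x => ∑ j, (u j t + s * v j t) • f j x) (tmin := a)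
        (tmax := b) ⟨a, ha⟩ x₀ (Real.toNNReal R) (Real.toNNReal (R / 2))
        (Real.toNNReal (m * (M + 1) * B)) (Real.toNNReal (m * (M + 1) * B)) := by
      refine ⟨fun t ht => ?_, fun x _ => ?_, fun t ht x hx => ?_, ?_⟩
      · refine LipschitzOnWith.of_dist_le_mul fun x hx x' hx' => ?_
        rw [Real.coe_toNNReal _ hR0] at hx hx'
        rw [dist_eq_norm, dist_eq_norm, Real.coe_toNNReal _ hN0, ← Finset.sum_sub_distrib]
        simp only [← smul_sub]
        rw [mul_assoc]
        refine norm_controlled_le (by positivity) (hcoef t ht) fun j => ?_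
        exact (convex_closedBall x₀ R).norm_image_sub_le_of_norm_hasFDerivWithin_le
          (fun z hz => (((hf j).contDiffAt (hW.mem_nhds (hR hz))).differentiableAt
            (by simp)).hasFDerivAt.hasFDerivWithinAt) (fun z hz => (hfB z hz j).2) hx' hx
      · exact continuousOn_finsetSum _ fun j _ =>
          ((hu j).add (continuousOn_const.mul (hv j))).smul continuousOn_const
      · rw [Real.coe_toNNReal _ hR0] at hx
        rw [Real.coe_toNNReal _ hN0]
        exact norm_controlled_le (by positivity) (hcoef t ht) fun j => (hfB x hx j).1
      · rw [Real.coe_toNNReal _ hN0, Real.coe_toNNReal _ hR0, Real.coe_toNNReal _ (by positivity),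
          sub_self, max_eq_left (sub_nonneg.2 hab)]
        linarith
    obtain ⟨α, h1, h2⟩ := exists_solution_mem_closedBall hpl (x := y a)
      (by rw [Real.coe_toNNReal _ (by positivity)]; exact hyR a ha)
    exact ⟨α, h1, fun t ht => by
      have := h2 t ht
      rwa [Real.coe_toNNReal _ hR0] at this⟩
  -- Setting the curve equal to `y` at s = 0 avoids any appeal to uniqueness. For large s the value
  -- is arbitrary, as only small s matter.
  have hex' : ∀ s : ℝ, ∃ α : ℝ → E, (s = 0 → α = y) ∧ (|s| * Mv ≤ 1 → α a = y a ∧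
      ∀ t ∈ Icc a b, α t ∈ closedBall x₀ R ∧
      HasDerivWithinAt α (∑ j, (u j t + s * v j t) • f j (α t)) (Icc a b) t) := by
    intro s
    by_cases h0 : s = 0
    · subst h0
      refine ⟨y, fun _ => rfl, fun _ => ⟨rfl, fun t ht =>
        ⟨closedBall_subset_closedBall (by linarith) (hyR t ht), ?_⟩⟩⟩
      simpa [controlled] using hy t ht
    · by_cases hs : |s| * Mv ≤ 1
      · obtain ⟨α, hα⟩ := hex s hs
        exact ⟨α, fun h => absurd h h0, fun _ => hα⟩
      · exact ⟨y, fun h => absurd h h0, fun h => absurd h hs⟩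
  choose Y hY0 hY using hex'
  have hsm1 : ∀ᶠ s : ℝ in 𝓝 0, |s| * Mv ≤ 1 := by
    have hc : Continuous fun s : ℝ => |s| * Mv := by fun_prop
    exact (hc.continuousAt.eventually (gt_mem_nhds (by simp))).mono fun s hs => le_of_lt hs
  have hsm2 : ∀ᶠ s : ℝ in 𝓝 0, |s| * Real.exp (C * (b - a)) < δ / 2 := by
    have hc : Continuous fun s : ℝ => |s| * Real.exp (C * (b - a)) := by fun_prop
    exact hc.continuousAt.eventually (gt_mem_nhds (by simp [hT.radius_pos]))
  refine ⟨Y, hY0 0 rfl, ?_, ?_⟩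
  · filter_upwards [hsm1] with s hs
    exact ⟨(hY s hs).1, fun t ht => ⟨hR ((hY s hs).2 t ht).1, ((hY s hs).2 t ht).2⟩⟩
  · have hend := hT.hasDerivAt_endpoint hab hy (y := Y) (by rw [hY0 0 rfl]) (by
      filter_upwards [hsm1, hsm2] with s hs hs2
      have hd : ∀ t ∈ Icc a b, HasDerivWithinAt (Y s)
          (controlled f u t (Y s t) + s • controlled f v t (Y s t)) (Icc a b) t := fun t ht => by
        rw [hsum]; exact ((hY s hs).2 t ht).2
      exact ⟨(hY s hs).1, fun t ht =>
        ⟨hT.norm_sub_lt hy hd (hY s hs).1 hs2 t ht, hd t ht⟩⟩) hP hQa hQ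
    rw [hPb] at hend
    exact hend

end Control

/-! ### The adjoint covector of a short critical curve. -/

section Annihilator

open Metric

variable {E : Type*} [NormedAddCommGroup E] [NormedSpace ℝ E]

lemma exists_antiderivative [CompleteSpace E] {g : ℝ → E} {a b : ℝ} (hab : a ≤ b)
    (hg : ContinuousOn g (Icc a b)) :
    ∃ Q : ℝ → E, Q a = 0 ∧ ∀ t ∈ Icc a b, HasDerivWithinAt Q (g t) (Icc a b) t :=
  ⟨ODE.picard (fun t _ => g t) a 0 (fun _ => (0 : E)), ODE.picard_apply₀, fun _ ht =>
    ODE.hasDerivWithinAt_picard_Icc (f := fun t _ => g t) (u := univ) (left_mem_Icc.2 hab)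
      (hg.comp continuous_fst.continuousOn fun z (hz : z ∈ Icc a b ×ˢ univ) => hz.1)
      continuousOn_const (fun _ _ => trivial) 0 ht⟩

/-- The endpoints of the first variations of a trajectory. -/
def variationSubmodule {m : ℕ} (f : Fin m → E → E) (P : ℝ → E →L[ℝ] E) (y : ℝ → E) (a b : ℝ) :
    Submodule ℝ E where
  carrier := {q | ∃ (v : Fin m → ℝ → ℝ) (Q : ℝ → E), (∀ j, ContinuousOn (v j) (Icc a b)) ∧ Q a = 0 ∧
    (∀ t ∈ Icc a b, HasDerivWithinAt Q (P t (controlled f v t (y t))) (Icc a b) t) ∧ Q b = q}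
  add_mem' := by
    rintro _ _ ⟨v, Q, hv, h0, hQ, rfl⟩ ⟨v', Q', hv', h0', hQ', rfl⟩
    refine ⟨fun j t => v j t + v' j t, fun t => Q t + Q' t, fun j => (hv j).add (hv' j),
      by simp [h0, h0'], fun t ht => ((hQ t ht).fun_add (hQ' t ht)).congr_deriv ?_, rfl⟩
    rw [← map_add, controlled, controlled, controlled, ← Finset.sum_add_distrib]
    simp only [add_smul]
  zero_mem' := ⟨fun _ _ => 0, fun _ => 0, fun _ => continuousOn_const, rfl, fun t _ => by
    simpa [controlled] using hasDerivWithinAt_const t (Icc a b) (0 : E), rfl⟩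
  smul_mem' := by
    rintro c _ ⟨v, Q, hv, h0, hQ, rfl⟩
    refine ⟨fun j t => c * v j t, fun t => c • Q t, fun j => continuousOn_const.mul (hv j),
      by simp [h0], fun t ht => ((hQ t ht).fun_const_smul c).congr_deriv ?_, rfl⟩
    rw [← map_smul, controlled, controlled, Finset.smul_sum]
    simp only [mul_smul]

/-- A covector annihilating all first variations of the endpoint annihilates the controlled fields
along the trajectory. -/
lemma apply_eq_zero_of_variationSubmodule_le [CompleteSpace E] {m : ℕ} {f : Fin m → E → E}
    {P : ℝ → E →L[ℝ] E}
    {y : ℝ → E} {a b : ℝ} (hab : a < b) (hP : ContinuousOn P (Icc a b))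
    (hf : ∀ j, ContinuousOn (fun t => f j (y t)) (Icc a b)) {l : E →L[ℝ] ℝ}
    (hl : ∀ q ∈ variationSubmodule f P y a b, l q = 0) :
    ∀ t ∈ Icc a b, ∀ j, l (P t (f j (y t))) = 0 := by
  have hv : ∀ j, ContinuousOn (fun t => l (P t (f j (y t)))) (Icc a b) := fun j =>
    l.continuous.comp_continuousOn (hP.clm_apply (hf j))
  -- Test with the control whose j-th component is l(P f_j) itself. Then l(Q) has derivative a sum
  -- of squares and vanishes at both ends, so every square is zero.
  obtain ⟨Q, hQa, hQ⟩ := exists_antiderivative hab.le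
    (g := fun t => P t (controlled f (fun j t => l (P t (f j (y t)))) t (y t)))
    (hP.clm_apply (continuousOn_finsetSum _ fun j _ => (hv j).smul (hf j)))
  have hg : ∀ t ∈ Icc a b, HasDerivWithinAt (fun t => l (Q t))
      (∑ j, l (P t (f j (y t))) ^ 2) (Icc a b) t := fun t ht =>
    (l.hasFDerivAt.comp_hasDerivWithinAt t (hQ t ht)).congr_deriv (by
      simp only [controlled, map_sum, map_smul, smul_eq_mul, pow_two])
  have hQb : l (Q b) = 0 := hl _ ⟨_, Q, hv, hQa, hQ, rfl⟩
  have hmono : MonotoneOn (fun t => l (Q t)) (Icc a b) := by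
    refine monotoneOn_of_hasDerivWithinAt_nonneg (convex_Icc a b)
      (fun t ht => (hg t ht).continuousWithinAt)
      (fun t ht => (hg t (interior_subset ht)).mono interior_subset)
      fun t _ => Finset.sum_nonneg fun j _ => sq_nonneg _
  have hzero : ∀ t ∈ Icc a b, l (Q t) = 0 := fun t ht => by
    have h1 := hmono (left_mem_Icc.2 hab.le) ht ht.1
    have h2 := hmono ht (right_mem_Icc.2 hab.le) ht.2
    simp only [hQa, hQb, map_zero] at h1 h2
    exact le_antisymm h2 h1
  intro t ht j
  have h0 : HasDerivWithinAt (fun t => l (Q t)) 0 (Icc a b) t :=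
    (hasDerivWithinAt_const t (Icc a b) (0 : ℝ)).congr hzero (hzero t ht)
  have hs := (uniqueDiffOn_Icc hab t ht).eq_deriv _ (hg t ht) h0
  have := (Finset.sum_eq_zero_iff_of_nonneg fun j _ => sq_nonneg _).1 hs j (Finset.mem_univ j)
  exact pow_eq_zero_iff two_ne_zero |>.1 this

variable {H : Type*} [TopologicalSpace H]
  {I : ModelWithCorners ℝ E H} {M : Type*} [TopologicalSpace M] [ChartedSpace H M]
  [IsManifold I ∞ M] {p : M}

lemma velocity_symm [I.Boundaryless] {c : ℝ → E} {t : ℝ} {x : M} {w : TangentSpace I x}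
    (hx : x ∈ (extChartAt I p).source) (hct : c t = extChartAt I p x)
    (hc : HasDerivAt c (mfderiv I 𝓘(ℝ, E) (extChartAt I p) x w) t) :
    MDifferentiableAt 𝓘(ℝ, ℝ) I (fun τ => (extChartAt I p).symm (c τ)) t ∧
      velocity I (fun τ => (extChartAt I p).symm (c τ)) t = ⟨x, w⟩ := by
  have hmem : c t ∈ (extChartAt I p).target := hct ▸ (extChartAt I p).map_source hx
  obtain rfl : x = (extChartAt I p).symm (c t) := by rw [hct, (extChartAt I p).left_inv hx]
  have h1 := hasMFDerivWithinAt_univ.1 (hasMFDerivWithinAt_symm hmem hc.hasDerivWithinAt)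
  exact ⟨h1.mdifferentiableAt, velocity_eq h1⟩

/-- Along a short critical trajectory there is a nowhere zero solution of the adjoint equation
annihilating the controlled fields. -/
theorem IsEndpointCritical.exists_adjoint [FiniteDimensional ℝ E] [I.Boundaryless]
    {Δ : Π x : M, Submodule ℝ (TangentSpace I x)} {γ : ℝ → M} {a b : ℝ}
    (hcrit : IsEndpointCritical I Δ γ a b) (hab : a < b) {m : ℕ}
    {ξ : Fin m → Π x : M, TangentSpace I x} {U : Set M} (hU : IsOpen U)
    (hξ : ∀ j, ξ j ∈ sectionsOn I Δ U) {u : Fin m → ℝ → ℝ}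
    (hu : ∀ j, ContinuousOn (u j) (Icc a b))
    (hγ : ∀ t ∈ Icc a b, γ t ∈ (extChartAt I p).source)
    (hy : ∀ t ∈ Icc a b, HasDerivWithinAt (fun t => extChartAt I p (γ t))
      (controlled (fun j => chartField I p (ξ j)) u t (extChartAt I p (γ t))) (Icc a b) t)
    {x₀ : E} {R B K : ℝ} (hK : 0 ≤ K) (hR : closedBall x₀ R ⊆ chartSet I p U)
    (hfB : ∀ x ∈ closedBall x₀ R, ∀ j, ‖chartField I p (ξ j) x‖ ≤ B ∧
      ‖fderiv ℝ (chartField I p (ξ j)) x‖ ≤ B)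
    (huK : ∀ t ∈ Icc a b, ∀ j, ‖u j t‖ ≤ K)
    (hyR : ∀ t ∈ Icc a b, extChartAt I p (γ t) ∈ closedBall x₀ (R / 2))
    (hsmall : m * (K + 1) * B * (b - a) ≤ R / 2) (hsmall' : 3 * (m * K * B) * (b - a) ≤ 1) :
    ∃ P : ℝ → E →L[ℝ] ℝ, ∀ t ∈ Icc a b, P t ≠ 0 ∧
      (∀ j, P t (chartField I p (ξ j) (extChartAt I p (γ t))) = 0) ∧
      HasDerivWithinAt P (-(P t).comp
        (∑ j, u j t • fderiv ℝ (chartField I p (ξ j)) (extChartAt I p (γ t)))) (Icc a b) t := by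
  have : CompleteSpace E := FiniteDimensional.complete ℝ E
  have hbm : b ∈ Icc a b := right_mem_Icc.2 hab.le
  obtain ⟨y, hyγ⟩ : ∃ y : ℝ → E, y = fun t => extChartAt I p (γ t) := ⟨_, rfl⟩
  obtain ⟨f, hff⟩ : ∃ f : Fin m → E → E, f = fun j => chartField I p (ξ j) := ⟨_, rfl⟩
  have hyt : ∀ t, extChartAt I p (γ t) = y t := fun t => by rw [hyγ]
  have hfj : ∀ j, chartField I p (ξ j) = f j := fun j => by rw [hff]
  simp only [hyt, hfj] at hy hfB hyR ⊢
  have hfs : ∀ j, ContDiffOn ℝ ∞ (f j) (chartSet I p U) := fun j => by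
    rw [hff]; exact contDiffOn_chartField hU (hξ j).1
  have hO : IsOpen (chartSet I p U) := isOpen_chartSet p hU
  have hyO : ∀ t ∈ Icc a b, y t ∈ chartSet I p U := fun t ht => by
    have h1 := nonneg_of_mem_closedBall (hyR t ht)
    exact hR (closedBall_subset_closedBall (by linarith) (hyR t ht))
  have hyc : ContinuousOn y (Icc a b) := fun t ht => (hy t ht).continuousWithinAt
  have hDc : ∀ j, ContinuousOn (fun t => fderiv ℝ (f j) (y t)) (Icc a b) := fun j =>
    ((hfs j).continuousOn_fderiv_of_isOpen hO (by simp)).comp hyc hyO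
  obtain ⟨T, hTb, hT⟩ := exists_adjoint_solution (A := fun t => ∑ j, u j t • fderiv ℝ (f j) (y t))
    (N := m * K * B) hab.le (continuousOn_finsetSum _ fun j _ => (hu j).smul (hDc j))
    (fun t ht => norm_controlled_le hK (huK t ht) fun j => (hfB _ (by
      have h1 := nonneg_of_mem_closedBall (hyR t ht)
      exact closedBall_subset_closedBall (by linarith) (hyR t ht)) j).2) hsmall'
  have hTc : ContinuousOn T (Icc a b) := fun t ht => (hT t ht).2.continuousWithinAt
  -- Each element of this subspace is the endpoint derivative of an actual variation, since `T` is
  -- the identity at `b`. If the subspace were everything, the curve would not be critical.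
  have hne : variationSubmodule f T y a b ≠ ⊤ := by
    intro htop
    refine hcrit (eq_univ_of_forall fun w => ?_)
    obtain ⟨v, Q, hv, hQa, hQ, hQb⟩ : (mfderiv I 𝓘(ℝ, E) (extChartAt I p) (γ b) w : E) ∈
      variationSubmodule f T y a b := by rw [htop]; trivial
    obtain ⟨Y, hY0, hY, hYb⟩ := exists_variation hO hfs hK hR hfB hab.le hu hv huK hyR hy hsmall
      hTb (fun t ht => (hT t ht).2) hQa hQ
    rw [hQb] at hYb
    have hvel := velocity_symm (c := fun s => Y s b) (hγ b hbm) (by rw [hY0, hyγ]) hYb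
    refine ⟨fun s t => (extChartAt I p).symm (Y s t), ⟨m, ξ, U, u, v, hU, hξ,
      fun j => ⟨hu j, hv j⟩, fun t ht => ?_, ?_⟩, hvel.1, hvel.2⟩
    · beta_reduce
      rw [hY0, hyγ]
      exact (extChartAt I p).left_inv (hγ t ht)
    · filter_upwards [hY] with s ⟨hsa, hs⟩
      refine ⟨?_, fun t ht => ⟨(hs t ht).1.2, hasMFDerivWithinAt_symm (hs t ht).1.1 ?_⟩⟩
      · rw [hsa, hyγ]
        exact (extChartAt I p).left_inv (hγ a (left_mem_Icc.2 hab.le))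
      · refine (hs t ht).2.congr_deriv ?_
        refine Eq.symm ((chartField_sum ξ (fun j => u j t + s * v j t)
          ((extChartAt I p).map_target (hs t ht).1.1)).trans ?_)
        rw [(extChartAt I p).right_inv (hs t ht).1.1]
        simp only [hfj]
        rfl
  obtain ⟨l₀, hl0, hl⟩ := Submodule.exists_le_ker_of_lt_top _ (lt_top_iff_ne_top.2 hne)
  set l : E →L[ℝ] ℝ := LinearMap.toContinuousLinearMap l₀ with hldef
  have hlne : l ≠ 0 := fun h => hl0 ((LinearMap.toContinuousLinearMap (𝕜 := ℝ)).map_eq_zero_iff.1 h)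
  have hann := apply_eq_zero_of_variationSubmodule_le hab hTc
    (fun j => (hfs j).continuousOn.comp hyc hyO) (l := l) (fun q hq => hl hq)
  refine ⟨fun t => l.comp (T t), fun t ht => ⟨fun h0 => ?_, hann t ht, ?_⟩⟩
  · have h1 : ‖l.comp (T t - ContinuousLinearMap.id ℝ E)‖ ≤ ‖l‖ * (1 / 2) :=
      (l.opNorm_comp_le _).trans (by gcongr; exact (hT t ht).1)
    rw [ContinuousLinearMap.comp_sub, show l.comp (T t) = 0 from h0, ContinuousLinearMap.comp_id, zero_sub, norm_neg] at h1
    have := norm_pos_iff.2 hlne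
    linarith
  · have h1 := (((ContinuousLinearMap.compL ℝ E E ℝ) l).hasFDerivAt.comp_hasDerivWithinAt t
      (hT t ht).2)
    refine h1.congr_deriv ?_
    ext v
    simp

end Annihilator

/-! ### The obstruction vanishes along annihilating adjoint covectors. -/

section Rigidity

open VectorField Metric

variable {E : Type*} [NormedAddCommGroup E] [NormedSpace ℝ E]
  {e : Fin 7 → E → E} {η : Fin 7 → E → E →L[ℝ] ℝ} {O : Set E}

/-- The derivatives of the components of a solution of the adjoint equation. -/
lemma IsCoframe.hasDerivWithinAt_apply_frame {n : ℕ} {e : Fin n → E → E}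
    {η : Fin n → E → E →L[ℝ] ℝ} (h : IsCoframe e η O) {P : ℝ → E →L[ℝ] ℝ} {y : ℝ → E}
    {u : Fin n → ℝ} {S : Set ℝ} {t : ℝ} (hyO : y t ∈ O)
    (hy : HasDerivWithinAt y (∑ j, u j • e j (y t)) S t)
    (hP : HasDerivWithinAt P (-(P t).comp (∑ j, u j • fderiv ℝ (e j) (y t))) S t) (i : Fin n) :
    HasDerivWithinAt (fun t => P t (e i (y t)))
      (∑ k, P t (e k (y t)) * ∑ j, u j * structureFun e η j i k (y t)) S t := by
  have h1 := hP.clm_apply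
    ((h.differentiableAt_frame hyO i).hasFDerivAt.comp_hasDerivWithinAt t hy)
  refine h1.congr_deriv ?_
  have h2 : ∀ j, P t (lieBracket ℝ (e j) (e i) (y t)) =
      ∑ k, structureFun e η j i k (y t) * P t (e k (y t)) := by
    intro j
    conv_lhs => rw [← h.expand (y t) hyO (lieBracket ℝ (e j) (e i) (y t))]
    simp only [map_sum, map_smul, smul_eq_mul, structureFun]
  have h3 : ∑ k, P t (e k (y t)) * ∑ j, u j * structureFun e η j i k (y t) =
      ∑ j, u j * P t (lieBracket ℝ (e j) (e i) (y t)) := by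
    simp only [h2, Finset.mul_sum]
    rw [Finset.sum_comm]
    exact Finset.sum_congr rfl fun j _ => Finset.sum_congr rfl fun k _ => by ring
  rw [h3]
  simp only [lieBracket, neg_apply, ContinuousLinearMap.comp_apply, sum_apply, smul_apply, map_sum,
    map_smul, smul_eq_mul, map_sub, mul_sub, Finset.sum_sub_distrib, Function.comp_apply]
  ring

/-- A nowhere zero solution of the adjoint equation annihilating `e 0, ..., e 3` forces the
obstruction to vanish. -/
lemma IsAdaptedCoframe.obstruction_eq_zero (h : IsAdaptedCoframe e η O) {P : ℝ → E →L[ℝ] ℝ}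
    {y : ℝ → E} {u : Fin 7 → ℝ → ℝ} {a b θ φ κ : ℝ} (hab : a < b) (h0 : (0 : ℝ) ∈ Icc a b)
    (hyO : ∀ t ∈ Icc a b, y t ∈ O)
    (hy : ∀ t ∈ Icc a b, HasDerivWithinAt y (∑ j, u j t • e j (y t)) (Icc a b) t)
    (hP : ∀ t ∈ Icc a b, HasDerivWithinAt P
      (-(P t).comp (∑ j, u j t • fderiv ℝ (e j) (y t))) (Icc a b) t)
    (hP0 : P 0 ≠ 0) (hPe : ∀ t ∈ Icc a b, ∀ j, j < 4 → P t (e j (y t)) = 0)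
    (hu : ∀ t ∈ Icc a b, ∀ j, 4 ≤ j → u j t = 0) (hu0 : ∀ t ∈ Icc a b, u 0 t ≠ 0)
    (hκ : κ ≠ 0) (huκ : ∀ j, u j 0 = κ * coneCoef θ φ j) :
    obstruction e η θ φ (y 0) = 0 := by
  have hd := fun t ht i => h.hasDerivWithinAt_apply_frame (hyO t ht) (hy t ht) (hP t ht) i
  have hsum : ∀ t ∈ Icc a b, ∀ i, ∑ k, P t (e k (y t)) *
      ∑ j, u j t * structureFun e η j i k (y t) =
      P t (e 4 (y t)) * ∑ j, u j t * structureFun e η j i 4 (y t) +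
      P t (e 5 (y t)) * ∑ j, u j t * structureFun e η j i 5 (y t) +
      P t (e 6 (y t)) * ∑ j, u j t * structureFun e η j i 6 (y t) := by
    intro t ht i
    rw [Fin.sum_univ_seven, hPe t ht 0 (by decide), hPe t ht 1 (by decide),
      hPe t ht 2 (by decide), hPe t ht 3 (by decide)]
    ring
  have hrel : ∀ t ∈ Icc a b, u 0 t * P t (e 4 (y t)) + u 1 t * P t (e 5 (y t)) = 0 ∧
      u 0 t * P t (e 5 (y t)) + u 1 t * P t (e 6 (y t)) = 0 := by
    intro t ht
    have hz : ∀ i : Fin 7, i < 4 → P t (e 4 (y t)) * ∑ j, u j t * structureFun e η j i 4 (y t) +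
      P t (e 5 (y t)) * ∑ j, u j t * structureFun e η j i 5 (y t) +
      P t (e 6 (y t)) * ∑ j, u j t * structureFun e η j i 6 (y t) = 0 := by
      intro i hi
      have h1 := hd t ht i
      rw [hsum t ht i] at h1
      exact (uniqueDiffOn_Icc hab t ht).eq_deriv _ h1 ((hasDerivWithinAt_const t (Icc a b)
        (0 : ℝ)).congr (fun τ hτ => hPe τ hτ i hi) (hPe t ht i hi))
    -- The bracket pairing is evaluated on a single frame vector by taking `w` to be an indicator.
    have hS : ∀ i k : Fin 7, ∑ j, ∑ i', u j t * (if i' = i then 1 else 0) *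
        structureFun e η j i' k (y t) = ∑ j, u j t * structureFun e η j i k (y t) := by
      intro i k
      refine Finset.sum_congr rfl fun j _ => ?_
      simp
    have hs := fun i : Fin 7 => h.sum_structureFun (hyO t ht) (v := fun j => u j t)
      (w := fun i' => if i' = i then 1 else 0) (hu t ht 4 le_rfl) (hu t ht 5 (by decide))
      (hu t ht 6 (by decide))
    simp only [hS] at hs
    have s2 := hs 2
    have s3 := hs 3
    have z2 := hz 2 (by decide)
    have z3 := hz 3 (by decide)
    rw [s2.1, s2.2.1, s2.2.2] at z2
    rw [s3.1, s3.2.1, s3.2.2] at z3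
    simp +decide only [if_true, if_false] at z2 z3
    constructor <;> linarith
  -- The velocity need not lie on the cone except at time 0, so the ratio u1 / u0 is eliminated
  -- between the two relations. The resulting identity holds on the whole interval and can be
  -- differentiated.
  have hquad : ∀ t ∈ Icc a b,
      P t (e 4 (y t)) * P t (e 6 (y t)) - P t (e 5 (y t)) * P t (e 5 (y t)) = 0 := by
    intro t ht
    obtain ⟨r1, r2⟩ := hrel t ht
    refine (mul_eq_zero.1 ?_).resolve_left (hu0 t ht)
    linear_combination P t (e 6 (y t)) * r1 - P t (e 5 (y t)) * r2
  have hdq := (((hd 0 h0 4).fun_mul (hd 0 h0 6)).fun_sub ((hd 0 h0 5).fun_mul (hd 0 h0 5)))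
  have hq0 := (uniqueDiffOn_Icc hab 0 h0).eq_deriv _ hdq ((hasDerivWithinAt_const 0 (Icc a b)
    (0 : ℝ)).congr hquad (hquad 0 h0))
  obtain ⟨r1, r2⟩ := hrel 0 h0
  have c0 : coneCoef θ φ 0 = 1 := rfl
  have c1 : coneCoef θ φ 1 = θ := rfl
  rw [huκ 0, huκ 1, c0, c1] at r1 r2
  have l5 : P 0 (e 5 (y 0)) = -θ * P 0 (e 6 (y 0)) := by
    refine mul_left_cancel₀ hκ ?_
    linarith
  have l4 : P 0 (e 4 (y 0)) = θ ^ 2 * P 0 (e 6 (y 0)) := by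
    refine mul_left_cancel₀ hκ ?_
    rw [l5] at r1
    linarith
  have l6 : P 0 (e 6 (y 0)) ≠ 0 := by
    intro h6
    refine hP0 (ContinuousLinearMap.ext fun v => ?_)
    rw [← h.expand (y 0) (hyO 0 h0) v, Fin.sum_univ_seven]
    simp only [map_add, map_smul, l4, l5, h6, hPe 0 h0 0 (by decide), hPe 0 h0 1 (by decide),
      hPe 0 h0 2 (by decide), hPe 0 h0 3 (by decide)]
    simp
  have hdr : ∀ i, ∑ k, P 0 (e k (y 0)) * ∑ j, u j 0 * structureFun e η j i k (y 0) =
      κ * P 0 (e 6 (y 0)) * drift e η i θ φ (y 0) := by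
    intro i
    rw [hsum 0 h0 i, drift_eq, l4, l5]
    simp only [huκ, mul_assoc, ← Finset.mul_sum]
    ring
  rw [hdr 4, hdr 5, hdr 6, l4, l5] at hq0
  -- At time 0 one has p4 = θ² p6, p5 = -θ p6, and p_i' = κ p6 times the i-th drift, so the
  -- derivative of p4 p6 - p5² is κ p6² times the obstruction.
  have hfin : κ * P 0 (e 6 (y 0)) ^ 2 * obstruction e η θ φ (y 0) = 0 := by
    rw [obstruction]
    linear_combination hq0
  exact (mul_eq_zero.1 hfin).resolve_left (mul_ne_zero hκ (pow_ne_zero 2 l6))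

end Rigidity

/-! ### The obstruction vanishes at velocities of singular curves on the cone. -/

section NoSingularCurve

open Metric

variable {X : Type*} [TopologicalSpace X] [ChartedSpace (EuclideanSpace ℝ (Fin 7)) X]
  [IsManifold (𝓡 7) ∞ X] {D : Π x : X, Submodule ℝ (TangentSpace (𝓡 7) x)} {U : Set X}
  {ξ : Fin 4 → Π x : X, TangentSpace (𝓡 7) x} {p : X}
  {η : Fin 7 → EuclideanSpace ℝ (Fin 7) → EuclideanSpace ℝ (Fin 7) →L[ℝ] ℝ}

lemma IsCoframe.eq_zero_of_mem_source
    (h : IsCoframe (frameRep p ξ) η (chartSet (𝓡 7) p U)) (hξ : IsAdaptedFrameOn D U ξ)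
    {x : X} (hx : x ∈ (extChartAt (𝓡 7) p).source) (hxU : x ∈ U)
    {w : TangentSpace (𝓡 7) x} (hw : w ∈ D x) {k : Fin 7} (hk : 4 ≤ k) :
    η k (extChartAt (𝓡 7) p x)
      (mfderiv (𝓡 7) 𝓘(ℝ, EuclideanSpace ℝ (Fin 7)) (extChartAt (𝓡 7) p) x w) = 0 := by
  obtain ⟨y, hy, rfl⟩ : ∃ y ∈ chartSet (𝓡 7) p U, (extChartAt (𝓡 7) p).symm y = x :=
    ⟨_, mem_chartSet_of_mem hx hxU, (extChartAt (𝓡 7) p).left_inv hx⟩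
  exact (congrArg (fun z => η k z (mfderiv (𝓡 7) 𝓘(ℝ, EuclideanSpace ℝ (Fin 7))
    (extChartAt (𝓡 7) p) ((extChartAt (𝓡 7) p).symm y) w))
    ((extChartAt (𝓡 7) p).right_inv hy.1)).trans (h.eq_zero_of_mem hξ hy hw hk)

/-- A neighbourhood on which finitely many smooth fields and their derivatives are bounded. -/
lemma exists_closedBall_bound {E : Type*} [NormedAddCommGroup E] [NormedSpace ℝ E] {m : ℕ}
    {f : Fin m → E → E} {W : Set E} (hW : IsOpen W) (hf : ∀ j, ContDiffOn ℝ ∞ (f j) W) {x₀ : E}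
    (hx₀ : x₀ ∈ W) : ∃ R > 0, ∃ B, 0 ≤ B ∧ closedBall x₀ R ⊆ W ∧
      ∀ x ∈ closedBall x₀ R, ∀ j, ‖f j x‖ ≤ B ∧ ‖fderiv ℝ (f j) x‖ ≤ B := by
  let B : ℝ := ∑ j, (‖f j x₀‖ + ‖fderiv ℝ (f j) x₀‖) + 1
  have hle : ∀ j, ‖f j x₀‖ + ‖fderiv ℝ (f j) x₀‖ < B := fun j =>
    (Finset.single_le_sum (f := fun j => ‖f j x₀‖ + ‖fderiv ℝ (f j) x₀‖)
      (fun j _ => by positivity) (Finset.mem_univ j)).trans_lt (lt_add_one _)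
  have hev : ∀ᶠ x in 𝓝 x₀, x ∈ W ∧ ∀ j, ‖f j x‖ ≤ B ∧ ‖fderiv ℝ (f j) x‖ ≤ B := by
    refine (hW.eventually_mem hx₀).and (eventually_all.2 fun j => ?_)
    have c1 : ContinuousAt (f j) x₀ := ((hf j).contDiffAt (hW.mem_nhds hx₀)).continuousAt
    have c2 : ContinuousAt (fderiv ℝ (f j)) x₀ :=
      (((hf j).fderiv_of_isOpen (m := ∞) hW (by simp)).contDiffAt (hW.mem_nhds hx₀)).continuousAt
    have h1 := hle j
    have b1 : ‖f j x₀‖ < B := by linarith [norm_nonneg (fderiv ℝ (f j) x₀)]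
    have b2 : ‖fderiv ℝ (f j) x₀‖ < B := by linarith [norm_nonneg (f j x₀)]
    filter_upwards [c1.norm.eventually (gt_mem_nhds b1), c2.norm.eventually (gt_mem_nhds b2)]
      with x hx hx'
    exact ⟨hx.le, hx'.le⟩
  obtain ⟨R, hR, hball⟩ := Metric.nhds_basis_closedBall.eventually_iff.1 hev
  exact ⟨R, hR, B, by positivity, fun x hx => (hball hx).1, fun x hx => (hball hx).2⟩

lemma sum_fin_seven_eq {G : Type*} [AddCommMonoid G] (g : Fin 7 → G) (hg : ∀ k, 4 ≤ k → g k = 0) :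
    ∑ k, g k = ∑ j : Fin 4, g (Fin.castLE (by decide) j) := by
  rw [Fin.sum_univ_seven, Fin.sum_univ_four, hg 4 le_rfl, hg 5 (by decide), hg 6 (by decide),
    add_zero, add_zero, add_zero]
  rfl

/-- A singular curve cannot have a velocity at which the obstruction is nonzero. -/
theorem IsSingularCurve.obstruction_eq_zero {x₀ : X} {u₀ : TangentSpace (𝓡 7) x₀} {q : ℝ × ℝ}
    {κ : ℝ} {γ : ℝ → X} (hγ : IsSingularCurve (𝓡 7) D γ) (hvel : velocity (𝓡 7) γ 0 = ⟨x₀, u₀⟩)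
    (hU : IsOpen U) (hxU : x₀ ∈ U) (hξ : IsAdaptedFrameOn D U ξ) (hκ : κ ≠ 0)
    (hu₀ : u₀ = κ • chartVector ξ (x₀, q))
    (h : IsAdaptedCoframe (frameRep x₀ ξ) η (chartSet (𝓡 7) x₀ U)) :
    obstruction (frameRep x₀ ξ) η q.1 q.2 (extChartAt (𝓡 7) x₀ x₀) = 0 := by
  have hx : x₀ ∈ (extChartAt (𝓡 7) x₀).source := mem_extChartAt_source x₀
  have hO := h.isOpen
  have hγ0 : γ 0 = x₀ := (Bundle.TotalSpace.mk.inj hvel).1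
  have hsec : ∀ j, ξ j ∈ sectionsOn (𝓡 7) D U := fun j => ⟨hξ.1.1 j, fun x hx => by
    rw [← (hξ.1.2 x hx).2]; exact Submodule.subset_span ⟨j, rfl⟩⟩
  obtain ⟨y, hyγ⟩ : ∃ y : ℝ → EuclideanSpace ℝ (Fin 7),
    y = fun t => extChartAt (𝓡 7) x₀ (γ t) := ⟨_, rfl⟩
  have hyt : ∀ t, extChartAt (𝓡 7) x₀ (γ t) = y t := fun t => by rw [hyγ]
  have hy0 : y 0 = extChartAt (𝓡 7) x₀ x₀ := by rw [hyγ, ← hγ0]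
  have hγc : ContinuousAt γ 0 := hγ.1.self_of_nhds.1.continuousAt
  have hmem : ∀ᶠ t in 𝓝 (0 : ℝ), γ t ∈ (extChartAt (𝓡 7) x₀).source ∧ γ t ∈ U :=
    (hγc.eventually (by rw [hγ0]; exact (isOpen_extChartAt_source x₀).mem_nhds hx)).and
      (hγc.eventually (by rw [hγ0]; exact hU.mem_nhds hxU))
  obtain ⟨r, hr, hball⟩ := Metric.eventually_nhds_iff_ball.1 (hγ.1.and hmem)
  have hyO : ∀ t ∈ ball (0 : ℝ) r, y t ∈ chartSet (𝓡 7) x₀ U := fun t ht => by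
    rw [← hyt]; exact mem_chartSet_of_mem (hball t ht).2.1 (hball t ht).2.2
  have hys : ContDiffOn ℝ ∞ y (ball 0 r) := fun t ht => by
    rw [hyγ]
    exact (contMDiffAt_iff_contDiffAt.1
      ((contMDiffAt_chart (hball t ht).2.1).comp t (hball t ht).1.1)).contDiffWithinAt
  have hyd : ∀ t ∈ ball (0 : ℝ) r, HasDerivAt y (mfderiv (𝓡 7) 𝓘(ℝ, EuclideanSpace ℝ (Fin 7))
      (extChartAt (𝓡 7) x₀) (γ t) (velocity (𝓡 7) γ t).2) t := fun t ht => by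
    rw [hyγ]
    exact hasDerivAt_chart_of_velocity ((hball t ht).1.1.mdifferentiableAt (by simp)) rfl
      (hball t ht).2.1
  have hdc : ContinuousOn (deriv y) (ball 0 r) :=
    hys.continuousOn_deriv_of_isOpen isOpen_ball (by simp)
  have hyc : ContinuousOn y (ball 0 r) := hys.continuousOn
  -- The control is read off from the curve by the coframe. It is continuous, and its last three
  -- components vanish because the curve is tangent to D.
  let u : Fin 7 → ℝ → ℝ := fun j t => η j (y t) (deriv y t)
  have huc : ∀ j, ContinuousOn (u j) (ball 0 r) := fun j =>
    (((h.smooth_coframe j).continuousOn.comp hyc hyO)).clm_apply hdc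
  have hu4 : ∀ t ∈ ball (0 : ℝ) r, ∀ j, 4 ≤ j → u j t = 0 := fun t ht j hj => by
    have h1 := h.eq_zero_of_mem_source hξ (hball t ht).2.1 (hball t ht).2.2 (hball t ht).1.2 hj
    have h2 : u j t = η j (y t) (mfderiv (𝓡 7) 𝓘(ℝ, EuclideanSpace ℝ (Fin 7))
      (extChartAt (𝓡 7) x₀) (γ t) (velocity (𝓡 7) γ t).2) := congrArg (η j (y t)) (hyd t ht).deriv
    rw [h2, ← hyt]
    exact h1
  have hyu : ∀ t ∈ ball (0 : ℝ) r, HasDerivAt y (∑ j, u j t • frameRep x₀ ξ j (y t)) t :=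
    fun t ht => by
    rw [h.expand (y t) (hyO t ht)]
    exact (hyd t ht).differentiableAt.hasDerivAt
  have h0 : (0 : ℝ) ∈ ball (0 : ℝ) r := mem_ball_self hr
  have huκ : ∀ j, u j 0 = κ * coneCoef q.1 q.2 j := by
    have hd0 : HasDerivAt y (κ • (coneField (frameRep x₀ ξ)
        (extChartAt (𝓡 7) x₀ x₀, q)).1) 0 := by
      have h1 := hasDerivAt_chart_of_velocity ((hball 0 h0).1.1.mdifferentiableAt (by simp)) hvel hx
      rw [← hyγ, hu₀] at h1
      refine h1.congr_deriv ((map_smul _ _ _).trans ?_)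
      refine congrArg (κ • ·) ?_
      have h2 := chartField_chartVector (ξ := ξ) (p := x₀) (z := (extChartAt (𝓡 7) x₀ x₀, q))
      have key : ∀ x : X, x = x₀ →
          (mfderiv (𝓡 7) 𝓘(ℝ, EuclideanSpace ℝ (Fin 7)) (extChartAt (𝓡 7) x₀) x
            (chartVector ξ (x, q)) : EuclideanSpace ℝ (Fin 7)) =
          mfderiv (𝓡 7) 𝓘(ℝ, EuclideanSpace ℝ (Fin 7)) (extChartAt (𝓡 7) x₀) x₀
            (chartVector ξ (x₀, q)) := by
        rintro _ rfl; rfl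
      exact (key _ ((extChartAt (𝓡 7) x₀).left_inv hx)).symm.trans h2
    intro j
    change η j (y 0) (deriv y 0) = _
    rw [hd0.deriv, map_smul, smul_eq_mul, hy0]
    rw [h.component_coneField (z := (extChartAt (𝓡 7) x₀ x₀, q)) (hy0 ▸ hyO 0 h0) j]
  have hfs : ∀ j, ContDiffOn ℝ ∞ (chartField (𝓡 7) x₀ (ξ j)) (chartSet (𝓡 7) x₀ U) := fun j =>
    contDiffOn_chartField hU (hsec j).1
  obtain ⟨R, hR, B, hB, hRW, hfB⟩ := exists_closedBall_bound hO hfs (hyO 0 h0)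
  obtain ⟨K, hK0, hK⟩ : ∃ K, 0 ≤ K ∧ ∀ᶠ t in 𝓝 (0 : ℝ), ∀ j, ‖u j t‖ ≤ K := by
    refine ⟨∑ j, ‖u j 0‖ + 1, by positivity, eventually_all.2 fun j => ?_⟩
    have hj := Finset.single_le_sum (f := fun j => ‖u j 0‖) (fun j _ => norm_nonneg _)
      (Finset.mem_univ j)
    filter_upwards [(((huc j).continuousAt (ball_mem_nhds _ hr)).norm).eventually
      (gt_mem_nhds (hj.trans_lt (lt_add_one _)))] with t ht using ht.le
  have hu0 : ∀ᶠ t in 𝓝 (0 : ℝ), u 0 t ≠ 0 :=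
    ((huc 0).continuousAt (ball_mem_nhds _ hr)).eventually_ne (by
      rw [huκ 0]; exact mul_ne_zero hκ one_ne_zero)
  have hyR : ∀ᶠ t in 𝓝 (0 : ℝ), y t ∈ closedBall (y 0) (R / 2) :=
    (hyc.continuousAt (ball_mem_nhds _ hr)).eventually (closedBall_mem_nhds _ (by positivity))
  have hrev : ∀ᶠ t in 𝓝 (0 : ℝ), t ∈ ball (0 : ℝ) r := ball_mem_nhds 0 hr
  obtain ⟨r', hr', hball'⟩ := Metric.eventually_nhds_iff_ball.1
    (hrev.and (hK.and (hu0.and hyR)))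
  have hs1 : ∀ᶠ ε : ℝ in 𝓝[>] 0, ((4 : ℕ) : ℝ) * (K + 1) * B * (ε - -ε) ≤ R / 2 := by
    have hc : Continuous fun ε : ℝ => ((4 : ℕ) : ℝ) * (K + 1) * B * (ε - -ε) := by fun_prop
    exact ((hc.continuousAt.eventually (gt_mem_nhds (by simpa using hR))).mono
      fun ε hε => le_of_lt hε).filter_mono nhdsWithin_le_nhds
  have hs2 : ∀ᶠ ε : ℝ in 𝓝[>] 0, 3 * (((4 : ℕ) : ℝ) * K * B) * (ε - -ε) ≤ 1 := by
    have hc : Continuous fun ε : ℝ => 3 * (((4 : ℕ) : ℝ) * K * B) * (ε - -ε) := by fun_prop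
    exact ((hc.continuousAt.eventually (gt_mem_nhds (by simp))).mono
      fun ε hε => le_of_lt hε).filter_mono nhdsWithin_le_nhds
  have hIoo : ∀ᶠ ε in 𝓝[>] (0 : ℝ), ε ∈ Ioo 0 r' := Ioo_mem_nhdsGT hr'
  -- One sufficiently short interval suffices: it is critical, lies where all bounds hold, and
  -- satisfies both smallness conditions of `exists_adjoint` with four fields.
  obtain ⟨ε, hcrit, hε, hε1, hε2⟩ := (hγ.2.and (hIoo.and (hs1.and hs2))).exists
  have hlt : -ε < ε := by linarith [hε.1]
  have hsub' : ∀ t ∈ Icc (-ε) ε, t ∈ ball (0 : ℝ) r' := fun t ht => by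
    rw [mem_ball_zero_iff, Real.norm_eq_abs]
    exact (abs_le.2 ht).trans_lt hε.2
  have hsub : ∀ t ∈ Icc (-ε) ε, t ∈ ball (0 : ℝ) r := fun t ht => (hball' t (hsub' t ht)).1
  have hcast : ∀ j : Fin 4, chartField (𝓡 7) x₀ (ξ j) = frameRep x₀ ξ (Fin.castLE (by decide) j) :=
    fun j => (frameRep_castLE x₀ j).symm
  obtain ⟨P, hP⟩ := hcrit.exists_adjoint hlt hU hsec
    (u := fun j => u (Fin.castLE (by decide) j))
    (fun j => (huc _).mono hsub) (fun t ht => (hball t (hsub t ht)).2.1)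
    (fun t ht => by
      simp only [hyt]
      refine (hyu t (hsub t ht)).hasDerivWithinAt.congr_deriv ?_
      rw [controlled, sum_fin_seven_eq _ fun k hk => by rw [hu4 t (hsub t ht) k hk, zero_smul]]
      simp only [hcast]) hK0 hRW hfB
    (fun t ht j => (hball' t (hsub' t ht)).2.1 _) (fun t ht => by
      rw [hyt]; exact (hball' t (hsub' t ht)).2.2.2) hε1 hε2
  have h0ε : (0 : ℝ) ∈ Icc (-ε) ε := ⟨by linarith [hε.1], hε.1.le⟩
  rw [← hy0]
  refine h.obstruction_eq_zero hlt h0ε (fun t ht => hyO t (hsub t ht))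
    (fun t ht => (hyu t (hsub t ht)).hasDerivWithinAt) (P := P) (fun t ht => ?_) (hP 0 h0ε).1
    (fun t ht j hj => ?_) (fun t ht => hu4 t (hsub t ht))
    (fun t ht => (hball' t (hsub' t ht)).2.2.1) hκ huκ
  · refine (hP t ht).2.2.congr_deriv ?_
    rw [hyt, sum_fin_seven_eq _ fun k hk => by rw [hu4 t (hsub t ht) k hk, zero_smul]]
    simp only [hcast]
  · have h1 := (hP t ht).2.1 ⟨j, hj⟩
    rw [hyt, hcast] at h1
    exact h1

end NoSingularCurve

end FourSeven

end

theorem theorem5p2 {X : Type*} [TopologicalSpace X] [T2Space X]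
    [ChartedSpace (EuclideanSpace ℝ (Fin 7)) X] [IsManifold (𝓡 7) ∞ X]
    (D : Π x : X, Submodule ℝ (TangentSpace (𝓡 7) x)) (hD : FourSeven.IsHyperbolic D)
    (x₀ : X) (u₀ : TangentSpace (𝓡 7) x₀) (hu₀ : u₀ ∈ FourSeven.charCone D x₀) (hne : u₀ ≠ 0) :
    (FourSeven.IsC3Type D x₀ u₀ →
      (∃ γ : ℝ → X, FourSeven.IsSingularPath (𝓡 7) D γ ∧
        FourSeven.velocity (𝓡 7) γ 0 = ⟨x₀, u₀⟩) ∧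
      (⟨x₀, u₀⟩ : TangentBundle (𝓡 7) X) ∈ FourSeven.singularVelocityCone (𝓡 7) D) ∧
    (FourSeven.IsRegularType D x₀ u₀ →
      (¬ ∃ γ : ℝ → X, FourSeven.IsSingularPath (𝓡 7) D γ ∧
        FourSeven.velocity (𝓡 7) γ 0 = ⟨x₀, u₀⟩) ∧
      (⟨x₀, u₀⟩ : TangentBundle (𝓡 7) X) ∉ FourSeven.singularVelocityCone (𝓡 7) D) := by
  refine ⟨fun hc => ?_, fun hr => ?_⟩
  · obtain ⟨U, ξ, q, κ, η, -, hxU, hξ, hκ, hu, h, hF⟩ := hc.exists_chart hne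
    obtain ⟨γ, hγ, hv⟩ := FourSeven.exists_singularPath hxU hξ hκ hu h hF
    exact ⟨⟨γ, hγ, hv⟩, γ, hγ.1, hv⟩
  · obtain ⟨U, ξ, q, κ, η, hU, hxU, hξ, hκ, hu, h, hF⟩ := hr.exists_chart hne
    -- Stated for singular curves rather than paths, so that it settles both the absence of singular
    -- paths and the statement on the singular velocity cone.
    have key : ∀ γ : ℝ → X, FourSeven.IsSingularCurve (𝓡 7) D γ →
        FourSeven.velocity (𝓡 7) γ 0 = ⟨x₀, u₀⟩ → False := fun γ hγ hv =>
      hF (hγ.obstruction_eq_zero hv hU hxU hξ hκ hu h)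
    exact ⟨fun ⟨γ, hγ, hv⟩ => key γ hγ.1 hv, fun ⟨γ, hγ, hv⟩ => key γ hγ hv⟩
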